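/- **Notation.** $\mathbb N=\{1,2,\dots\}$, $\mathbb N_0=\mathbb N\cup\{0\}$, $U=\mathbb R^{\mathbb N}$; $\gamma$ and $\gamma_N$ are the standard Gaussian product measures on $U$ and $\mathbb R^N$; $X$ is a complex separable Hilbert space; $\mathcal F$ is the set of finitely supported $\nu\in\mathbb N_0^{\mathbb N}$; $p_\nu(1)=\prod_j(1+\nu_j)$. **Holomorphy.** Let $b\in(0,\infty)^{\mathbb N}$, $\xi,\delta>0$. A vector $\varrho\in(0,\infty)^N$ is admissible if $\sum_{j\le N}b_j\varrho_j\le\xi$. A function $u\in L^2(U,X;\gamma)$ is $(b,\xi,\delta,X)$-holomorphic if there are $u_N:\mathbb R^N\to X$, $N\in\mathbb N$, such that: (a) $u_N(y)=u_M(y,0,\dots,0)$ for all $N<M$ and $y\in\mathbb R^N$; (b) for every $N$ and every admissible $\varrho$, $u_N$ extends holomorphically to $\{z\in\mathbb C^N:|\mathrm{Im}\,z_j|<\varrho_j\ \forall j\}$; (c) for every $N$ there is $\varphi_N:\mathbb R^N\to[0,\infty)$ with $\|\varphi_N\|_{L^2(\gamma_N)}\le\delta$ and $\|u_N(y+z)\|_X\le\varphi_N(y)$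 for all $y\in\mathbb R^N$, all admissible $\varrho$ and all $z\in\mathbb C^N$ with $|z_j|<\varrho_j$ for all $j$; (d) $\|u-\tilde u_N\|_{L^2(U,X;\gamma)}\to0$, where $\tilde u_N(y)=u_N(y_1,\dots,y_N)$. One evaluates $u(y_1,\dots,y_N,0,0,\dots):=u_N(y_1,\dots,y_N)$. **Interpolation.** Let $\chi_{n,0},\dots,\chi_{n,n}$ be the roots of the Hermite polynomial of degree $n+1$ (so $\chi_{0,0}=0$), $I_n$ the Lagrange interpolation operator in these points, and $I_{-1}=0$. For finite $\Lambda\subset\mathcal F$ put $\mathbf I_\Lambda=\sum_{\nu\in\Lambda}\bigotimes_j(I_{\nu_j}-I_{\nu_j-1})$. For $\mathbf l=(l_\nu)_{\nu\in\mathcal F}\subset\mathbb N_0$ with finitely many $l_\nu\neq0$, put $\Gamma_j=\{\nu:l_\nu\ge j\}$ and $L=\max_\nu l_\nu$, and $$\mathbf I^{\rm ML}_{\mathbf l}u=\sum_{j=1}^{L}(\mathbf I_{\Gamma_j}-\mathbf I_{\Gamma_{j+1}})u^j,\qquad \mathrm{work}(\mathbf l)=\sum_{j=1}^{L}\mathfrak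 w_j\sum_{\nu\in\Gamma_j}p_\nu(1).$$ **Assumptions.** (1) $(\mathfrak w_l)_{l\in\mathbb N_0}\subset\mathbb N_0$ is strictly increasing, $\mathfrak w_0=0$, and there is $K_{\mathfrak W}\ge1$ such that for all $l\in\mathbb N$: $\sum_{j=0}^l\mathfrak w_j\le K_{\mathfrak W}\mathfrak w_l$, $l\le K_{\mathfrak W}(1+\log\mathfrak w_l)$, $\mathfrak w_l\le K_{\mathfrak W}(1+\mathfrak w_{l-1})$; and for every $s>0$ there is $C_s>0$ with $\sum_{j\ge l}\mathfrak w_j^{-s}\le C_s(1+\mathfrak w_l)^{-s}$ for all $l\in\mathbb N$. (2) $\alpha,\xi,\delta>0$, $0<p_1<2/3$, $p_1\le p_2<1$, and $b_1\in\ell^{p_1}(\mathbb N)$, $b_2\in\ell^{p_2}(\mathbb N)$ have positive entries. (3) $u,u^l\in L^2(U,X;\gamma)$, $l\in\mathbb N$; $u$ is $(b_1,\xi,\delta,X)$-holomorphic and $(b_2,\xi,\delta,X)$-holomorphic (the latter follows from the former if $b_{1,j}\le b_{2,j}$ for all $j$); for every $l\in\mathbb N$, $u-u^l$ is $(b_1,\xi,\delta,X)$-holomorphic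 and $(b_2,\xi,\delta\mathfrak w_l^{-\alpha},X)$-holomorphic. Point values of $u$ and $u-u^l$, and hence of $u^l$, at finitely supported sequences are taken through functions $u_N$ and $(u-u^l)_N$ that witness $(b_1,\xi,\delta,X)$-holomorphy. **Level allocation.** Let $q_1=p_1/(1-p_1)$ and let $r\in\mathbb R$ satisfy $r>2(1+(\alpha+1)q_1)/q_1+3$. For $K>0$ and $i=1,2$ let $\varrho_{i,j}=b_{i,j}^{p_i-1}\,\xi/(4\|b_i\|_{\ell^{p_i}})$ and $$c_\nu=\prod_{j\in\mathrm{supp}\,\nu}\max\{1,K\varrho_{1,j}\}^2\nu_j^{r-3},\qquad d_\nu=\prod_{j\in\mathrm{supp}\,\nu}\max\{1,K\varrho_{2,j}\}^2\nu_j^{r-3}.$$ For $\varepsilon>0$ let $\Lambda_\varepsilon=\{\nu\in\mathcal F:c_\nu^{-1}\ge\varepsilon\}$, let $l_{\varepsilon,\nu}=0$ for $\nu\notin\Lambda_\varepsilon$, and for $\nu\in\Lambda_\varepsilon$ $$l_{\varepsilon,\nu}=\max\Big\{j\in\mathbb N_0:\ \mathfrak w_j\le\varepsilon^{-\frac{1/2-q_1/4}{\alpha}}\,d_\nu^{\frac{-1}{1+2\alpha}}\Big(\sum_{\mu\in\Lambda_\varepsilon}d_\mu^{\frac{-1}{1+2\alpha}}\Big)^{\frac1{2\alpha}}\Big\},\qquad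 \mathbf l_\varepsilon=(l_{\varepsilon,\nu})_{\nu\in\mathcal F}.$$ **Theorem.** Under these assumptions there are constants $K>0$ and $C>0$ such that for every $n\in\mathbb N$ there is $\varepsilon_n\in(0,1]$ for which $\Lambda_{\varepsilon_n}$ is finite, $\mathrm{work}(\mathbf l_{\varepsilon_n})\le n$, and $$\big\|u-\mathbf I^{\rm ML}_{\mathbf l_{\varepsilon_n}}u\big\|_{L^2(U,X;\gamma)}\le C(1+\log n)\,n^{-R},\qquad R=\min\Big\{\alpha,\ \frac{\alpha(p_1^{-1}-3/2)}{\alpha+p_1^{-1}-p_2^{-1}}\Big\}.$$ -/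

import Mathlib

open MeasureTheory ProbabilityTheory Filter Topology

noncomputable section

namespace MLSmolyak

/-- The standard Gaussian measure on `ℝ^N`. -/
def gaussN (N : ℕ) : Measure (Fin N → ℝ) := Measure.pi fun _ => gaussianReal 0 1

/-- The countable product Gaussian measure on `U = ℝ^∞`. -/
def gaussU : Measure (ℕ → ℝ) := Measure.infinitePi fun _ => gaussianReal 0 1

/-- Multiindices: finitely supported sequences of natural numbers. -/
abbrev MIdx : Type := ℕ →₀ ℕ

section Holomorphy

variable {X : Type*} [NormedAddCommGroup X] [InnerProductSpace ℂ X]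

/-- `ρ ∈ (0,∞)^N` is `(b,ξ)`-admissible. -/
def Admissible (b : ℕ → ℝ) (ξ : ℝ) {N : ℕ} (ρ : Fin N → ℝ) : Prop :=
  (∀ j, 0 < ρ j) ∧ ∑ j : Fin N, b j * ρ j ≤ ξ

/-- The product of strips `{z ∈ ℂ^N : |Im z_j| < ρ_j for all j}`. -/
def strip {N : ℕ} (ρ : Fin N → ℝ) : Set (Fin N → ℂ) := {z | ∀ j, |(z j).im| < ρ j}

/-- The open polydisc `{z ∈ ℂ^N : |z_j| < ρ_j for all j}`. -/
def polydisc {N : ℕ} (ρ : Fin N → ℝ) : Set (Fin N → ℂ) := {z | ∀ j, ‖z j‖ < ρ j}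

/-- The real point `y ∈ ℝ^N` as a point of `ℂ^N`. -/
def toC {N : ℕ} (y : Fin N → ℝ) : Fin N → ℂ := fun j => (y j : ℂ)

/-- `(y_1, …, y_N, 0, …, 0) ∈ ℝ^M`, for `N ≤ M`. -/
def padZero {N : ℕ} (M : ℕ) (y : Fin N → ℝ) : Fin M → ℝ :=
  fun j => if h : (j : ℕ) < N then y ⟨j, h⟩ else 0

/-- The finite-dimensional functions `uN N : ℝ^N → X` witness that `u ∈ L²(U,X;γ)` is
`(b,ξ,δ,X)`-holomorphic. The holomorphic extension `F` of `uN N` to a product of strips is unique,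
so the pointwise bound on the polydiscs, with one `φ` for all admissible `ρ`, is stated directly for
each extension. -/
structure HolomorphicFamily (b : ℕ → ℝ) (ξ δ : ℝ) (u : (ℕ → ℝ) → X)
    (uN : ∀ N : ℕ, (Fin N → ℝ) → X) : Prop where
  memLp : MemLp u 2 gaussU
  consistent : ∀ N M : ℕ, 0 < N → N < M → ∀ y : Fin N → ℝ, uN N y = uN M (padZero M y)
  extension : ∀ N : ℕ, 0 < N → ∃ φ : (Fin N → ℝ) → ℝ,
    (∀ y, 0 ≤ φ y) ∧ MemLp φ 2 (gaussN N) ∧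
      eLpNorm φ 2 (gaussN N) ≤ ENNReal.ofReal δ ∧
      ∀ ρ : Fin N → ℝ, Admissible b ξ ρ →
        ∃ F : (Fin N → ℂ) → X, DifferentiableOn ℂ F (strip ρ) ∧
          (∀ y : Fin N → ℝ, F (toC y) = uN N y) ∧
          ∀ y : Fin N → ℝ, ∀ z ∈ polydisc ρ, ‖F (toC y + z)‖ ≤ φ y
  tendsto : Tendsto (fun N : ℕ => eLpNorm (fun y => u y - uN N (fun j : Fin N => y j)) 2 gaussU)
    atTop (𝓝 0)

/-- `(b,ξ,δ,X)`-holomorphy. -/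
def IsHolomorphic (b : ℕ → ℝ) (ξ δ : ℝ) (u : (ℕ → ℝ) → X) : Prop :=
  ∃ uN : ∀ N : ℕ, (Fin N → ℝ) → X, HolomorphicFamily b ξ δ u uN

/-- Point evaluation at a finitely supported sequence,
`u(y_1, …, y_N, 0, 0, …) := uN N (y_1, …, y_N)`, with `N ≥ 1` the least number such that all later
entries vanish (for a consistent family, every larger `N` gives the same value). -/
def evalFin (uN : ∀ N : ℕ, (Fin N → ℝ) → X) (x : ℕ →₀ ℝ) : X :=
  uN (x.support.sup id + 1) (fun j => x j)

end Holomorphy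

section Interpolation

variable {X : Type*} [NormedAddCommGroup X] [InnerProductSpace ℂ X]

/-- The Gauss-Hermite points `χ_{n,0}, …, χ_{n,n}`: the roots of the Hermite polynomial `H_{n+1}`
(whose normalization does not matter here). -/
def nodes (n : ℕ) : Finset ℝ :=
  ((Polynomial.hermite (n + 1)).map (Int.castRingHom ℝ)).roots.toFinset

/-- The tensorized interpolant `I_ν v`. The points with coordinates `χ_{ν_j,μ_j}` are finitely
supported, as `χ_{0,0} = 0`, and the coordinates with `ν_j = 0` contribute the factor `1`. -/
def tensorInterp (ν : MIdx) (v : (ℕ →₀ ℝ) → X) (y : ℕ → ℝ) : X :=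
  ∑ x ∈ ν.support.finsupp (fun j => nodes (ν j)),
    (∏ j ∈ ν.support, (Lagrange.basis (nodes (ν j)) id (x j)).eval (y j)) • v x

/-- `⨂_j (I_{ν_j} - I_{ν_j - 1}) v`, multiplied out (recall `I_{-1} = 0`). -/
def detail (ν : MIdx) (v : (ℕ →₀ ℝ) → X) (y : ℕ → ℝ) : X :=
  ∑ S ∈ ν.support.powerset,
    (-1 : ℝ) ^ S.card • tensorInterp (ν - Finsupp.indicator S (fun _ _ => 1)) v y

/-- The Smolyak interpolant `I_Λ v`, for a finite set `Λ` of multiindices. -/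
def smolyak (Λ : Set MIdx) (v : (ℕ →₀ ℝ) → X) (y : ℕ → ℝ) : X :=
  ∑ᶠ (ν : MIdx) (_ : ν ∈ Λ), detail ν v y

/-- `Γ_j(l) = {ν : l_ν ≥ j}`. -/
def levelSet (l : MIdx → ℕ) (j : ℕ) : Set MIdx := {ν | j ≤ l ν}

/-- The maximal level `L = max_ν l_ν` (for bounded `l`). -/
def maxLevel (l : MIdx → ℕ) : ℕ := sSup (Set.range l)

/-- The multilevel Smolyak interpolant `∑_{j=1}^L (I_{Γ_j} - I_{Γ_{j+1}}) u^j`, where `ul j` is the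
family of finite-dimensional functions through which `u^j` is evaluated. -/
def mlInterp (l : MIdx → ℕ) (ul : ℕ → ∀ N : ℕ, (Fin N → ℝ) → X) (y : ℕ → ℝ) : X :=
  ∑ j ∈ Finset.Icc 1 (maxLevel l),
    (smolyak (levelSet l j) (evalFin (ul j)) y - smolyak (levelSet l (j + 1)) (evalFin (ul j)) y)

/-- `work(l) = ∑_{j=1}^L 𝔴_j ∑_{ν ∈ Γ_j(l)} ∏_i (1 + ν_i)`. -/
def work (w : ℕ → ℕ) (l : MIdx → ℕ) : ℕ :=
  ∑ j ∈ Finset.Icc 1 (maxLevel l),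
    w j * ∑ᶠ (ν : MIdx) (_ : ν ∈ levelSet l j), ν.prod fun _ m => 1 + m

end Interpolation

/-- The assumptions on the sequence `𝔴_0 < 𝔴_1 < …` of work measures. -/
structure WorkSequence (w : ℕ → ℕ) : Prop where
  strictMono : StrictMono w
  zero : w 0 = 0
  growth : ∃ K : ℝ, 1 ≤ K ∧ ∀ l : ℕ, 1 ≤ l →
    (∑ j ∈ Finset.range (l + 1), (w j : ℝ) ≤ K * w l) ∧
    ((l : ℝ) ≤ K * (1 + Real.log (w l))) ∧
    ((w l : ℝ) ≤ K * (1 + w (l - 1)))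
  tail : ∀ r : ℝ, 0 < r → ∃ C : ℝ, 0 < C ∧ ∀ l : ℕ, 1 ≤ l →
    Summable (fun j : ℕ => (w (l + j) : ℝ) ^ (-r)) ∧
    ∑' j : ℕ, (w (l + j) : ℝ) ^ (-r) ≤ C * (1 + (w l : ℝ)) ^ (-r)

/-- `ϱ_j = b_j^{p-1} ξ / (4 ‖b‖_{ℓ^p})`, for a positive sequence `b ∈ ℓ^p`. -/
def rho (b : ℕ → ℝ) (p ξ : ℝ) (j : ℕ) : ℝ :=
  b j ^ (p - 1) * (ξ / (4 * (∑' i, b i ^ p) ^ (1 / p)))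

/-- `∏_{j ∈ supp ν} max {1, K ϱ_j}² ν_j^{r-3}`. -/
def weight (K r : ℝ) (ρ : ℕ → ℝ) (ν : MIdx) : ℝ :=
  ν.prod fun j m => max 1 (K * ρ j) ^ 2 * (m : ℝ) ^ (r - 3)

/-- `Λ_ε = {ν : c_ν⁻¹ ≥ ε}`. -/
def activeSet (c : MIdx → ℝ) (ε : ℝ) : Set MIdx := {ν | ε ≤ (c ν)⁻¹}

open Classical in
/-- The level allocation: `0` off `Λ_ε`, and for `ν ∈ Λ_ε` the largest `j` with
`𝔴_j ≤ ε^{-(1/2-q₁/4)/α} d_ν^{-1/(1+2α)} (∑_{μ ∈ Λ_ε} d_μ^{-1/(1+2α)})^{1/(2α)}`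
(for a finite set `Λ_ε`). -/
def constructLevels (w : ℕ → ℕ) (c d : MIdx → ℝ) (q₁ α ε : ℝ) (ν : MIdx) : ℕ :=
  if ν ∈ activeSet c ε then
    sSup {j : ℕ | (w j : ℝ) ≤ ε ^ (-((1 / 2 - q₁ / 4) / α)) * d ν ^ (-1 / (1 + 2 * α)) *
      (∑ᶠ (μ : MIdx) (_ : μ ∈ activeSet c ε), d μ ^ (-1 / (1 + 2 * α))) ^ (1 / (2 * α))}
  else 0

end MLSmolyak

end

/-! ### Gaussian integration by parts and Hermite polynomials -/

namespace MLSmolyak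
open Polynomial

/-! With the convention u^0 = 0, the error u - I^ML u is u - I_Λ u plus the sum over ν in Λ of the
ν-th details of u - u^{l_ν} (`sub_mlInterp_eq`). Both parts rest on one estimate,
`exists_detail_bound`: if v is (b,ξ,δ)-holomorphic, its ν-th detail has L²-norm at most δ a_ν
weight_ν^{-1/2}, where the weight is built from b and the a_ν are summable and independent of v. Off
Λ_ε one has c_ν^{-1/2} < ε^{1/2}. On Λ_ε the allocated level is maximal, so the next one exceeds the
threshold, and this gives w_l^{-α} d_ν^{-1/2} ≤ C ε^κ with κ = 1/2 - q₁/4 (`level_decay`). The error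
is therefore O(ε^κ). The work is at most C ε^{-κ/α} times the power 1 + 1/(2α) of the sum of p_ν(1)
d_ν^{-1/(1+2α)} over Λ_ε (`work_constructLevels_le`). That sum is O(ε^{-t}), t = `growthExp`,
because it still converges over all ν after multiplication by c_ν^{-t}
(`summable_points_mul_weights`, `sum_activeSet_le`). So the work is O(ε^{-τ}) with τ = κ/α + t(1 +
1/(2α)), and choosing ε such that this bound equals n gives the rate κ/τ, which is at least R
(`rate_le`). No logarithm arises; the factor 1 + log n is slack.

The detail bound starts in one variable. The squared Gaussian L²-norm of the Lagrange basis
polynomial at a node c is (n+1)!/He'(c)². A lower bound for He'(c), from the monotone Sonin energy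
of the Hermite function (`factorial_le_of_node`), makes the norm at most 10(n+1) exp(-c²/4).
Normalized Hermite polynomials grow at most like exp(x²/4), so the exponentials cancel at the nodes
and interpolants of Hermite polynomials grow only polynomially in the degrees. For a function
holomorphic in a strip of half-width ρ, Cauchy estimates and integration by parts give Hermite
coefficients of arbitrary algebraic decay with a factor 1/ρ (`StripBound.decay`); hence the n-th
increment, n ≥ 1, is at most C/ρ times any prescribed negative power of n + 1, times a fixed
function of y. The increment of degree 0 is the value at 0, and averaging over |x| < ρ bounds it at
the cost γ(|x| < ρ)^{-1/2}.

These bounds tensorize (`PolyBound.enorm_tincr_le`), and the product of the costs of the inactive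
directions stays bounded when the radii grow like b_j^{p-1} (`exists_prod_ballMeas_ge`). Such radii
alone only cancel the weight, so the radii are adapted to ν: the k active directions beyond a fixed
index J receive the extra radius ξ/(2 k b_j). The resulting power k^k is absorbed by an auxiliary
summation over k (`detailMajorant`).

Finally, b₂-holomorphy may be witnessed by other finite-dimensional functions than those used for
point evaluation. `HolFam.eq_of_tendsto` shows that there is only one witnessing family, by a
Schwarz lemma in each new variable. -/

/-- The standard Gaussian measure on the real line. -/
noncomputable abbrev gauss : Measure ℝ := gaussianReal 0 1

lemma gaussianPDFReal_std (x : ℝ) :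
    gaussianPDFReal 0 1 x = (Real.sqrt (2 * Real.pi))⁻¹ * Real.exp (-(x ^ 2) / 2) := by
  simp [gaussianPDFReal]

lemma integral_gauss (f : ℝ → ℝ) :
    ∫ x, f x ∂gauss = (Real.sqrt (2 * Real.pi))⁻¹ * ∫ x, f x * Real.exp (-(x ^ 2) / 2) := by
  rw [integral_gaussianReal_eq_integral_smul one_ne_zero, ← integral_const_mul]
  congr 1; ext x
  rw [gaussianPDFReal_std, smul_eq_mul]; ring

lemma integrable_gauss_iff (f : ℝ → ℝ) :
    Integrable f gauss ↔ Integrable (fun x => f x * Real.exp (-(x ^ 2) / 2)) := by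
  rw [gauss, gaussianReal_of_var_ne_zero 0 one_ne_zero,
    integrable_withDensity_iff_integrable_smul' (measurable_gaussianPDF 0 1)
      (ae_of_all _ fun x => gaussianPDF_lt_top)]
  have h : (fun x => (gaussianPDF 0 1 x).toReal • f x) =
      fun x => (Real.sqrt (2 * Real.pi))⁻¹ * (f x * Real.exp (-(x ^ 2) / 2)) := by
    ext x
    rw [toReal_gaussianPDF, gaussianPDFReal_std, smul_eq_mul]; ring
  rw [h]
  exact integrable_const_mul_iff (IsUnit.mk0 _ (by positivity)) _

lemma hasDerivAt_exp_neg_sq (x : ℝ) :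
    HasDerivAt (fun x : ℝ => Real.exp (-(x ^ 2) / 2)) (-x * Real.exp (-(x ^ 2) / 2)) x := by
  have h : HasDerivAt (fun x : ℝ => -(x ^ 2) / 2) (-x) x := by
    have := ((hasDerivAt_pow 2 x).neg).div_const 2
    exact this.congr_deriv (by norm_num; ring)
  simpa [mul_comm] using h.exp

/-- Gaussian integration by parts (Stein's identity). -/
lemma gauss_ibp {f f' : ℝ → ℝ} (hf : ∀ x, HasDerivAt f (f' x) x) (h0 : Integrable f gauss)
    (h1 : Integrable f' gauss) (h2 : Integrable (fun x => x * f x) gauss) :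
    ∫ x, f' x ∂gauss = ∫ x, x * f x ∂gauss := by
  have hd : ∀ x, HasDerivAt (fun x => f x * Real.exp (-(x ^ 2) / 2))
      (f' x * Real.exp (-(x ^ 2) / 2) - (x * f x) * Real.exp (-(x ^ 2) / 2)) x := by
    intro x
    have := (hf x).mul (hasDerivAt_exp_neg_sq x)
    refine this.congr_deriv ?_; ring
  have i1 := (integrable_gauss_iff _).1 h1
  have i2 := (integrable_gauss_iff _).1 h2
  have := integral_eq_zero_of_hasDerivAt_of_integrable hd (i1.sub i2) ((integrable_gauss_iff _).1 h0)
  rw [integral_sub i1 i2, sub_eq_zero] at this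
  rw [integral_gauss, integral_gauss, this]

lemma integrable_pow_gauss (k : ℕ) : Integrable (fun x : ℝ => x ^ k) gauss := by
  rcases Nat.eq_zero_or_pos k with rfl | hk
  · simp
  · have h := (memLp_id_gaussianReal' (μ := 0) (v := 1) (k : ENNReal) (by simp)).integrable_norm_pow
      hk.ne'
    refine h.mono' (by fun_prop) (ae_of_all _ fun x => ?_)
    simp

lemma integrable_poly (P : ℝ[X]) : Integrable (fun x => P.eval x) gauss := by
  induction P using Polynomial.induction_on' with
  | add p q hp hq => simp only [eval_add]; exact hp.add hq
  | monomial n a => simp only [eval_monomial]; exact (integrable_pow_gauss n).const_mul a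

lemma memLp_poly (P : ℝ[X]) : MemLp (fun x => P.eval x) 2 gauss := by
  rw [memLp_two_iff_integrable_sq (by fun_prop)]
  simp only [← eval_pow]
  exact integrable_poly (P ^ 2)

/-- The Gaussian integral of a polynomial. -/
noncomputable def gint (P : ℝ[X]) : ℝ := ∫ x, P.eval x ∂gauss

lemma gint_add (P Q : ℝ[X]) : gint (P + Q) = gint P + gint Q := by
  simp only [gint, eval_add]
  exact integral_add (integrable_poly P) (integrable_poly Q)

lemma gint_sub (P Q : ℝ[X]) : gint (P - Q) = gint P - gint Q := by
  simp only [gint, eval_sub]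
  exact integral_sub (integrable_poly P) (integrable_poly Q)

lemma gint_C_mul (a : ℝ) (P : ℝ[X]) : gint (C a * P) = a * gint P := by
  simp only [gint, eval_mul, eval_C]
  exact integral_const_mul _ _

lemma gint_one : gint 1 = 1 := by simp [gint]

lemma gint_zero : gint 0 = 0 := by simp [gint]

lemma gint_sum {ι : Type*} (s : Finset ι) (P : ι → ℝ[X]) :
    gint (∑ i ∈ s, P i) = ∑ i ∈ s, gint (P i) := by
  classical
  induction s using Finset.induction_on with
  | empty => simp [gint_zero]
  | insert a s ha ih => rw [Finset.sum_insert ha, Finset.sum_insert ha, gint_add, ih]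

lemma gint_sq_nonneg (P : ℝ[X]) : 0 ≤ gint (P ^ 2) := by
  simp only [gint, eval_pow]
  exact integral_nonneg fun x => sq_nonneg _

lemma gint_derivative (P : ℝ[X]) : gint (derivative P) = gint (X * P) := by
  have := gauss_ibp (f := fun x => P.eval x) (f' := fun x => (derivative P).eval x)
    (fun x => P.hasDerivAt x) (integrable_poly P) (integrable_poly _)
    ((integrable_poly (X * P)).congr (ae_of_all _ fun x => by simp))
  simpa [gint] using this

/-- The probabilists' Hermite polynomials with real coefficients. -/
noncomputable def He (n : ℕ) : ℝ[X] := (hermite n).map (Int.castRingHom ℝ)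

lemma He_zero : He 0 = 1 := by simp [He, hermite_zero]

lemma He_one : He 1 = X := by simp [He]

lemma He_succ (n : ℕ) : He (n + 1) = X * He n - derivative (He n) := by
  simp [He, hermite_succ, derivative_map]

lemma He_monic (n : ℕ) : (He n).Monic := (hermite_monic n).map _

lemma natDegree_He (n : ℕ) : (He n).natDegree = n := by
  rw [He, (hermite_monic n).natDegree_map, natDegree_hermite]

lemma derivative_He_succ (n : ℕ) : derivative (He (n + 1)) = ((n : ℝ[X]) + 1) * He n := by
  induction n with
  | zero => simp [He_one, He_zero]
  | succ n ih =>
    rw [He_succ (n + 1), derivative_sub, derivative_mul, derivative_X, ih, derivative_mul]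
    have : derivative ((n : ℝ[X]) + 1) = 0 := by simp
    rw [this, He_succ n]
    push_cast
    ring

lemma derivative_He (n : ℕ) : derivative (He n) = (n : ℝ[X]) * He (n - 1) := by
  cases n with
  | zero => simp [He_zero]
  | succ n => simpa using derivative_He_succ n

lemma X_mul_He (n : ℕ) : X * He n = He (n + 1) + (n : ℝ[X]) * He (n - 1) := by
  rw [He_succ, derivative_He]; ring

/-- The raising operator X - d/dx is the adjoint of d/dx for the Gaussian measure. All orthogonality
relations follow by iterating this. -/
lemma gint_mul_He_succ (P : ℝ[X]) (n : ℕ) :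
    gint (P * He (n + 1)) = gint (derivative P * He n) := by
  have h := gint_derivative (P * He n)
  rw [derivative_mul, gint_add] at h
  rw [He_succ, mul_sub, gint_sub]
  have : P * (X * He n) = X * (P * He n) := by ring
  rw [this, ← h]; ring

lemma gint_mul_He_eq_zero {P : ℝ[X]} {n : ℕ} (h : P.natDegree < n) : gint (P * He n) = 0 := by
  induction n generalizing P with
  | zero => omega
  | succ n ih =>
    rw [gint_mul_He_succ]
    rcases Nat.eq_zero_or_pos P.natDegree with h0 | h0
    · rw [eq_C_of_natDegree_eq_zero h0]; simp [gint_zero]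
    · exact ih (lt_of_lt_of_le (natDegree_derivative_lt h0.ne') (by omega))

lemma gint_He_sq (n : ℕ) : gint (He n * He n) = n.factorial := by
  induction n with
  | zero => simp [He_zero, gint_one]
  | succ n ih =>
    rw [gint_mul_He_succ, derivative_He_succ]
    have : ((n : ℝ[X]) + 1) * He n * He n = C ((n : ℝ) + 1) * (He n * He n) := by simp; ring
    rw [this, gint_C_mul, ih, Nat.factorial_succ]; push_cast; ring

lemma gint_He_mul_He {m n : ℕ} (h : m ≠ n) : gint (He m * He n) = 0 := by
  rcases lt_or_gt_of_ne h with h | h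
  · exact gint_mul_He_eq_zero (by rwa [natDegree_He])
  · rw [mul_comm]; exact gint_mul_He_eq_zero (by rwa [natDegree_He])

lemma gint_monic_mul_He {P : ℝ[X]} (hP : P.Monic) {n : ℕ} (h : P.natDegree = n) :
    gint (P * He n) = n.factorial := by
  have : gint ((P - He n) * He n) = 0 := by
    by_cases h0 : P - He n = 0
    · simp [h0, gint_zero]
    apply gint_mul_He_eq_zero
    by_cases hn : n = 0
    · exfalso; apply h0
      rw [hn] at h
      rw [hn, hP.natDegree_eq_zero.1 h, He_zero, sub_self]
    have := degree_sub_lt_left (p := P) (q := He n)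
      (by rw [degree_eq_natDegree hP.ne_zero, degree_eq_natDegree (He_monic n).ne_zero, h,
        natDegree_He]) hP.ne_zero (by rw [hP.leadingCoeff, (He_monic n).leadingCoeff])
    rw [degree_eq_natDegree h0, degree_eq_natDegree hP.ne_zero, h] at this
    exact_mod_cast this
  rw [sub_mul, gint_sub, sub_eq_zero] at this
  rw [this, gint_He_sq]

lemma exists_He_expansion (n : ℕ) (P : ℝ[X]) (hP : P.natDegree ≤ n) :
    ∃ a : ℕ → ℝ, P = ∑ k ∈ Finset.range (n + 1), C (a k) * He k := by
  induction n generalizing P with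
  | zero =>
    refine ⟨fun _ => P.coeff 0, ?_⟩
    simp only [zero_add, Finset.range_one, Finset.sum_singleton, He_zero, mul_one]
    exact eq_C_of_natDegree_le_zero hP
  | succ n ih =>
    obtain ⟨a, ha⟩ := ih (P - C (P.coeff (n + 1)) * He (n + 1)) (by
      rw [natDegree_le_iff_coeff_eq_zero]
      intro N hN
      rw [coeff_sub, coeff_C_mul]
      rcases Nat.lt_or_ge (n + 1) N with h | h
      · rw [coeff_eq_zero_of_natDegree_lt (lt_of_le_of_lt hP h),
          coeff_eq_zero_of_natDegree_lt (p := He (n + 1)) (by rwa [natDegree_He])]; simp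
      · obtain rfl : N = n + 1 := by omega
        have := (He_monic (n + 1)).coeff_natDegree
        rw [natDegree_He] at this
        rw [this]; simp)
    refine ⟨fun k => if k = n + 1 then P.coeff (n + 1) else a k, ?_⟩
    rw [Finset.sum_range_succ]
    have : ∑ k ∈ Finset.range (n + 1), C (if k = n + 1 then P.coeff (n + 1) else a k) * He k =
        ∑ k ∈ Finset.range (n + 1), C (a k) * He k := by
      refine Finset.sum_congr rfl fun k hk => ?_
      rw [Finset.mem_range] at hk
      rw [if_neg (by omega)]
    rw [this, ← ha]; simp

lemma gint_expansion_mul_He (n : ℕ) (a : ℕ → ℝ) (k : ℕ) (hk : k ∈ Finset.range (n + 1)) :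
    gint ((∑ i ∈ Finset.range (n + 1), C (a i) * He i) * He k) = a k * k.factorial := by
  rw [Finset.sum_mul, gint_sum, Finset.sum_eq_single_of_mem k hk]
  · rw [mul_assoc, gint_C_mul, gint_He_sq]
  · intro j _ hj
    rw [mul_assoc, gint_C_mul, gint_He_mul_He hj, mul_zero]

lemma He_expansion {n : ℕ} {P : ℝ[X]} (hP : P.natDegree ≤ n) :
    P = ∑ k ∈ Finset.range (n + 1), C (gint (P * He k) / k.factorial) * He k := by
  obtain ⟨a, ha⟩ := exists_He_expansion n P hP
  conv_lhs => rw [ha]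
  refine Finset.sum_congr rfl fun k hk => ?_
  rw [ha, gint_expansion_mul_He n a k hk]
  congr 2
  field_simp

lemma gint_sq_expansion (n : ℕ) (a : ℕ → ℝ) :
    gint ((∑ k ∈ Finset.range (n + 1), C (a k) * He k) ^ 2) =
      ∑ k ∈ Finset.range (n + 1), a k ^ 2 * k.factorial := by
  rw [pow_two, Finset.mul_sum, gint_sum]
  refine Finset.sum_congr rfl fun k hk => ?_
  have : (∑ k ∈ Finset.range (n + 1), C (a k) * He k) * (C (a k) * He k) =
      C (a k) * ((∑ k ∈ Finset.range (n + 1), C (a k) * He k) * He k) := by ring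
  rw [this, gint_C_mul, gint_expansion_mul_He n a k hk]; ring

/-- Differentiation shifts the Hermite expansion and multiplies the k-th squared norm by k ≤ n. This
Markov inequality is used to localize the nodes. -/
lemma gint_derivative_sq_le {n : ℕ} {P : ℝ[X]} (hP : P.natDegree ≤ n) :
    gint (derivative P ^ 2) ≤ n * gint (P ^ 2) := by
  obtain ⟨a, ha⟩ := exists_He_expansion n P hP
  cases n with
  | zero =>
    have : derivative P = 0 := by rw [eq_C_of_natDegree_le_zero hP]; simp
    simp [this, gint_zero]
  | succ n =>
    have hd : derivative P = ∑ k ∈ Finset.range (n + 1), C ((a (k + 1)) * (k + 1)) * He k := by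
      rw [ha, derivative_sum, Finset.sum_range_succ']
      have : derivative (C (a 0) * He 0) = 0 := by simp [He_zero]
      rw [this, add_zero]
      refine Finset.sum_congr rfl fun k _ => ?_
      rw [derivative_C_mul, derivative_He_succ]
      simp; ring
    rw [hd, gint_sq_expansion, ha, gint_sq_expansion, Finset.mul_sum,
      Finset.sum_range_succ' _ (n + 1)]
    have h0 : 0 ≤ ((n + 1 : ℕ) : ℝ) * (a 0 ^ 2 * (Nat.factorial 0 : ℕ)) := by positivity
    refine le_trans (Finset.sum_le_sum fun k hk => ?_) (le_add_of_nonneg_right h0)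
    rw [Finset.mem_range] at hk
    have hk' : (k : ℝ) + 1 ≤ n + 1 := by exact_mod_cast hk
    rw [Nat.factorial_succ]; push_cast
    have h1 : 0 ≤ a (k + 1) ^ 2 * ((k : ℝ) + 1) * k.factorial := by positivity
    nlinarith [mul_le_mul_of_nonneg_right hk' h1]

lemma gint_cauchy_schwarz (P Q : ℝ[X]) : gint (P * Q) ^ 2 ≤ gint (P ^ 2) * gint (Q ^ 2) := by
  have h : ∀ t : ℝ, 0 ≤ gint (Q ^ 2) * (t * t) + (2 * gint (P * Q)) * t + gint (P ^ 2) := by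
    intro t
    have := gint_sq_nonneg (P + C t * Q)
    have e : (P + C t * Q) ^ 2 = P ^ 2 + C (2 * t) * (P * Q) + C (t * t) * Q ^ 2 := by
      rw [C_mul, C_mul, show (C (2 : ℝ) : ℝ[X]) = 2 from rfl]; ring
    rw [e, gint_add, gint_add, gint_C_mul, gint_C_mul] at this
    linarith
  have := discrim_le_zero h
  rw [discrim] at this
  linarith

end MLSmolyak

/-! ### Zeros of Hermite polynomials and the quotients by their linear factors -/

namespace MLSmolyak
open Polynomial

lemma continuous_poly_mul_exp (P : ℝ[X]) :
    Continuous fun x => P.eval x * Real.exp (-(x ^ 2) / 2) := by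
  have := P.continuous
  fun_prop

lemma gint_pos_of_nonneg {P : ℝ[X]} (h0 : ∀ x, 0 ≤ P.eval x) (hP : P ≠ 0) : 0 < gint P := by
  have hc := continuous_poly_mul_exp P
  rw [gint, integral_gauss]
  refine mul_pos (by positivity) ?_
  rw [integral_pos_iff_support_of_nonneg (fun x => mul_nonneg (h0 x) (Real.exp_pos _).le)
    ((integrable_gauss_iff _).1 (integrable_poly P))]
  have hs : IsOpen (Function.support fun x => P.eval x * Real.exp (-(x ^ 2) / 2)) :=
    hc.isOpen_support
  refine hs.measure_pos _ ?_
  by_contra hne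
  rw [Set.not_nonempty_iff_eq_empty, Function.support_eq_empty_iff] at hne
  apply hP
  refine Polynomial.funext fun x => ?_
  have := congrFun hne x
  simpa [(Real.exp_pos _).ne'] using this

/-- If He n = q R with q an irreducible quadratic, then q has constant sign, so R He n = q R² has a
nonzero integral. But R has degree below n and is orthogonal to He n. -/
lemma splits_He (n : ℕ) : (He n).Splits := by
  rw [splits_iff_splits]
  right
  intro q hq hdvd
  by_contra hdeg
  have h2 := hq.degree_le_two
  have h0 := degree_pos_of_irreducible hq
  have hnat : q.natDegree = 2 := by
    rw [degree_eq_natDegree hq.ne_zero] at h2 h0 hdeg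
    have a1 : q.natDegree ≤ 2 := by exact_mod_cast h2
    have a2 : 0 < q.natDegree := by exact_mod_cast h0
    have a3 : q.natDegree ≠ 1 := by
      intro h; apply hdeg; rw [h]; rfl
    omega
  have hroot : ∀ x, q.eval x ≠ 0 := by
    intro x hx
    exact hdeg (degree_eq_one_of_irreducible_of_root hq hx)
  obtain ⟨R, hR⟩ := hdvd
  have hR0 : R ≠ 0 := by
    rintro rfl
    exact (He_monic n).ne_zero (by rw [hR, mul_zero])
  have hdegR : R.natDegree < n := by
    have := natDegree_He n
    rw [hR, natDegree_mul hq.ne_zero hR0] at this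
    omega
  have hint := gint_mul_He_eq_zero hdegR
  have hsign : (∀ x, 0 < q.eval x) ∨ (∀ x, q.eval x < 0) := by
    by_contra hcon
    push Not at hcon
    obtain ⟨⟨a, ha⟩, ⟨b, hb⟩⟩ := hcon
    obtain ⟨c, hc⟩ := mem_range_of_exists_le_of_exists_ge q.continuous ⟨a, ha⟩ ⟨b, hb⟩
    exact hroot c hc
  rcases hsign with hs | hs
  · have := gint_pos_of_nonneg (P := R * He n)
      (fun x => by
        rw [hR, eval_mul, eval_mul]
        nlinarith [mul_nonneg (hs x).le (sq_nonneg (R.eval x))])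
      (mul_ne_zero hR0 (He_monic n).ne_zero)
    linarith
  · have := gint_pos_of_nonneg (P := -(R * He n))
      (fun x => by
        rw [hR, eval_neg, eval_mul, eval_mul]
        nlinarith [mul_nonneg (neg_pos.2 (hs x)).le (sq_nonneg (R.eval x))])
      (neg_ne_zero.2 (mul_ne_zero hR0 (He_monic n).ne_zero))
    have h3 : gint (-(R * He n)) = 0 := by
      have := gint_sub 0 (R * He n)
      rw [zero_sub, gint_zero, hint] at this
      simpa using this
    linarith

/-- The three-term recurrence carries a common zero down to He 0 = 1. As He (n + 1)' is a multiple
of He n, this makes all zeros simple. -/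
lemma He_no_common_root (n : ℕ) (x : ℝ) (h1 : (He n).eval x = 0) (h2 : (He (n + 1)).eval x = 0) :
    False := by
  induction n with
  | zero => simp [He_zero] at h1
  | succ n ih =>
    apply ih _ h1
    have := congrArg (eval x) (X_mul_He (n + 1))
    simp only [eval_mul, eval_add, h1, h2, eval_X, mul_zero, zero_add, Nat.add_sub_cancel] at this
    have h3 := mul_eq_zero.1 this.symm
    rcases h3 with h3 | h3
    · have : ((n : ℝ) + 1) = 0 := by simpa using h3
      have : (0 : ℝ) < n + 1 := by positivity
      linarith
    · exact h3

lemma eval_derivative_He_succ (n : ℕ) (x : ℝ) :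
    (derivative (He (n + 1))).eval x = (n + 1) * (He n).eval x := by
  rw [derivative_He_succ]; simp

lemma eval_derivative_He_ne_zero {n : ℕ} {x : ℝ} (h : (He (n + 1)).eval x = 0) :
    (derivative (He (n + 1))).eval x ≠ 0 := by
  rw [eval_derivative_He_succ]
  intro h0
  rcases mul_eq_zero.1 h0 with h1 | h1
  · have : (0 : ℝ) < n + 1 := by positivity
    linarith
  · exact He_no_common_root n x h1 h

lemma nodes_eq (n : ℕ) : nodes n = (He (n + 1)).roots.toFinset := rfl

lemma mem_nodes {n : ℕ} {x : ℝ} : x ∈ nodes n ↔ (He (n + 1)).eval x = 0 := by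
  rw [nodes_eq, Multiset.mem_toFinset, mem_roots (He_monic _).ne_zero, IsRoot]

lemma nodup_roots_He (n : ℕ) : (He (n + 1)).roots.Nodup := by
  rw [Multiset.nodup_iff_count_le_one]
  intro a
  rw [count_roots]
  by_contra hlt
  push Not at hlt
  have := (one_lt_rootMultiplicity_iff_isRoot (He_monic (n + 1)).ne_zero).1 hlt
  exact eval_derivative_He_ne_zero this.1 this.2

lemma card_nodes (n : ℕ) : (nodes n).card = n + 1 := by
  rw [nodes_eq, Multiset.toFinset_card_of_nodup (nodup_roots_He n),
    splits_iff_card_roots.1 (splits_He (n + 1)), natDegree_He]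

/-- The quotient of the Hermite polynomial by the linear factor of a node. -/
noncomputable def nodeQuot (n : ℕ) (c : ℝ) : ℝ[X] := He (n + 1) /ₘ (X - C c)

section NodeQuot
variable {n : ℕ} {c : ℝ}

lemma mul_nodeQuot (hc : (He (n + 1)).eval c = 0) : (X - C c) * nodeQuot n c = He (n + 1) :=
  mul_divByMonic_eq_iff_isRoot.2 hc

lemma natDegree_nodeQuot : (nodeQuot n c).natDegree = n := by
  rw [nodeQuot, natDegree_divByMonic _ (monic_X_sub_C c), natDegree_He, natDegree_X_sub_C]; rfl

lemma nodeQuot_monic (hc : (He (n + 1)).eval c = 0) : (nodeQuot n c).Monic := by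
  have := He_monic (n + 1)
  rw [← mul_nodeQuot hc] at this
  exact (monic_X_sub_C c).of_mul_monic_left this

lemma derivative_eq_nodeQuot (hc : (He (n + 1)).eval c = 0) :
    derivative (He (n + 1)) = nodeQuot n c + (X - C c) * derivative (nodeQuot n c) := by
  conv_lhs => rw [← mul_nodeQuot hc]
  simp [derivative_mul]

lemma eval_nodeQuot (hc : (He (n + 1)).eval c = 0) :
    (nodeQuot n c).eval c = (derivative (He (n + 1))).eval c := by
  rw [derivative_eq_nodeQuot hc]; simp

lemma gint_nodeQuot_sub (hc : (He (n + 1)).eval c = 0) :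
    gint ((X - C c) * nodeQuot n c ^ 2) = 0 := by
  rw [pow_two, ← mul_assoc, mul_nodeQuot hc, mul_comm]
  exact gint_mul_He_eq_zero (by rw [natDegree_nodeQuot]; omega)

/-- Integrate the derivative of Q He (n + 1) by parts, where He (n + 1) = (X - c) Q; every term
other than the integral of Q² is known from orthogonality. Up to the factor He'(c)², this is the
squared norm of a Lagrange basis polynomial. -/
lemma gint_nodeQuot_sq (hc : (He (n + 1)).eval c = 0) :
    gint (nodeQuot n c ^ 2) = (n + 1).factorial := by
  set Q := nodeQuot n c with hQ
  have h1 := gint_derivative (Q * He (n + 1))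
  have h2 : derivative (Q * He (n + 1)) =
      C (2 * ((n : ℝ) + 1)) * (Q * He n) - Q ^ 2 := by
    have e1 : derivative Q * He (n + 1) = Q * (derivative (He (n + 1)) - Q) := by
      rw [derivative_eq_nodeQuot hc]
      conv_lhs => rw [← mul_nodeQuot hc]
      rw [← hQ]; ring
    rw [derivative_mul, e1, derivative_He_succ]
    simp only [map_mul, map_add, C_1, map_natCast]
    rw [show (C (2 : ℝ) : ℝ[X]) = 2 from rfl]; ring
  have h3 : X * (Q * He (n + 1)) = He (n + 1) * He (n + 1) + C c * (Q * He (n + 1)) := by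
    have : X * Q = He (n + 1) + C c * Q := by rw [← mul_nodeQuot hc]; ring
    rw [← mul_assoc, this]; ring
  rw [h2, h3, gint_sub, gint_C_mul, gint_add, gint_C_mul, gint_He_sq,
    gint_mul_He_eq_zero (P := Q) (n := n + 1) (by rw [natDegree_nodeQuot]; omega),
    gint_monic_mul_He (nodeQuot_monic hc) natDegree_nodeQuot] at h1
  have h4 : (((n + 1).factorial : ℕ) : ℝ) = (n + 1) * n.factorial := by
    rw [Nat.factorial_succ]; push_cast; ring
  rw [h4] at h1 ⊢
  linarith

lemma gint_nodeQuot_sub_sq (hc : (He (n + 1)).eval c = 0) :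
    gint ((X - C c) ^ 2 * nodeQuot n c ^ 2) = (n + 1).factorial := by
  rw [← mul_pow, mul_nodeQuot hc, pow_two, gint_He_sq]

lemma gint_X_mul_He_sq (n : ℕ) :
    gint ((X * He (n + 1)) ^ 2) = (2 * n + 3) * (n + 1).factorial := by
  have e : (X * He (n + 1)) ^ 2 = He (n + 2) * He (n + 2) +
      C (2 * ((n : ℝ) + 1)) * (He n * He (n + 2)) + C (((n : ℝ) + 1) ^ 2) * (He n * He n) := by
    rw [X_mul_He]
    simp only [map_mul, map_add, C_1, map_natCast, map_pow]
    rw [show (C (2 : ℝ) : ℝ[X]) = 2 from rfl]; push_cast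
    ring
  rw [e, gint_add, gint_add, gint_C_mul, gint_C_mul, gint_He_sq, gint_He_sq,
    gint_He_mul_He (by omega)]
  rw [Nat.factorial_succ (n + 1), Nat.factorial_succ n]; push_cast; ring

lemma gint_nodeQuot_sub_four (hc : (He (n + 1)).eval c = 0) :
    gint ((X - C c) ^ 4 * nodeQuot n c ^ 2) = (2 * n + 3 + c ^ 2) * (n + 1).factorial := by
  have e : (X - C c) ^ 4 * nodeQuot n c ^ 2 = (X * He (n + 1)) ^ 2 -
      C (2 * c) * ((X * He (n + 1)) * He (n + 1)) + C (c ^ 2) * (He (n + 1) * He (n + 1)) := by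
    rw [← mul_nodeQuot hc]
    simp only [map_mul, map_pow]
    rw [show (C (2 : ℝ) : ℝ[X]) = 2 from rfl]; ring
  have h0 : gint ((X * He (n + 1)) * He (n + 1)) = 0 := by
    have : (X * He (n + 1)) * He (n + 1) =
        He (n + 2) * He (n + 1) + C ((n : ℝ) + 1) * (He n * He (n + 1)) := by
      rw [X_mul_He]; simp; ring
    rw [this, gint_add, gint_C_mul, gint_He_mul_He (by omega), gint_He_mul_He (by omega)]; simp
  rw [e, gint_add, gint_sub, gint_C_mul, gint_C_mul, h0, gint_He_sq, gint_X_mul_He_sq]; ring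

/-- Two evaluations of the squared norm of X Q are compared. Expanding X = (X - c) + c gives (c² +
1) S, and integration by parts gives S + 2⟨X Q, Q'⟩. Cauchy-Schwarz and the Markov inequality for Q'
then yield c⁴ ≤ 4n(c² + 1). -/
lemma node_sq_le (hc : (He (n + 1)).eval c = 0) : c ^ 2 ≤ 4 * n + 1 := by
  set Q := nodeQuot n c with hQ
  have hS : gint (Q ^ 2) = (n + 1).factorial := gint_nodeQuot_sq hc
  set S := gint (Q ^ 2) with hSdef
  have hSpos : 0 < S := by rw [hS]; positivity
  have hD : gint (derivative Q ^ 2) ≤ n * S := gint_derivative_sq_le natDegree_nodeQuot.le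
  have hx : gint ((X * Q) ^ 2) = (c ^ 2 + 1) * S := by
    have e : (X * Q) ^ 2 = (X - C c) ^ 2 * Q ^ 2 + C (2 * c) * ((X - C c) * Q ^ 2) +
        C (c ^ 2) * Q ^ 2 := by
      simp only [map_mul, map_pow]
      rw [show (C (2 : ℝ) : ℝ[X]) = 2 from rfl]; ring
    rw [e, gint_add, gint_add, gint_C_mul, gint_C_mul, gint_nodeQuot_sub_sq hc,
      gint_nodeQuot_sub hc, ← hS]; ring
  have hi : gint ((X * Q) ^ 2) = S + 2 * gint ((X * Q) * derivative Q) := by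
    have e : (X * Q) ^ 2 = X * (X * Q ^ 2) := by ring
    have e2 : derivative (X * Q ^ 2) = Q ^ 2 + C 2 * ((X * Q) * derivative Q) := by
      simp only [derivative_mul, derivative_pow, derivative_X]
      rw [show (C ((2 : ℕ) : ℝ) : ℝ[X]) = 2 from rfl, show (C (2 : ℝ) : ℝ[X]) = 2 from rfl]
      ring
    rw [e, ← gint_derivative, e2, gint_add, gint_C_mul]
  have hcs := gint_cauchy_schwarz (X * Q) (derivative Q)
  rw [hx] at hi hcs
  have hy : gint ((X * Q) * derivative Q) = c ^ 2 / 2 * S := by linarith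
  rw [hy] at hcs
  have h1 : (c ^ 2 / 2 * S) ^ 2 ≤ (c ^ 2 + 1) * S * (n * S) :=
    hcs.trans (mul_le_mul_of_nonneg_left hD (by positivity))
  have h2 : (c ^ 2) ^ 2 ≤ 4 * n * (c ^ 2 + 1) := by
    have : (c ^ 2 / 2 * S) ^ 2 = (c ^ 2) ^ 2 / 4 * S ^ 2 := by ring
    rw [this, show (c ^ 2 + 1) * S * (n * S) = (n * (c ^ 2 + 1)) * S ^ 2 by ring] at h1
    have := le_of_mul_le_mul_right h1 (by positivity)
    linarith
  by_contra hlt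
  push Not at hlt
  nlinarith [sq_nonneg c]

end NodeQuot

end MLSmolyak

/-! ### Sonin energy and the size of the derivative at the nodes -/

namespace MLSmolyak
open Polynomial

lemma hasDerivAt_poly_mul_exp (P : ℝ[X]) (x : ℝ) :
    HasDerivAt (fun x => P.eval x * Real.exp (-(x ^ 2) / 2))
      ((derivative P - X * P).eval x * Real.exp (-(x ^ 2) / 2)) x := by
  refine ((P.hasDerivAt x).mul (hasDerivAt_exp_neg_sq x)).congr_deriv ?_
  simp; ring

lemma integrable_poly_mul_exp (P : ℝ[X]) :
    Integrable (fun x => P.eval x * Real.exp (-(x ^ 2) / 2)) :=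
  (integrable_gauss_iff _).1 (integrable_poly P)

lemma tendsto_poly_mul_exp (P : ℝ[X]) :
    Tendsto (fun x => P.eval x * Real.exp (-(x ^ 2) / 2)) atTop (𝓝 0) :=
  tendsto_zero_of_hasDerivAt_of_integrableOn_Ioi (a := 0)
    (fun x _ => hasDerivAt_poly_mul_exp P x) (integrable_poly_mul_exp _).integrableOn
    (integrable_poly_mul_exp _).integrableOn

lemma derivative_derivative_He (n : ℕ) :
    derivative (derivative (He (n + 1))) =
      X * derivative (He (n + 1)) - ((n : ℝ[X]) + 1) * He (n + 1) := by
  have h := derivative_He_succ n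
  have h2 : derivative (He n) = X * He n - He (n + 1) := by rw [He_succ]; ring
  rw [h, derivative_mul, h2]
  have : derivative ((n : ℝ[X]) + 1) = 0 := by simp
  rw [this]; ring

/-- The polynomial factor of the Sonin energy of a Hermite function. -/
noncomputable def energyPoly (n : ℕ) : ℝ[X] :=
  (derivative (He (n + 1)) - C (1 / 2) * X * He (n + 1)) ^ 2 +
    (C ((n : ℝ) + 3 / 2) - C (1 / 4) * X ^ 2) * He (n + 1) ^ 2

/-- The Hermite function h = He (n + 1) exp(-x²/4) solves h'' + (n + 3/2 - x²/4) h = 0. Its energy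
h'² + (n + 3/2 - x²/4) h² therefore has derivative -(x/2) h², and decreases on the positive
half-line. -/
lemma derivative_energyPoly (n : ℕ) :
    derivative (energyPoly n) - X * energyPoly n = -(C (1 / 2) * X * He (n + 1) ^ 2) := by
  refine Polynomial.funext fun x => ?_
  have hd := congrArg (eval x) (derivative_derivative_He n)
  simp only [eval_sub, eval_mul, eval_X, eval_add, eval_natCast, eval_one] at hd
  simp only [energyPoly, derivative_add, derivative_mul, derivative_sub, derivative_pow,
    derivative_C, derivative_X, eval_sub, eval_add, eval_mul, eval_pow, eval_C, eval_X, hd,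
    eval_neg, eval_zero, eval_one]
  norm_num
  ring

lemma hasDerivAt_energy (n : ℕ) (x : ℝ) :
    HasDerivAt (fun x => (energyPoly n).eval x * Real.exp (-(x ^ 2) / 2))
      (-((C (1 / 2) * X * He (n + 1) ^ 2).eval x * Real.exp (-(x ^ 2) / 2))) x := by
  refine (hasDerivAt_poly_mul_exp _ x).congr_deriv ?_
  rw [derivative_energyPoly, eval_neg]; ring

lemma energy_eq_integral (n : ℕ) (x : ℝ) :
    (energyPoly n).eval x * Real.exp (-(x ^ 2) / 2) =
      ∫ t in Set.Ioi x, (C (1 / 2) * X * He (n + 1) ^ 2).eval t * Real.exp (-(t ^ 2) / 2) := by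
  have h := integral_Ioi_of_hasDerivAt_of_tendsto (a := x)
    (hasDerivAt_energy n x).continuousAt.continuousWithinAt
    (fun t _ => hasDerivAt_energy n t) (integrable_poly_mul_exp _).neg.integrableOn
    (tendsto_poly_mul_exp _)
  rw [integral_neg] at h
  linarith

lemma energy_anti {n : ℕ} {x y : ℝ} (hx : 0 ≤ x) (hxy : x ≤ y) :
    (energyPoly n).eval y * Real.exp (-(y ^ 2) / 2) ≤
      (energyPoly n).eval x * Real.exp (-(x ^ 2) / 2) := by
  rw [energy_eq_integral, energy_eq_integral]
  refine setIntegral_mono_set (integrable_poly_mul_exp _).integrableOn ?_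
    (Set.Ioi_subset_Ioi hxy).eventuallyLE
  refine (ae_restrict_iff' measurableSet_Ioi).2 (ae_of_all _ fun t ht => ?_)
  have h1 : 0 < t := lt_of_le_of_lt hx ht
  simp only [eval_mul, eval_C, eval_X, eval_pow, Pi.zero_apply]
  positivity

/-- The Hermite function, with its Gaussian factor, grows at most linearly from a nonnegative zero
up to the turning point. -/
lemma hermiteFun_sq_le {n : ℕ} {c x : ℝ} (hc : (He (n + 1)).eval c = 0) (hc0 : 0 ≤ c) (hcx : c ≤ x)
    (hx : x ^ 2 ≤ 4 * n + 6) :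
    (He (n + 1)).eval x ^ 2 * Real.exp (-(x ^ 2) / 2) ≤
      ((derivative (He (n + 1))).eval c ^ 2 * Real.exp (-(c ^ 2) / 2)) * (x - c) ^ 2 := by
  set e := (derivative (He (n + 1))).eval c ^ 2 * Real.exp (-(c ^ 2) / 2) with he
  have he0 : 0 ≤ e := by positivity
  have hEc : (energyPoly n).eval c * Real.exp (-(c ^ 2) / 2) = e := by
    simp [energyPoly, hc, he]
  have hexp : ∀ t : ℝ, Real.exp (-(t ^ 2) / 4) ^ 2 = Real.exp (-(t ^ 2) / 2) := by
    intro t; rw [← Real.exp_nat_mul]; congr 1; push_cast; ring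
  have hd : ∀ t, HasDerivAt (fun t => (He (n + 1)).eval t * Real.exp (-(t ^ 2) / 4))
      (((derivative (He (n + 1))).eval t - t / 2 * (He (n + 1)).eval t) *
        Real.exp (-(t ^ 2) / 4)) t := by
    intro t
    have h1 : HasDerivAt (fun x : ℝ => -(x ^ 2) / 4) (-t / 2) t := by
      have := ((hasDerivAt_pow 2 t).neg).div_const 4
      exact this.congr_deriv (by norm_num; ring)
    refine (((He (n + 1)).hasDerivAt t).mul h1.exp).congr_deriv ?_
    ring
  have hb : ∀ t ∈ Set.Icc c x, ‖((derivative (He (n + 1))).eval t - t / 2 * (He (n + 1)).eval t) *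
        Real.exp (-(t ^ 2) / 4)‖ ≤ Real.sqrt e := by
    intro t ht
    refine Real.abs_le_sqrt ?_
    rw [mul_pow, hexp]
    have h2 := energy_anti (n := n) hc0 ht.1
    rw [hEc] at h2
    -- Before the turning point the potential term of the energy is nonnegative, so the energy
    -- dominates h'².
    refine le_trans (mul_le_mul_of_nonneg_right ?_ (Real.exp_pos _).le) h2
    simp only [energyPoly, eval_add, eval_mul, eval_sub, eval_pow, eval_C, eval_X]
    have h3 : t ^ 2 ≤ 4 * n + 6 := by
      have : t ^ 2 ≤ x ^ 2 := by
        have := ht.1; have := ht.2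
        nlinarith
      linarith
    have h4 : 0 ≤ ((n : ℝ) + 3 / 2 - 1 / 4 * t ^ 2) * (He (n + 1)).eval t ^ 2 :=
      mul_nonneg (by linarith) (sq_nonneg _)
    have h5 : t / 2 = 1 / 2 * t := by ring
    rw [h5]; linarith
  have := Convex.norm_image_sub_le_of_norm_hasDerivWithin_le
    (fun t _ => (hd t).hasDerivWithinAt) hb (convex_Icc c x) (Set.left_mem_Icc.2 hcx)
    (Set.right_mem_Icc.2 hcx)
  simp only [hc, zero_mul, sub_zero, Real.norm_eq_abs] at this
  have h6 := pow_le_pow_left₀ (abs_nonneg _) this 2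
  rw [sq_abs, mul_pow, mul_pow, hexp, Real.sq_sqrt he0, sq_abs] at h6
  exact h6

/-- A polynomial minorant of the positive part of x - c: integrated against Q² it involves only the
moments computed above, and so bounds the mass to the right of the node from below. -/
lemma quartic_le_posPart {lam : ℝ} (hlpos : 0 < lam) (x c : ℝ) :
    1 / 2 * (x - c) + 1 / (2 * lam) * (x - c) ^ 2 - 1 / (2 * lam ^ 3) * (x - c) ^ 4 ≤
      if c < x then x - c else 0 := by
  set s := (x - c) / lam with hs
  have hxs : x - c = lam * s := by rw [hs]; field_simp
  have h1 : 1 / 2 * (x - c) + 1 / (2 * lam) * (x - c) ^ 2 - 1 / (2 * lam ^ 3) * (x - c) ^ 4 =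
      lam / 2 * (s + s ^ 2 - s ^ 4) := by
    rw [hxs]; field_simp
  rw [h1]
  split_ifs with h
  · have hs0 : 0 ≤ s := div_nonneg (by linarith) hlpos.le
    rw [hxs]
    have : s ^ 2 - s ^ 4 ≤ s := by
      nlinarith [sq_nonneg (s - 1), sq_nonneg (s ^ 2 - s), mul_nonneg hs0 (sq_nonneg (s - 1)),
        mul_nonneg hs0 (sq_nonneg (s + 1)), mul_nonneg hs0 (sq_nonneg s)]
    nlinarith
  · have hs0 : s ≤ 0 := div_nonpos_of_nonpos_of_nonneg (by linarith) hlpos.le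
    have : s + s ^ 2 - s ^ 4 ≤ 0 := by
      nlinarith [sq_nonneg (s + 1), mul_nonneg (neg_nonneg.2 hs0) (sq_nonneg (s - 1)),
        mul_nonneg (neg_nonneg.2 hs0) (sq_nonneg (s + 1)),
        mul_nonneg (neg_nonneg.2 hs0) (sq_nonneg s), sq_nonneg (s ^ 2 + s)]
    nlinarith

/-- The integral of (x - c) Q² over x > c against exp(-x²/2) is bounded in two ways. From below, the
quartic minorant gives a multiple of (n+1)!/λ. From above, the integrand is h²/(x - c): up to the
turning point it is at most e (x - c) by linear growth of h, and beyond it it is at most a multiple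
of x h², whose integral is governed by the energy e at c. -/
lemma factorial_le_of_nonneg_node {n : ℕ} {c : ℝ} (hc : (He (n + 1)).eval c = 0) (hc0 : 0 ≤ c) :
    ((n + 1).factorial : ℝ) ≤ 100 * (n + 1) ^ 2 *
      ((derivative (He (n + 1))).eval c ^ 2 * Real.exp (-(c ^ 2) / 2)) := by
  set e := (derivative (He (n + 1))).eval c ^ 2 * Real.exp (-(c ^ 2) / 2) with he
  have he0 : 0 ≤ e := by positivity
  set S : ℝ := ((n + 1).factorial : ℝ) with hS
  have hSpos : 0 < S := by positivity
  have hcn := node_sq_le hc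
  set x₀ := Real.sqrt (4 * n + 6) with hx₀
  have hx₀sq : x₀ ^ 2 = 4 * n + 6 := Real.sq_sqrt (by positivity)
  have hx₀pos : 0 < x₀ := Real.sqrt_pos.2 (by positivity)
  have hcx : c < x₀ := lt_of_pow_lt_pow_left₀ 2 hx₀pos.le (by linarith)
  -- This follows from 2 x₀ c ≤ x₀² + c² and x₀² - c² ≥ 5.
  have hgap : 5 / 2 ≤ x₀ * (x₀ - c) := by nlinarith
  set Q := nodeQuot n c with hQ
  have hH : ∀ x, (He (n + 1)).eval x = (x - c) * Q.eval x := by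
    intro x; rw [← mul_nodeQuot hc]; simp [hQ]
  -- With this choice λ² is at least 2(2n + 3 + c²), because c² ≤ 4n + 1; hence the quartic moment
  -- costs at most half of the quadratic one.
  set lam := Real.sqrt (12 * (n + 1)) with hlam
  have hlsq : lam ^ 2 = 12 * (n + 1) := Real.sq_sqrt (by positivity)
  have hlpos : 0 < lam := Real.sqrt_pos.2 (by positivity)
  have hlle : lam ≤ 4 * (n + 1) := by
    refine Real.sqrt_le_iff.2 ⟨by positivity, ?_⟩
    have : (0 : ℝ) ≤ n := by positivity
    nlinarith
  -- the lower bound for the mass to the right of the node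
  set L : ℝ[X] := C (1 / 2) * ((X - C c) * Q ^ 2) + C (1 / (2 * lam)) * ((X - C c) ^ 2 * Q ^ 2) -
    C (1 / (2 * lam ^ 3)) * ((X - C c) ^ 4 * Q ^ 2) with hL
  have hLint : S / (4 * lam) ≤ gint L := by
    rw [hL, gint_sub, gint_add, gint_C_mul, gint_C_mul, gint_C_mul, gint_nodeQuot_sub hc,
      gint_nodeQuot_sub_sq hc, gint_nodeQuot_sub_four hc, ← hS]
    have h1 : (2 * n + 3 + c ^ 2) ≤ lam ^ 2 / 2 := by
      rw [hlsq]; have : (0 : ℝ) ≤ n := by positivity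
      linarith
    have h2 : 1 / (2 * lam ^ 3) * ((2 * n + 3 + c ^ 2) * S) ≤ 1 / (2 * lam ^ 3) * (lam ^ 2 / 2 * S) := by
      gcongr
    have h3 : 1 / (2 * lam ^ 3) * (lam ^ 2 / 2 * S) = S / (4 * lam) := by field_simp; norm_num
    have h4 : 1 / (2 * lam) * S = S / (4 * lam) + S / (4 * lam) := by field_simp; norm_num
    linarith
  have hLle : ∀ x, L.eval x ≤ if c < x then (x - c) * Q.eval x ^ 2 else 0 := by
    intro x
    simp only [hL, eval_sub, eval_add, eval_mul, eval_C, eval_X, eval_pow]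
    have key := quartic_le_posPart hlpos x c
    have h2 : 1 / 2 * ((x - c) * eval x Q ^ 2) + 1 / (2 * lam) * ((x - c) ^ 2 * eval x Q ^ 2) -
        1 / (2 * lam ^ 3) * ((x - c) ^ 4 * eval x Q ^ 2) =
        (1 / 2 * (x - c) + 1 / (2 * lam) * (x - c) ^ 2 - 1 / (2 * lam ^ 3) * (x - c) ^ 4) *
          eval x Q ^ 2 := by ring
    rw [h2]
    have h3 := mul_le_mul_of_nonneg_right key (sq_nonneg (eval x Q))
    refine h3.trans (le_of_eq ?_)
    split_ifs <;> ring
  -- the upper bound by the energy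
  set W : ℝ[X] := C (1 / 2) * X * He (n + 1) ^ 2 with hW
  have hup : ∀ x, L.eval x * Real.exp (-(x ^ 2) / 2) ≤
      (Set.Ioc c x₀).indicator (fun _ => e * x₀) x +
        (Set.Ioi c).indicator (fun x => 4 / 5 * (W.eval x * Real.exp (-(x ^ 2) / 2))) x := by
    intro x
    refine (mul_le_mul_of_nonneg_right (hLle x) (Real.exp_pos _).le).trans ?_
    split_ifs with hx
    · have hx0 : 0 < x := lt_of_le_of_lt hc0 hx
      have hWx : 0 ≤ W.eval x * Real.exp (-(x ^ 2) / 2) := by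
        simp only [hW, eval_mul, eval_C, eval_X, eval_pow]; positivity
      rw [Set.indicator_of_mem (show x ∈ Set.Ioi c from hx)]
      have hxc : 0 < x - c := by linarith
      rcases le_or_gt x x₀ with h | h
      · rw [Set.indicator_of_mem (show x ∈ Set.Ioc c x₀ from ⟨hx, h⟩)]
        have h1 := hermiteFun_sq_le hc hc0 hx.le (by rw [← hx₀sq]; gcongr)
        rw [hH, ← he] at h1
        have h2 : (x - c) * ((x - c) * eval x Q ^ 2 * Real.exp (-(x ^ 2) / 2)) ≤
            (x - c) * (e * (x - c)) := by
          calc _ = ((x - c) * eval x Q) ^ 2 * Real.exp (-(x ^ 2) / 2) := by ring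
            _ ≤ _ := h1
            _ = _ := by ring
        have h3 := le_of_mul_le_mul_left h2 hxc
        have h4 : e * (x - c) ≤ e * x₀ := by gcongr; linarith
        linarith
      · rw [Set.indicator_of_notMem (fun hh => absurd hh.2 (not_le.2 h)), zero_add]
        simp only [hW, eval_mul, eval_C, eval_X, eval_pow]
        rw [hH]
        -- Here x (x - c) ≥ 5/2, that is, 1/(x - c) ≤ (2/5) x, which turns h²/(x - c) into 4/5 of
        -- the energy dissipation (x/2) h².
        have h0 : x₀ * (x₀ - c) ≤ x * (x - c) :=
          mul_le_mul h.le (by linarith) (by linarith) hx0.le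
        have h1 : 0 ≤ 2 / 5 * (x * (x - c)) - 1 := by linarith
        have h2 : 0 ≤ (x - c) * eval x Q ^ 2 * Real.exp (-(x ^ 2) / 2) := by positivity
        have h3 := mul_nonneg h1 h2
        nlinarith only [h3]
    · rw [zero_mul, Set.indicator_of_notMem (fun hh => hx hh.1), Set.indicator_of_notMem (show x ∉ Set.Ioi c from hx), add_zero]
  have hW1 : ∫ t in Set.Ioi c, W.eval t * Real.exp (-(t ^ 2) / 2) = e := by
    rw [hW, ← energy_eq_integral]; simp [energyPoly, hc, he]
  have hint : ∫ x, L.eval x * Real.exp (-(x ^ 2) / 2) ≤ e * x₀ * (x₀ - c) + 4 / 5 * e := by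
    have i1 : Integrable ((Set.Ioc c x₀).indicator (fun _ => e * x₀)) := by
      refine (integrable_indicator_iff measurableSet_Ioc).2 ?_
      exact integrableOn_const (by simp)
    have i2 : Integrable ((Set.Ioi c).indicator
        (fun x => 4 / 5 * (W.eval x * Real.exp (-(x ^ 2) / 2)))) :=
      (((integrable_poly_mul_exp W).const_mul (4 / 5))).indicator measurableSet_Ioi
    refine (integral_mono (integrable_poly_mul_exp L) (i1.add i2) hup).trans (le_of_eq ?_)
    rw [integral_add' i1 i2, integral_indicator measurableSet_Ioc, integral_indicator measurableSet_Ioi,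
      integral_const_mul (4 / 5 : ℝ) (fun x => W.eval x * Real.exp (-(x ^ 2) / 2)), hW1]
    simp [hcx.le]
    ring
  have hpi : 2 ≤ Real.sqrt (2 * Real.pi) :=
    Real.le_sqrt_of_sq_le (by linarith [Real.pi_gt_three])
  have hfin : gint L ≤ 1 / 2 * (e * (4 * n + 7)) := by
    rw [gint, integral_gauss]
    have h0 : 0 ≤ e * (4 * n + 7) := by positivity
    have h1 : ∫ x, L.eval x * Real.exp (-(x ^ 2) / 2) ≤ e * (4 * n + 7) := by
      refine hint.trans ?_
      have : x₀ * (x₀ - c) ≤ 4 * n + 6 := by nlinarith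
      nlinarith [mul_le_mul_of_nonneg_left this he0]
    refine (mul_le_mul_of_nonneg_left h1 (by positivity)).trans ?_
    refine mul_le_mul_of_nonneg_right ?_ h0
    rw [one_div]
    exact inv_anti₀ (by norm_num) hpi
  have h5 := hLint.trans hfin
  rw [div_le_iff₀ (by positivity)] at h5
  have hn0 : (0 : ℝ) ≤ n := by positivity
  calc S ≤ 1 / 2 * (e * (4 * n + 7)) * (4 * lam) := h5
    _ ≤ 1 / 2 * (e * (4 * n + 7)) * (4 * (4 * (n + 1))) := by gcongr
    _ ≤ 100 * (n + 1) ^ 2 * e := by nlinarith [mul_nonneg he0 hn0, mul_nonneg he0 (mul_nonneg hn0 hn0)]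

lemma eval_He_neg (n : ℕ) (x : ℝ) : (He n).eval (-x) = (-1) ^ n * (He n).eval x := by
  induction n using Nat.strong_induction_on with
  | _ n ih =>
    rcases n with _ | _ | n
    · simp [He_zero]
    · simp [He_one]
    · have h := fun y : ℝ => congrArg (eval y) (X_mul_He (n + 1))
      simp only [eval_mul, eval_add, eval_X, Nat.add_sub_cancel, eval_natCast] at h
      have h1 := h x
      have h2 := h (-x)
      rw [ih (n + 1) (by omega), ih n (by omega)] at h2
      have e1 : (-1 : ℝ) ^ (n + 1) = -(-1) ^ n := by ring
      have e2 : (-1 : ℝ) ^ (n + 1 + 1) = (-1) ^ n := by ring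
      rw [e1] at h2
      rw [e2]
      linear_combination (-1) ^ n * h1 - h2

/-- A lower bound for the derivative of a Hermite polynomial at its zeros. -/
lemma factorial_le_of_node {n : ℕ} {c : ℝ} (hc : (He (n + 1)).eval c = 0) :
    ((n + 1).factorial : ℝ) ≤ 100 * (n + 1) ^ 2 *
      ((derivative (He (n + 1))).eval c ^ 2 * Real.exp (-(c ^ 2) / 2)) := by
  rcases le_total 0 c with h | h
  · exact factorial_le_of_nonneg_node hc h
  · have h1 : (He (n + 1)).eval (-c) = 0 := by rw [eval_He_neg, hc, mul_zero]
    have h2 := factorial_le_of_nonneg_node h1 (by linarith)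
    rw [eval_derivative_He_succ, eval_He_neg] at h2
    rw [eval_derivative_He_succ]
    convert h2 using 3
    · rw [mul_pow, mul_pow, mul_pow, ← pow_mul, mul_comm n 2, pow_mul]; norm_num
    · rw [neg_sq]

end MLSmolyak

/-! ### Growth of Lagrange basis polynomials and of interpolated Hermite polynomials -/

namespace MLSmolyak
open Polynomial

/-- The Hermite polynomials, normalized in `L²(gauss)`. -/
noncomputable def hn (n : ℕ) (x : ℝ) : ℝ := (He n).eval x / Real.sqrt n.factorial

lemma sqrt_factorial_pos (n : ℕ) : 0 < Real.sqrt n.factorial :=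
  Real.sqrt_pos.2 (by positivity)

lemma continuous_hn (n : ℕ) : Continuous (hn n) := by
  have := (He n).continuous
  unfold hn
  fun_prop

/-- The sum of the absolute values of the normalized Hermite polynomials up to degree `n`. -/
noncomputable def hsum (n : ℕ) (x : ℝ) : ℝ := ∑ m ∈ Finset.range (n + 1), |hn m x|

lemma hsum_nonneg (n : ℕ) (x : ℝ) : 0 ≤ hsum n x := Finset.sum_nonneg fun _ _ => abs_nonneg _

lemma hsum_le_succ (n : ℕ) (x : ℝ) : hsum n x ≤ hsum (n + 1) x := by
  rw [hsum, hsum, Finset.sum_range_succ _ (n + 1)]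
  exact le_add_of_nonneg_right (abs_nonneg _)

lemma continuous_hsum (n : ℕ) : Continuous (hsum n) := by
  unfold hsum
  exact continuous_finsetSum _ fun m _ => (continuous_hn m).abs

lemma abs_eval_le_hsum {n : ℕ} {P : ℝ[X]} (hP : P.natDegree ≤ n) (y : ℝ) :
    |P.eval y| ≤ Real.sqrt (gint (P ^ 2)) * hsum n y := by
  conv_lhs => rw [He_expansion hP]
  rw [eval_finsetSum, hsum, Finset.mul_sum]
  refine (Finset.abs_sum_le_sum_abs _ _).trans (Finset.sum_le_sum fun k _ => ?_)
  have hk := sqrt_factorial_pos k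
  have hk2 : Real.sqrt (k.factorial : ℝ) ^ 2 = k.factorial := Real.sq_sqrt (by positivity)
  have h1 : |gint (P * He k)| ≤ Real.sqrt (gint (P ^ 2)) * Real.sqrt k.factorial := by
    rw [← Real.sqrt_mul (gint_sq_nonneg P)]
    refine Real.abs_le_sqrt ?_
    have := gint_cauchy_schwarz P (He k)
    rwa [pow_two (He k), gint_He_sq] at this
  rw [eval_mul, eval_C, hn, abs_mul, abs_div, abs_div, abs_of_pos hk,
    abs_of_nonneg (by positivity : (0 : ℝ) ≤ k.factorial)]
  rw [← mul_div_assoc, le_div_iff₀ hk]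
  calc |gint (P * He k)| / k.factorial * |(He k).eval y| * Real.sqrt k.factorial
      ≤ (Real.sqrt (gint (P ^ 2)) * Real.sqrt k.factorial) / k.factorial * |(He k).eval y| *
        Real.sqrt k.factorial := by gcongr
    _ = Real.sqrt (gint (P ^ 2)) * |(He k).eval y| * (Real.sqrt k.factorial ^ 2 / k.factorial) := by
        ring
    _ = _ := by rw [hk2, div_self (by positivity), mul_one]

/-- The Lagrange basis polynomial at the Gauss-Hermite points. -/
noncomputable abbrev lag (n : ℕ) (c : ℝ) : ℝ[X] := Lagrange.basis (nodes n) id c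

lemma lag_eq {n : ℕ} {c : ℝ} (hc : c ∈ nodes n) :
    lag n c = C ((derivative (He (n + 1))).eval c)⁻¹ * nodeQuot n c := by
  have hc' := mem_nodes.1 hc
  have hd := eval_derivative_He_ne_zero hc'
  have hinj : Set.InjOn (id : ℝ → ℝ) (nodes n) := Function.injective_id.injOn
  have hQ0 : (C ((derivative (He (n + 1))).eval c)⁻¹ * nodeQuot n c).degree ≤ n := by
    refine (degree_mul_le _ _).trans ?_
    have h1 := degree_C_le (a := ((derivative (He (n + 1))).eval c)⁻¹)
    have h2 : (nodeQuot n c).degree ≤ n := by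
      have := degree_le_natDegree (p := nodeQuot n c)
      rwa [natDegree_nodeQuot] at this
    simpa using add_le_add h1 h2
  refine Polynomial.eq_of_degrees_lt_of_eval_finset_eq (nodes n) ?_ ?_ ?_
  · rw [Lagrange.degree_basis hinj hc, card_nodes]
    exact_mod_cast Nat.lt_succ_self n
  · rw [card_nodes]
    exact lt_of_le_of_lt hQ0 (by exact_mod_cast Nat.lt_succ_self n)
  · intro x hx
    rcases eq_or_ne x c with rfl | hxc
    · have := Lagrange.eval_basis_self hinj hc
      rw [id] at this
      rw [this, eval_mul, eval_C, eval_nodeQuot hc', inv_mul_cancel₀ hd]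
    · have := Lagrange.eval_basis_of_ne (v := id) (i := c) (j := x) (s := nodes n) hxc.symm hx
      rw [id] at this
      rw [this, eval_mul, eval_C]
      have h2 := congrArg (eval x) (mul_nodeQuot hc')
      rw [mem_nodes.1 hx, eval_mul] at h2
      have h3 : (nodeQuot n c).eval x = 0 := by
        refine (mul_eq_zero.1 h2).resolve_left ?_
        simpa [sub_eq_zero] using hxc
      rw [h3, mul_zero]

/-- The basis polynomial is Q/He'(c), with squared norm (n+1)!/He'(c)², so the lower bound for
He'(c) applies. The factor exp(-c²/4) is essential: it compensates the growth of the interpolated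
function at the node. -/
lemma abs_lag_le {n : ℕ} {c : ℝ} (hc : c ∈ nodes n) (y : ℝ) :
    |(lag n c).eval y| ≤ 10 * (n + 1) * Real.exp (-(c ^ 2) / 4) * hsum n y := by
  have hc' := mem_nodes.1 hc
  have hd := eval_derivative_He_ne_zero hc'
  set D := (derivative (He (n + 1))).eval c with hD
  have hdeg : (lag n c).natDegree ≤ n := by
    rw [lag_eq hc]
    exact (natDegree_C_mul_le _ _).trans natDegree_nodeQuot.le
  refine (abs_eval_le_hsum hdeg y).trans (mul_le_mul_of_nonneg_right ?_ (hsum_nonneg _ _))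
  refine Real.sqrt_le_iff.2 ⟨by positivity, ?_⟩
  have h1 : gint (lag n c ^ 2) = (n + 1).factorial / D ^ 2 := by
    rw [lag_eq hc, mul_pow, ← C_pow, gint_C_mul, gint_nodeQuot_sq hc', ← hD]
    rw [inv_pow]; ring
  have hexp : Real.exp (-(c ^ 2) / 4) ^ 2 = Real.exp (-(c ^ 2) / 2) := by
    rw [← Real.exp_nat_mul]; congr 1; push_cast; ring
  rw [h1, div_le_iff₀ (by positivity), mul_pow, mul_pow, hexp]
  have := factorial_le_of_node hc'
  rw [← hD] at this
  calc _ ≤ _ := this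
    _ = _ := by ring

/-- The function He k² exp(-x²/2) is minus the integral of its derivative over (x, ∞). That
derivative is He k · R times the Gaussian factor, with R = k He (k - 1) - He (k + 1), and the
arithmetic-geometric mean inequality bounds it by full Gaussian integrals of He k² and R². -/
lemma hn_sq_le (k : ℕ) (x : ℝ) : hn k x ^ 2 ≤ 3 * (k + 1) * Real.exp (x ^ 2 / 2) := by
  set R : ℝ[X] := C (k : ℝ) * He (k - 1) - He (k + 1) with hR
  have hRsq : gint (R ^ 2) = (2 * k + 1) * k.factorial := by
    have e : R ^ 2 = C ((k : ℝ) ^ 2) * (He (k - 1) * He (k - 1)) -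
        C (2 * (k : ℝ)) * (He (k - 1) * He (k + 1)) + He (k + 1) * He (k + 1) := by
      rw [hR]; simp only [map_mul, map_pow]
      rw [show (C (2 : ℝ) : ℝ[X]) = 2 from rfl]; ring
    rw [e, gint_add, gint_sub, gint_C_mul, gint_C_mul, gint_He_sq, gint_He_sq,
      gint_He_mul_He (by omega)]
    cases k with
    | zero => simp
    | succ k =>
      rw [Nat.factorial_succ (k + 1), Nat.factorial_succ k]
      simp only [Nat.add_sub_cancel]; push_cast; ring
  have hder : derivative (He k ^ 2) - X * He k ^ 2 = He k * R := by
    have h1 : X * He k = He (k + 1) + C (k : ℝ) * He (k - 1) := by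
      rw [X_mul_He]; simp
    have h2 : derivative (He k) = C (k : ℝ) * He (k - 1) := by rw [derivative_He]; simp
    have : X * He k ^ 2 = (X * He k) * He k := by ring
    rw [derivative_pow, this, h1, h2, hR]
    norm_num
    rw [show (C (2 : ℝ) : ℝ[X]) = 2 from rfl]; ring
  have hFTC := integral_Ioi_of_hasDerivAt_of_tendsto (a := x)
    (hasDerivAt_poly_mul_exp (He k ^ 2) x).continuousAt.continuousWithinAt
    (fun t _ => hasDerivAt_poly_mul_exp (He k ^ 2) t) (integrable_poly_mul_exp _).integrableOn
    (tendsto_poly_mul_exp _)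
  rw [hder] at hFTC
  set W : ℝ[X] := C (1 / 2) * He k ^ 2 + C (1 / 2) * R ^ 2 with hW
  have hle : -∫ t in Set.Ioi x, (He k * R).eval t * Real.exp (-(t ^ 2) / 2) ≤
      ∫ t, W.eval t * Real.exp (-(t ^ 2) / 2) := by
    rw [← integral_neg]
    have hWnn : ∀ t, 0 ≤ W.eval t * Real.exp (-(t ^ 2) / 2) := by
      intro t; simp only [hW, eval_add, eval_mul, eval_C, eval_pow]; positivity
    refine le_trans ?_ (setIntegral_le_integral (s := Set.Ioi x) (integrable_poly_mul_exp W)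
      (ae_of_all _ hWnn))
    refine setIntegral_mono (integrable_poly_mul_exp _).neg.integrableOn
      (integrable_poly_mul_exp W).integrableOn fun t => ?_
    simp only [hW, eval_add, eval_mul, eval_C, eval_pow, ← neg_mul]
    refine mul_le_mul_of_nonneg_right ?_ (Real.exp_pos _).le
    nlinarith [sq_nonneg ((He k).eval t + R.eval t)]
  have hWint : gint W = (k + 1) * k.factorial := by
    rw [hW, gint_add, gint_C_mul, gint_C_mul, hRsq, pow_two, gint_He_sq]; ring
  rw [gint, integral_gauss] at hWint
  have hpi : Real.sqrt (2 * Real.pi) ≤ 3 :=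
    Real.sqrt_le_iff.2 ⟨by norm_num, by nlinarith [Real.pi_lt_d2]⟩
  have hpi0 : 0 < Real.sqrt (2 * Real.pi) := Real.sqrt_pos.2 (by positivity)
  have hI : ∫ t, W.eval t * Real.exp (-(t ^ 2) / 2) =
      Real.sqrt (2 * Real.pi) * ((k + 1) * k.factorial) := by
    rw [← hWint]; field_simp
  have hkey : (He k).eval x ^ 2 * Real.exp (-(x ^ 2) / 2) ≤ 3 * ((k + 1) * k.factorial) := by
    rw [hFTC, hI, zero_sub, neg_neg, eval_pow] at hle
    exact hle.trans (mul_le_mul_of_nonneg_right hpi (by positivity))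
  rw [hn, div_pow, Real.sq_sqrt (by positivity), div_le_iff₀ (by positivity)]
  have hee : Real.exp (-(x ^ 2) / 2) * Real.exp (x ^ 2 / 2) = 1 := by
    rw [← Real.exp_add]; simp [neg_div]
  calc (He k).eval x ^ 2
      = (He k).eval x ^ 2 * Real.exp (-(x ^ 2) / 2) * Real.exp (x ^ 2 / 2) := by
        rw [mul_assoc, hee, mul_one]
    _ ≤ 3 * ((k + 1) * k.factorial) * Real.exp (x ^ 2 / 2) := by gcongr
    _ = _ := by ring

lemma abs_hn_le (k : ℕ) (x : ℝ) : |hn k x| ≤ 2 * (k + 1) * Real.exp (x ^ 2 / 4) := by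
  refine abs_le_of_sq_le_sq ?_ (by positivity)
  have hexp : Real.exp (x ^ 2 / 4) ^ 2 = Real.exp (x ^ 2 / 2) := by
    rw [← Real.exp_nat_mul]; congr 1; push_cast; ring
  rw [mul_pow, hexp]
  refine (hn_sq_le k x).trans (mul_le_mul_of_nonneg_right ?_ (Real.exp_pos _).le)
  have : (0 : ℝ) ≤ k := by positivity
  nlinarith

lemma hsum_le (n : ℕ) (x : ℝ) : hsum n x ≤ 2 * (n + 1) ^ 2 * Real.exp (x ^ 2 / 4) := by
  have : ∀ m ∈ Finset.range (n + 1), |hn m x| ≤ 2 * (n + 1) * Real.exp (x ^ 2 / 4) := by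
    intro m hm
    refine (abs_hn_le m x).trans ?_
    have : (m : ℝ) ≤ n := by exact_mod_cast Nat.lt_succ_iff.1 (Finset.mem_range.1 hm)
    gcongr
  refine (Finset.sum_le_card_nsmul _ _ _ this).trans (le_of_eq ?_)
  rw [Finset.card_range, nsmul_eq_mul]; push_cast; ring

section Interp
variable {Y : Type*} [AddCommGroup Y] [Module ℝ Y]

/-- Lagrange interpolation in the Gauss-Hermite points, evaluated at `y`. -/
noncomputable def interp (n : ℕ) (y : ℝ) (f : ℝ → Y) : Y :=
  ∑ x ∈ nodes n, (lag n x).eval y • f x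

/-- The increments of the interpolation operators, evaluated at `y`. -/
noncomputable def incr : ℕ → ℝ → (ℝ → Y) → Y
  | 0, y, f => interp 0 y f
  | n + 1, y, f => interp (n + 1) y f - interp n y f

lemma sum_incr (n : ℕ) (y : ℝ) (f : ℝ → Y) :
    ∑ k ∈ Finset.range (n + 1), incr k y f = interp n y f := by
  induction n with
  | zero => simp [incr]
  | succ n ih => rw [Finset.sum_range_succ, ih, incr]; abel

end Interp

lemma interp_hn_of_le {n k : ℕ} (h : k ≤ n) (y : ℝ) : interp n y (hn k) = hn k y := by
  have h1 := Lagrange.eq_interpolate (s := nodes n) (v := id) (f := He k)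
    Function.injective_id.injOn (by
      rw [card_nodes, degree_eq_natDegree (He_monic k).ne_zero, natDegree_He]
      exact_mod_cast Nat.lt_succ_of_le h)
  have h2 := congrArg (eval y) h1
  rw [Lagrange.interpolate_apply, eval_finsetSum] at h2
  rw [hn, h2, interp, Finset.sum_div]
  refine Finset.sum_congr rfl fun x _ => ?_
  rw [eval_mul, eval_C, smul_eq_mul, hn, id]; ring

/-- At each of the n + 1 nodes the factors exp(-x²/4) and exp(x²/4) cancel. -/
lemma abs_interp_le {n : ℕ} {f : ℝ → ℝ} {M : ℝ} (hf : ∀ x, |f x| ≤ M * Real.exp (x ^ 2 / 4))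
    (y : ℝ) : |interp n y f| ≤ 10 * (n + 1) ^ 2 * M * hsum n y := by
  have : ∀ x ∈ nodes n, |(lag n x).eval y • f x| ≤ 10 * (n + 1) * M * hsum n y := by
    intro x hx
    rw [smul_eq_mul, abs_mul]
    have hee : Real.exp (-(x ^ 2) / 4) * Real.exp (x ^ 2 / 4) = 1 := by
      rw [← Real.exp_add]; simp [neg_div]
    calc |(lag n x).eval y| * |f x|
        ≤ (10 * (n + 1) * Real.exp (-(x ^ 2) / 4) * hsum n y) * (M * Real.exp (x ^ 2 / 4)) :=
          mul_le_mul (abs_lag_le hx y) (hf x) (abs_nonneg _)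
            (mul_nonneg (by positivity) (hsum_nonneg _ _))
      _ = 10 * (n + 1) * M * hsum n y * (Real.exp (-(x ^ 2) / 4) * Real.exp (x ^ 2 / 4)) := by ring
      _ = _ := by rw [hee, mul_one]
  refine (Finset.abs_sum_le_sum_abs _ _).trans ((Finset.sum_le_card_nsmul _ _ _ this).trans
    (le_of_eq ?_))
  rw [card_nodes, nsmul_eq_mul]; push_cast; ring

lemma abs_interp_hn_le (n k : ℕ) (y : ℝ) :
    |interp n y (hn k)| ≤ 20 * (n + 1) ^ 2 * (k + 1) * hsum n y := by
  refine (abs_interp_le (M := 2 * (k + 1)) (abs_hn_le k) y).trans (le_of_eq ?_)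
  ring

lemma incr_hn_eq_zero {n k : ℕ} (h : k ≤ n) (y : ℝ) : incr (n + 1) y (hn k) = 0 := by
  rw [incr, interp_hn_of_le h, interp_hn_of_le (h.trans n.le_succ), sub_self]

lemma abs_incr_hn_le (n k : ℕ) (y : ℝ) :
    |incr (n + 1) y (hn k)| ≤ 40 * (n + 2) ^ 2 * (k + 1) * hsum (n + 1) y := by
  rw [incr]
  refine (abs_sub _ _).trans ?_
  have h1 := abs_interp_hn_le (n + 1) k y
  have h2 := abs_interp_hn_le n k y
  have h3 : 20 * ((n : ℝ) + 1) ^ 2 * (k + 1) * hsum n y ≤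
      20 * ((n : ℝ) + 2) ^ 2 * (k + 1) * hsum (n + 1) y := by
    have := hsum_le_succ n y
    have := hsum_nonneg n y
    gcongr; norm_num
  push_cast at h1
  rw [show (n : ℝ) + 1 + 1 = n + 2 by ring] at h1
  linarith

end MLSmolyak

/-! ### Polynomials determine continuous functions of moderate growth -/

namespace MLSmolyak

/-- The exponential is expanded into its power series and integrated termwise, dominated by |d x|
exp(|t||x|). -/
lemma integral_mul_cexp_eq_zero {d : ℝ → ℝ} (hm : Measurable d)
    (hexp : ∀ t : ℝ, Integrable (fun x => |d x| * Real.exp (t * |x|)) gauss)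
    (h0 : ∀ k : ℕ, ∫ x, d x * x ^ k ∂gauss = 0) (t : ℝ) :
    ∫ x, (d x : ℂ) * Complex.exp (t * x * Complex.I) ∂gauss = 0 := by
  have hs := hasSum_integral_of_dominated_convergence (μ := gauss)
    (F := fun (k : ℕ) x => (d x : ℂ) * ((t * x * Complex.I) ^ k / k.factorial))
    (f := fun x => (d x : ℂ) * Complex.exp (t * x * Complex.I))
    (fun k x => |d x| * ((|t| * |x|) ^ k / k.factorial))
    (fun k => by fun_prop)
    (fun k => ae_of_all _ fun x => by
      simp [mul_pow])
    (ae_of_all _ fun x => (Real.summable_pow_div_factorial _).mul_left _)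
    ((hexp |t|).congr (ae_of_all _ fun x => by
      simp only [tsum_mul_left]
      rw [Real.exp_eq_exp_ℝ, NormedSpace.exp_eq_tsum_div]))
    (ae_of_all _ fun x => by
      refine HasSum.mul_left _ ?_
      rw [Complex.exp_eq_exp_ℂ]
      exact NormedSpace.expSeries_div_hasSum_exp _)
  have hz : ∀ k : ℕ, ∫ x, (d x : ℂ) * ((t * x * Complex.I) ^ k / k.factorial) ∂gauss = 0 := by
    intro k
    have : ∀ x : ℝ, (d x : ℂ) * ((t * x * Complex.I) ^ k / k.factorial) =
        ((t * Complex.I) ^ k / k.factorial) * ((d x * x ^ k : ℝ) : ℂ) := by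
      intro x; push_cast; ring
    simp_rw [this]
    rw [integral_const_mul, integral_complex_ofReal, h0]; simp
  simp only [hz] at hs
  exact hs.unique hasSum_zero

/-- Polynomials determine continuous functions of moderate growth. -/
lemma eq_zero_of_integral_pow_eq_zero {d : ℝ → ℝ} (hd : Continuous d)
    (hexp : ∀ t : ℝ, Integrable (fun x => |d x| * Real.exp (t * |x|)) gauss)
    (h0 : ∀ k : ℕ, ∫ x, d x * x ^ k ∂gauss = 0) (x : ℝ) : d x = 0 := by
  have hm := hd.measurable
  have hint : Integrable d gauss := by
    have := hexp 0
    simp only [zero_mul, Real.exp_zero, mul_one] at this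
    exact (integrable_norm_iff hm.aestronglyMeasurable).1 this
  let f₁ : ℝ → NNReal := fun x => (d x).toNNReal
  let f₂ : ℝ → NNReal := fun x => (-d x).toNNReal
  have hf₁ : Measurable f₁ := hm.real_toNNReal
  have hf₂ : Measurable f₂ := hm.neg.real_toNNReal
  have hfin : ∀ e : ℝ → ℝ, Integrable e gauss →
      ∫⁻ x, ((e x).toNNReal : ENNReal) ∂gauss ≠ ⊤ := fun e he => he.lintegral_lt_top.ne
  have hF₁ : IsFiniteMeasure (gauss.withDensity fun x => (f₁ x : ENNReal)) :=
    isFiniteMeasure_withDensity (hfin d hint)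
  have hF₂ : IsFiniteMeasure (gauss.withDensity fun x => (f₂ x : ENNReal)) :=
    isFiniteMeasure_withDensity (hfin _ hint.neg)
  -- The measures with the positive and the negative part of d as densities have the same
  -- characteristic function.
  have heq : gauss.withDensity (fun x => (f₁ x : ENNReal)) =
      gauss.withDensity fun x => (f₂ x : ENNReal) := by
    apply Measure.ext_of_charFun
    ext t
    rw [charFun_apply_real, charFun_apply_real, integral_withDensity_eq_integral_smul hf₁,
      integral_withDensity_eq_integral_smul hf₂, ← sub_eq_zero, ← integral_sub]
    · rw [← integral_mul_cexp_eq_zero hm hexp h0 t]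
      congr 1; ext x
      have : (d x : ℂ) = ((f₁ x : ℝ) : ℂ) - ((f₂ x : ℝ) : ℂ) := by
        rw [← Complex.ofReal_sub]
        congr 1
        simp only [f₁, f₂, Real.coe_toNNReal']
        rcases le_total 0 (d x) with h | h
        · rw [max_eq_left h, max_eq_right (by linarith)]; ring
        · rw [max_eq_right h, max_eq_left (by linarith)]; ring
      rw [this, NNReal.smul_def, NNReal.smul_def, Complex.real_smul, Complex.real_smul]
      ring
    all_goals
      refine hint.norm.mono' (by fun_prop) (ae_of_all _ fun x => ?_)
      rw [NNReal.smul_def, norm_smul]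
      have : ‖Complex.exp (t * x * Complex.I)‖ = 1 := by
        rw [← Complex.ofReal_mul]; exact Complex.norm_exp_ofReal_mul_I _
      rw [this, mul_one]
      simp only [f₁, f₂, Real.norm_eq_abs]
      rw [Real.coe_toNNReal', abs_of_nonneg (le_max_right _ _)]
      first
        | exact max_le (le_abs_self _) (abs_nonneg _)
        | exact max_le (neg_le_abs _) (abs_nonneg _)
  rw [withDensity_eq_iff (by fun_prop) (by fun_prop) (hfin d hint)] at heq
  have hae : d =ᵐ[gauss] fun _ => 0 := by
    filter_upwards [heq] with y hy
    have h2 : f₁ y = f₂ y := by exact_mod_cast hy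
    simp only [f₁, f₂] at h2
    rcases le_total 0 (d y) with h | h
    · rw [Real.toNNReal_of_nonpos (by linarith : -d y ≤ 0)] at h2
      exact le_antisymm (Real.toNNReal_eq_zero.1 h2) h
    · rw [Real.toNNReal_of_nonpos h] at h2
      have := Real.toNNReal_eq_zero.1 h2.symm
      linarith
  have hvol : d =ᵐ[volume] fun _ => 0 :=
    (gaussianReal_absolutelyContinuous' 0 one_ne_zero).ae_eq hae
  exact congrFun ((hd.ae_eq_iff_eq volume continuous_const).1 hvol) x

end MLSmolyak

/-! ### Hermite coefficients: decay and pointwise expansion -/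

namespace MLSmolyak
open Polynomial

lemma integral_mul_sq_le {f h : ℝ → ℝ} (hf : MemLp f 2 gauss) (hh : MemLp h 2 gauss) :
    (∫ x, f x * h x ∂gauss) ^ 2 ≤ (∫ x, f x ^ 2 ∂gauss) * ∫ x, h x ^ 2 ∂gauss := by
  have i1 := hf.integrable_sq
  have i2 := hh.integrable_sq
  have i3 : Integrable (fun x => f x * h x) gauss := hf.integrable_mul hh
  have key : ∀ t : ℝ, 0 ≤ (∫ x, h x ^ 2 ∂gauss) * (t * t) + (2 * ∫ x, f x * h x ∂gauss) * t +
      ∫ x, f x ^ 2 ∂gauss := by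
    intro t
    have e : ∫ x, (f x + t * h x) ^ 2 ∂gauss = (∫ x, h x ^ 2 ∂gauss) * (t * t) +
        (2 * ∫ x, f x * h x ∂gauss) * t + ∫ x, f x ^ 2 ∂gauss := by
      have : ∀ x, (f x + t * h x) ^ 2 = (t * t) * h x ^ 2 + (2 * t) * (f x * h x) + f x ^ 2 := by
        intro x; ring
      simp_rw [this]
      have i23 : Integrable (fun x => (t * t) * h x ^ 2 + (2 * t) * (f x * h x)) gauss :=
        (i2.const_mul _).add (i3.const_mul _)
      rw [integral_add i23 i1,
        integral_add (i2.const_mul _) (i3.const_mul _), integral_const_mul, integral_const_mul]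
      ring
    rw [← e]
    exact integral_nonneg fun x => sq_nonneg _
  have := discrim_le_zero key
  rw [discrim] at this
  linarith

lemma memLp_hn (k : ℕ) : MemLp (hn k) 2 gauss := by
  have := (memLp_poly (He k)).mul_const (Real.sqrt k.factorial)⁻¹
  exact this

lemma integral_hn_mul_hn (j k : ℕ) : ∫ x, hn j x * hn k x ∂gauss = if j = k then 1 else 0 := by
  have : ∀ x, hn j x * hn k x =
      (Real.sqrt j.factorial * Real.sqrt k.factorial)⁻¹ * (He j * He k).eval x := by
    intro x; rw [hn, hn, eval_mul]; field_simp
  simp_rw [this]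
  rw [integral_const_mul]
  change _ * gint (He j * He k) = _
  split_ifs with h
  · subst h
    rw [gint_He_sq, Real.mul_self_sqrt (by positivity)]
    field_simp
  · rw [gint_He_mul_He h, mul_zero]

lemma integral_hn_sq (k : ℕ) : ∫ x, hn k x ^ 2 ∂gauss = 1 := by
  simp_rw [pow_two]
  rw [integral_hn_mul_hn, if_pos rfl]

/-- The Hermite coefficients of a function. -/
noncomputable def hcoef (f : ℝ → ℝ) (k : ℕ) : ℝ := ∫ x, f x * hn k x ∂gauss

lemma abs_hcoef_le {f : ℝ → ℝ} (hf : MemLp f 2 gauss) {M : ℝ} (hM : 0 ≤ M)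
    (h : ∫ x, f x ^ 2 ∂gauss ≤ M ^ 2) (k : ℕ) : |hcoef f k| ≤ M := by
  refine abs_le_of_sq_le_sq ?_ hM
  have := integral_mul_sq_le hf (memLp_hn k)
  rw [integral_hn_sq, mul_one] at this
  exact this.trans h

lemma hcoef_succ {f f' : ℝ → ℝ} (hd : ∀ x, HasDerivAt f (f' x) x) (hf : MemLp f 2 gauss)
    (hf' : MemLp f' 2 gauss) (k : ℕ) :
    hcoef f (k + 1) = hcoef f' k / Real.sqrt (k + 1) := by
  have ip : ∀ {u : ℝ → ℝ}, MemLp u 2 gauss → ∀ P : ℝ[X],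
      Integrable (fun x => u x * P.eval x) gauss := fun hu P => hu.integrable_mul (memLp_poly P)
  have h := gauss_ibp (f := fun x => f x * (He k).eval x)
    (f' := fun x => f' x * (He k).eval x + f x * (derivative (He k)).eval x)
    (fun x => (hd x).mul ((He k).hasDerivAt x)) (ip hf _) ((ip hf' _).add (ip hf _))
    ((ip hf (X * He k)).congr (ae_of_all _ fun x => by simp; ring))
  rw [integral_add (ip hf' _) (ip hf _)] at h
  have h2 : ∫ x, f x * (He (k + 1)).eval x ∂gauss = ∫ x, f' x * (He k).eval x ∂gauss := by
    have e : ∀ x, f x * (He (k + 1)).eval x =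
        x * (f x * (He k).eval x) - f x * (derivative (He k)).eval x := by
      intro x; rw [He_succ]; simp; ring
    simp_rw [e]
    rw [integral_sub ((ip hf (X * He k)).congr (ae_of_all _ fun x => by simp; ring)) (ip hf _)]
    linarith
  have e1 : ∀ (u : ℝ → ℝ) (m : ℕ), hcoef u m =
      (∫ x, u x * (He m).eval x ∂gauss) / Real.sqrt m.factorial := by
    intro u m
    rw [hcoef, ← integral_div]
    congr 1; ext x; rw [hn]; ring
  rw [e1, e1, h2, Nat.factorial_succ, div_div]
  congr 1
  push_cast
  rw [mul_comm, Real.sqrt_mul (by positivity)]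

section Tower

variable {g : ℕ → ℝ → ℝ}

/-- Each integration by parts lowers the index by one and produces the square root of the old index;
the product of these roots is the root of a descending factorial. -/
lemma abs_hcoef_mul_sqrt_le (hd : ∀ j x, HasDerivAt (g j) (g (j + 1) x) x)
    (hL : ∀ j, MemLp (g j) 2 gauss) (j k : ℕ) :
    |hcoef (g 0) (k + j)| * Real.sqrt ((k + j).descFactorial j) = |hcoef (g j) k| := by
  suffices H : ∀ i, |hcoef (g i) (k + j)| * Real.sqrt ((k + j).descFactorial j) =
      |hcoef (g (i + j)) k| by simpa using H 0
  induction j with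
  | zero => simp
  | succ j ih =>
    intro i
    have h1 := ih (i + 1)
    rw [show i + (j + 1) = i + 1 + j by ring, ← h1, ← add_assoc,
      hcoef_succ (hd i) (hL i) (hL (i + 1)), Nat.succ_descFactorial_succ, abs_div]
    have : (0 : ℝ) < Real.sqrt ((k + j : ℕ) + 1) := Real.sqrt_pos.2 (by positivity)
    push_cast at this ⊢
    rw [Real.sqrt_mul (by positivity), abs_of_pos this]
    field_simp

/-- One derivative suffices for k < 2s. For larger k, 2s derivatives gain s powers of the index, as
each is worth a square root. Every coefficient with k ≥ 1 is thus controlled by at least one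
derivative, which later provides the factor 1/ρ. -/
lemma abs_hcoef_decay (hd : ∀ j x, HasDerivAt (g j) (g (j + 1) x) x)
    (hL : ∀ j, MemLp (g j) 2 gauss) {s : ℕ} {M : ℝ} (hM : 0 ≤ M)
    (h1 : ∫ x, g 1 x ^ 2 ∂gauss ≤ M ^ 2) (h2 : ∫ x, g (2 * s) x ^ 2 ∂gauss ≤ M ^ 2) {k : ℕ}
    (hk : 1 ≤ k) : |hcoef (g 0) k| ≤ M * (2 * s + 1) ^ s / (k + 1) ^ s := by
  rw [le_div_iff₀ (by positivity)]
  rcases lt_or_ge k (2 * s) with hlt | hge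
  · have hb : |hcoef (g 0) k| ≤ M := by
      obtain ⟨m, rfl⟩ : ∃ m, k = m + 1 := ⟨k - 1, by omega⟩
      have e := abs_hcoef_mul_sqrt_le hd hL 1 m
      have e2 := abs_hcoef_le (hL 1) hM h1 m
      rw [← e] at e2
      refine le_trans (le_mul_of_one_le_right (abs_nonneg _) ?_) e2
      rw [Real.one_le_sqrt]
      simp
    have : ((k : ℝ) + 1) ≤ 2 * s + 1 := by exact_mod_cast (by omega : k + 1 ≤ 2 * s + 1)
    gcongr
  · obtain ⟨m, rfl⟩ : ∃ m, k = m + 2 * s := ⟨k - 2 * s, by omega⟩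
    have e := abs_hcoef_mul_sqrt_le hd hL (2 * s) m
    have e2 := abs_hcoef_le (hL (2 * s)) hM h2 m
    rw [← e] at e2
    have h3 : ((m : ℝ) + 1) ^ s ≤ Real.sqrt ((m + 2 * s).descFactorial (2 * s)) := by
      refine Real.le_sqrt_of_sq_le ?_
      have := Nat.pow_sub_le_descFactorial (m + 2 * s) (2 * s)
      rw [show m + 2 * s + 1 - 2 * s = m + 1 by omega] at this
      rw [← pow_mul, mul_comm s 2]
      exact_mod_cast this
    have h4 : ((m + 2 * s : ℕ) : ℝ) + 1 ≤ (2 * s + 1) * (m + 1) := by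
      push_cast
      have : (0 : ℝ) ≤ (s : ℝ) * m := by positivity
      nlinarith
    calc |hcoef (g 0) (m + 2 * s)| * (((m + 2 * s : ℕ) : ℝ) + 1) ^ s
        ≤ |hcoef (g 0) (m + 2 * s)| * ((2 * s + 1) * (m + 1)) ^ s := by gcongr
      _ = (|hcoef (g 0) (m + 2 * s)| * (m + 1) ^ s) * (2 * s + 1) ^ s := by
        rw [mul_pow]; ring
      _ ≤ (|hcoef (g 0) (m + 2 * s)| * Real.sqrt ((m + 2 * s).descFactorial (2 * s))) *
          (2 * s + 1) ^ s := by gcongr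
      _ ≤ M * (2 * s + 1) ^ s := by gcongr

end Tower

lemma integrable_exp_sq_mul_exp_abs (t : ℝ) :
    Integrable (fun x : ℝ => Real.exp (x ^ 2 / 4) * Real.exp (t * |x|)) gauss := by
  rw [integrable_gauss_iff]
  have h := (integrable_exp_neg_mul_sq (b := 1 / 8) (by norm_num)).const_mul (Real.exp (2 * t ^ 2))
  refine h.mono' (by fun_prop) (ae_of_all _ fun x => ?_)
  rw [Real.norm_of_nonneg (by positivity), ← Real.exp_add, ← Real.exp_add, ← Real.exp_add]
  apply Real.exp_le_exp.2
  have := sq_nonneg (|x| - 4 * t)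
  rw [sub_sq, sq_abs] at this
  nlinarith

lemma integrable_mul_exp_abs {f : ℝ → ℝ} (hf : MemLp f 2 gauss) (t : ℝ) :
    Integrable (fun x => |f x| * Real.exp (t * |x|)) gauss := by
  refine hf.norm.integrable_mul (q := 2) (g := fun x => Real.exp (t * |x|)) ?_
  rw [memLp_two_iff_integrable_sq (by fun_prop)]
  have h := integrable_exp_sq_mul_exp_abs (2 * t)
  refine h.mono' (by fun_prop) (ae_of_all _ fun x => ?_)
  rw [Real.norm_of_nonneg (by positivity), ← Real.exp_nat_mul]
  push_cast
  rw [← mul_assoc]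
  exact le_mul_of_one_le_left (Real.exp_pos _).le (Real.one_le_exp (by positivity))

lemma summable_inv_succ_pow {m : ℕ} (hm : 2 ≤ m) : Summable fun k : ℕ => 1 / ((k : ℝ) + 1) ^ m := by
  have := (summable_nat_add_iff 1).2 (Real.summable_one_div_nat_pow.2 (show 1 < m by omega))
  simpa using this

/-- The Hermite series converges pointwise to the function. -/
lemma hasSum_hermite {f : ℝ → ℝ} (hc : Continuous f) (hf : MemLp f 2 gauss) {s : ℕ} (hs : 3 ≤ s)
    {B : ℝ} (hB : ∀ k, |hcoef f k| ≤ B / (k + 1) ^ s) (y : ℝ) :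
    HasSum (fun k => hcoef f k * hn k y) (f y) := by
  have hB0 : 0 ≤ B := by simpa using (abs_nonneg _).trans (hB 0)
  have hterm : ∀ k y, ‖hcoef f k * hn k y‖ ≤
      2 * B * (1 / ((k : ℝ) + 1) ^ 2) * Real.exp (y ^ 2 / 4) := by
    intro k y
    rw [norm_mul, Real.norm_eq_abs, Real.norm_eq_abs]
    have h1 : B / ((k : ℝ) + 1) ^ s ≤ B / ((k : ℝ) + 1) ^ 3 := by
      have : (1 : ℝ) ≤ k + 1 := by linarith [(Nat.cast_nonneg k : (0 : ℝ) ≤ k)]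
      gcongr
    calc _ ≤ (B / ((k : ℝ) + 1) ^ 3) * (2 * (k + 1) * Real.exp (y ^ 2 / 4)) :=
          mul_le_mul ((hB k).trans h1) (abs_hn_le k y) (abs_nonneg _) (by positivity)
      _ = _ := by field_simp
  have hsum2 := summable_inv_succ_pow le_rfl
  have hsummable : ∀ y, Summable fun k => hcoef f k * hn k y := fun y =>
    Summable.of_norm_bounded ((hsum2.mul_left (2 * B)).mul_right (Real.exp (y ^ 2 / 4)))
      fun k => hterm k y
  set T : ℝ → ℝ := fun y => ∑' k, hcoef f k * hn k y with hT
  have hTc : Continuous T := by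
    rw [continuous_iff_continuousAt]
    intro y₀
    have hcont : ContinuousOn T (Metric.ball 0 (|y₀| + 1)) := by
      refine continuousOn_tsum
        (u := fun k : ℕ => 2 * B * (1 / ((k : ℝ) + 1) ^ 2) * Real.exp ((|y₀| + 1) ^ 2 / 4))
        (fun k => ((continuous_hn k).const_mul _).continuousOn)
        ((hsum2.mul_left (2 * B)).mul_right _) fun k y hy => ?_
      refine (hterm k y).trans ?_
      rw [Metric.mem_ball, dist_zero_right, Real.norm_eq_abs] at hy
      have : y ^ 2 ≤ (|y₀| + 1) ^ 2 := by
        rw [← sq_abs y]; gcongr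
      gcongr
    exact hcont.continuousAt (Metric.isOpen_ball.mem_nhds (by simp))
  have hTle : ∀ y, |T y| ≤ (∑' k : ℕ, 2 * B * (1 / ((k : ℝ) + 1) ^ 2)) * Real.exp (y ^ 2 / 4) := by
    intro y
    have := tsum_of_norm_bounded ((hsum2.mul_left (2 * B)).hasSum.mul_right (Real.exp (y ^ 2 / 4)))
      fun k => hterm k y
    simpa using this
  set A := ∑' k : ℕ, 2 * B * (1 / ((k : ℝ) + 1) ^ 2)
  have hTexp : ∀ t : ℝ, Integrable (fun x => |T x| * Real.exp (t * |x|)) gauss := by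
    intro t
    refine ((integrable_exp_sq_mul_exp_abs t).const_mul A).mono' (by fun_prop)
      (ae_of_all _ fun x => ?_)
    rw [Real.norm_of_nonneg (by positivity), ← mul_assoc]
    exact mul_le_mul_of_nonneg_right (hTle x) (Real.exp_pos _).le
  have hTpoly : ∀ P : ℝ[X], Integrable (fun x => T x * P.eval x) gauss := by
    intro P
    induction P using Polynomial.induction_on' with
    | add p q hp hq =>
      simp only [eval_add, mul_add]
      exact hp.add hq
    | monomial n a =>
      refine ((hTexp n).const_mul |a|).mono' (by fun_prop) (ae_of_all _ fun x => ?_)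
      simp only [eval_monomial, norm_mul, Real.norm_eq_abs, norm_pow]
      have h1 : |x| ^ n ≤ Real.exp (n * |x|) := by
        rw [Real.exp_nat_mul]
        have := Real.add_one_le_exp |x|
        gcongr; linarith
      calc |T x| * (|a| * |x| ^ n) = |a| * (|T x| * |x| ^ n) := by ring
        _ ≤ _ := by gcongr
  have hTcoef : ∀ m, ∫ x, T x * hn m x ∂gauss = hcoef f m := by
    intro m
    have hi : ∀ k, Integrable (fun x => hcoef f k * hn k x * hn m x) gauss := by
      intro k
      simp only [mul_assoc]
      exact ((memLp_hn k).integrable_mul (memLp_hn m)).const_mul _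
    have hsm : Summable fun k => ∫ x, ‖hcoef f k * hn k x * hn m x‖ ∂gauss := by
      refine Summable.of_nonneg_of_le (fun k => integral_nonneg fun x => norm_nonneg _) (fun k => ?_)
        (hsum2.mul_left B)
      have h1 : ∀ x, ‖hcoef f k * hn k x * hn m x‖ = |hcoef f k| * (|hn k x| * |hn m x|) := by
        intro x; simp only [norm_mul, Real.norm_eq_abs]; ring
      simp_rw [h1]
      rw [integral_const_mul]
      have h2 : ∫ x, |hn k x| * |hn m x| ∂gauss ≤ 1 := by
        have h3 := integral_mul_sq_le (memLp_hn k).norm (memLp_hn m).norm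
        simp only [Real.norm_eq_abs, sq_abs, integral_hn_sq, mul_one] at h3
        exact le_of_sq_le_sq (by simpa using h3) zero_le_one
      have h4 : B / ((k : ℝ) + 1) ^ s ≤ B / ((k : ℝ) + 1) ^ 2 := by
        have : (1 : ℝ) ≤ k + 1 := by linarith [(Nat.cast_nonneg k : (0 : ℝ) ≤ k)]
        gcongr; omega
      calc |hcoef f k| * ∫ x, |hn k x| * |hn m x| ∂gauss ≤ |hcoef f k| * 1 := by gcongr
        _ ≤ B * (1 / ((k : ℝ) + 1) ^ 2) := by
          rw [mul_one, mul_one_div]; exact (hB k).trans h4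
    have h5 := hasSum_integral_of_summable_integral_norm hi hsm
    have h6 : ∀ k, ∫ x, hcoef f k * hn k x * hn m x ∂gauss = if k = m then hcoef f m else 0 := by
      intro k
      simp only [mul_assoc]
      rw [integral_const_mul, integral_hn_mul_hn]
      split_ifs with h
      · rw [h, mul_one]
      · rw [mul_zero]
    simp only [h6, tsum_mul_right] at h5
    exact h5.unique (by simpa using hasSum_ite_eq m (hcoef f m))
  -- The series T has the same Hermite coefficients as f, so f - T is orthogonal to all polynomials.
  have hdz : ∀ x, f x - T x = 0 := by
    refine eq_zero_of_integral_pow_eq_zero (hc.sub hTc) (fun t => ?_) (fun k => ?_)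
    · refine ((integrable_mul_exp_abs hf t).add (hTexp t)).mono' (by fun_prop)
        (ae_of_all _ fun x => ?_)
      rw [Real.norm_of_nonneg (by positivity)]
      simp only [Pi.add_apply]
      rw [← add_mul]
      exact mul_le_mul_of_nonneg_right (abs_sub _ _) (Real.exp_pos _).le
    · have hfp : ∀ P : ℝ[X], Integrable (fun x => f x * P.eval x) gauss := fun P =>
        hf.integrable_mul (memLp_poly P)
      have hH : ∀ m, ∫ x, (f x - T x) * (He m).eval x ∂gauss = 0 := by
        intro m
        have e : ∀ u : ℝ → ℝ, ∫ x, u x * (He m).eval x ∂gauss =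
            (∫ x, u x * hn m x ∂gauss) * Real.sqrt m.factorial := by
          intro u
          rw [← integral_mul_const]
          congr 1; ext x
          have := (sqrt_factorial_pos m).ne'
          rw [hn]; field_simp
        simp only [sub_mul]
        rw [integral_sub (hfp _) (hTpoly _), e f, e T, hTcoef, hcoef, sub_self]
      obtain ⟨a, ha⟩ := exists_He_expansion k (X ^ k) (by simp)
      have h7 : ∀ x, (f x - T x) * x ^ k =
          ∑ i ∈ Finset.range (k + 1), a i * ((f x - T x) * (He i).eval x) := by
        intro x
        have := congrArg (eval x) ha
        rw [eval_finsetSum] at this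
        simp only [eval_pow, eval_X, eval_mul, eval_C] at this
        rw [this, Finset.mul_sum]
        exact Finset.sum_congr rfl fun i _ => by ring
      simp_rw [h7]
      rw [integral_finsetSum _ fun i _ => ?_]
      · simp [integral_const_mul, hH]
      · simp only [sub_mul]
        exact ((hfp _).sub (hTpoly _)).const_mul _
  have : f y = T y := by linarith [hdz y]
  rw [this]
  exact (hsummable y).hasSum

end MLSmolyak

/-! ### Interpolation increments of functions holomorphic in a strip -/

namespace MLSmolyak

section Linear
variable {Y Z : Type*} [AddCommGroup Y] [Module ℝ Y] [AddCommGroup Z] [Module ℝ Z]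

lemma map_interp (L : Y →ₗ[ℝ] Z) (n : ℕ) (y : ℝ) (f : ℝ → Y) :
    L (interp n y f) = interp n y fun x => L (f x) := by
  simp [interp]

lemma map_incr (L : Y →ₗ[ℝ] Z) (n : ℕ) (y : ℝ) (f : ℝ → Y) :
    L (incr n y f) = incr n y fun x => L (f x) := by
  cases n with
  | zero => exact map_interp L 0 y f
  | succ n => rw [incr, incr, map_sub, map_interp, map_interp]

lemma nodes_zero : nodes 0 = {0} := by
  ext x
  rw [mem_nodes]
  simp [He_one]

lemma interp_zero (y : ℝ) (f : ℝ → Y) : interp 0 y f = f 0 := by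
  simp [interp, lag, nodes_zero]

lemma incr_zero (y : ℝ) (f : ℝ → Y) : incr 0 y f = f 0 := interp_zero y f

end Linear

lemma hasSum_interp {a : ℕ → ℝ} {φ : ℕ → ℝ → ℝ} {f : ℝ → ℝ}
    (h : ∀ x, HasSum (fun k => a k * φ k x) (f x)) (n : ℕ) (y : ℝ) :
    HasSum (fun k => a k * interp n y (φ k)) (interp n y f) := by
  have := hasSum_sum (s := nodes n) fun x _ => (h x).mul_left ((lag n x).eval y)
  have e : (fun k => a k * interp n y (φ k)) =
      fun k => ∑ x ∈ nodes n, (lag n x).eval y * (a k * φ k x) := by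
    ext k
    unfold interp
    rw [Finset.mul_sum]
    exact Finset.sum_congr rfl fun x _ => by rw [smul_eq_mul]; ring
  rw [e]
  exact this

lemma hasSum_incr {a : ℕ → ℝ} {φ : ℕ → ℝ → ℝ} {f : ℝ → ℝ}
    (h : ∀ x, HasSum (fun k => a k * φ k x) (f x)) (n : ℕ) (y : ℝ) :
    HasSum (fun k => a k * incr n y (φ k)) (incr n y f) := by
  cases n with
  | zero => exact hasSum_interp h 0 y
  | succ n =>
    simp only [incr, mul_sub]
    exact (hasSum_interp h _ y).sub (hasSum_interp h _ y)

/-- `∑ (k+1)⁻²`. -/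
noncomputable def zetaTwo : ℝ := ∑' k : ℕ, 1 / ((k : ℝ) + 1) ^ 2

lemma zetaTwo_pos : 0 < zetaTwo :=
  (summable_inv_succ_pow le_rfl).tsum_pos (fun k => by positivity) 0 (by norm_num)

section Scalar
variable {f : ℝ → ℝ} {t : ℕ} {B : ℝ}

lemma hasSum_hermite_of_decay (hc : Continuous f) (hf : MemLp f 2 gauss)
    (hB : ∀ k, 1 ≤ k → |hcoef f k| ≤ B / (k + 1) ^ (t + 7)) (y : ℝ) :
    HasSum (fun k => hcoef f k * hn k y) (f y) := by
  refine hasSum_hermite hc hf (s := t + 7) (by omega) (B := max B |hcoef f 0|) (fun k => ?_) y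
  rcases Nat.eq_zero_or_pos k with rfl | hk
  · simp
  · refine (hB k hk).trans ?_
    gcongr
    exact le_max_left _ _

/-- The increment annihilates the Hermite polynomials of degree at most n. In the remaining terms, t
+ 2 powers of k + 1 ≥ n + 2 yield the decay and absorb the growth (n + 2)² of the interpolants; the
other powers absorb their factor k + 1 and make the series converge. -/
lemma abs_incr_le_of_decay (hc : Continuous f) (hf : MemLp f 2 gauss) (hB0 : 0 ≤ B)
    (hB : ∀ k, 1 ≤ k → |hcoef f k| ≤ B / (k + 1) ^ (t + 7)) (n : ℕ) (y : ℝ) :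
    |incr (n + 1) y f| ≤ 40 * zetaTwo * B / (n + 2) ^ t * hsum (n + 1) y := by
  have hS := hasSum_incr (hasSum_hermite_of_decay hc hf hB) (n + 1) y
  have hG := hsum_nonneg (n + 1) y
  have hterm : ∀ k : ℕ, ‖hcoef f k * incr (n + 1) y (hn k)‖ ≤
      40 * B / (n + 2) ^ t * hsum (n + 1) y * (1 / ((k : ℝ) + 1) ^ 2) := by
    intro k
    rcases le_or_gt k n with h | h
    · rw [incr_hn_eq_zero h, mul_zero, norm_zero]
      positivity
    · rw [norm_mul, Real.norm_eq_abs, Real.norm_eq_abs]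
      have h1 : (n : ℝ) + 2 ≤ k + 1 := by exact_mod_cast (by omega : n + 2 ≤ k + 1)
      calc _ ≤ (B / ((k : ℝ) + 1) ^ (t + 7)) * (40 * (n + 2) ^ 2 * (k + 1) * hsum (n + 1) y) :=
            mul_le_mul (hB k (by omega)) (abs_incr_hn_le n k y) (abs_nonneg _) (by positivity)
        _ ≤ (B / (((k : ℝ) + 1) ^ 2 * ((k : ℝ) + 1) ^ 3 * ((n : ℝ) + 2) ^ (t + 2))) *
            (40 * (n + 2) ^ 2 * (k + 1) * hsum (n + 1) y) := by
          rw [show t + 7 = 2 + 3 + (t + 2) by ring, pow_add _ (2 + 3), pow_add _ 2 3]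
          gcongr
        _ = 40 * B / (n + 2) ^ t * hsum (n + 1) y * (1 / ((k : ℝ) + 1) ^ 2) *
              (1 / ((k : ℝ) + 1) ^ 2) := by
          rw [pow_add _ t 2]; field_simp
        _ ≤ _ := by
          refine mul_le_of_le_one_right (by positivity) ?_
          rw [div_le_one (by positivity)]
          exact one_le_pow₀ (by linarith [(Nat.cast_nonneg k : (0 : ℝ) ≤ k)])
  have := tsum_of_norm_bounded ((summable_inv_succ_pow le_rfl).hasSum.mul_left _) hterm
  rw [hS.tsum_eq, Real.norm_eq_abs] at this
  refine this.trans (le_of_eq ?_)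
  rw [← zetaTwo]; ring

/-- Dominated convergence in the Hermite series: each term is reproduced exactly once n ≥ k. For k >
n the interpolant of the k-th polynomial is O((k + 1)⁵) at fixed y, which is why seven powers of
decay are required. -/
lemma tendsto_interp_of_decay (hc : Continuous f) (hf : MemLp f 2 gauss) (hB0 : 0 ≤ B)
    (hB : ∀ k, 1 ≤ k → |hcoef f k| ≤ B / (k + 1) ^ (t + 7)) (y : ℝ) :
    Tendsto (fun n => interp n y f) atTop (𝓝 (f y)) := by
  have hf' := hasSum_hermite_of_decay hc hf hB
  have e1 : ∀ n, interp n y f = f y + ∑' k, hcoef f k * (interp n y (hn k) - hn k y) := by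
    intro n
    have := (hasSum_interp hf' n y).sub (hf' y)
    simp only [← mul_sub] at this
    rw [this.tsum_eq]; ring
  simp_rw [e1]
  have hz : Tendsto (fun n : ℕ => ∑' k, hcoef f k * (interp n y (hn k) - hn k y)) atTop
      (𝓝 (∑' _ : ℕ, (0 : ℝ))) := by
    refine tendsto_tsum_of_dominated_convergence
      (bound := fun k : ℕ => 42 * B * Real.exp (y ^ 2 / 4) * (1 / ((k : ℝ) + 1) ^ 2))
      ((summable_inv_succ_pow le_rfl).mul_left _) (fun k => ?_) (Eventually.of_forall fun n k => ?_)
    · refine tendsto_const_nhds.congr' ?_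
      filter_upwards [eventually_ge_atTop k] with n hn
      rw [interp_hn_of_le hn, sub_self, mul_zero]
    · rcases le_or_gt k n with h | h
      · rw [interp_hn_of_le h, sub_self, mul_zero, norm_zero]
        positivity
      · have h1 : (n : ℝ) + 1 ≤ k + 1 := by exact_mod_cast (by omega : n + 1 ≤ k + 1)
        have hk1 : (1 : ℝ) ≤ k + 1 := by linarith [(Nat.cast_nonneg k : (0 : ℝ) ≤ k)]
        have h2 : |interp n y (hn k) - hn k y| ≤ 42 * (k + 1) ^ 5 * Real.exp (y ^ 2 / 4) := by
          refine (abs_sub _ _).trans ?_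
          calc _ ≤ 20 * ((n : ℝ) + 1) ^ 2 * (k + 1) * hsum n y + 2 * (k + 1) * Real.exp (y ^ 2 / 4) :=
                add_le_add (abs_interp_hn_le n k y) (abs_hn_le k y)
            _ ≤ 20 * ((k : ℝ) + 1) ^ 2 * (k + 1) * (2 * (k + 1) ^ 2 * Real.exp (y ^ 2 / 4)) +
                2 * (k + 1) ^ 5 * Real.exp (y ^ 2 / 4) := by
              have h3 : hsum n y ≤ 2 * ((k : ℝ) + 1) ^ 2 * Real.exp (y ^ 2 / 4) :=
                (hsum_le n y).trans (by gcongr)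
              have h4 : ((k : ℝ) + 1) ≤ (k + 1) ^ 5 := le_self_pow₀ hk1 (by norm_num)
              have := hsum_nonneg n y
              gcongr
            _ = _ := by ring
        rw [norm_mul, Real.norm_eq_abs, Real.norm_eq_abs]
        calc _ ≤ (B / ((k : ℝ) + 1) ^ (t + 7)) * (42 * (k + 1) ^ 5 * Real.exp (y ^ 2 / 4)) :=
              mul_le_mul (hB k (by omega)) h2 (abs_nonneg _) (by positivity)
          _ ≤ (B / ((k : ℝ) + 1) ^ 7) * (42 * (k + 1) ^ 5 * Real.exp (y ^ 2 / 4)) := by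
            gcongr
            · omega
          _ = _ := by field_simp
  rw [tsum_zero] at hz
  simpa using hz.const_add (f y)

end Scalar

/-- The `L²`-norm of an `[0,∞]`-valued function. -/
noncomputable def l2 {Ω : Type*} [MeasurableSpace Ω] (μ : Measure Ω) (φ : Ω → ENNReal) : ENNReal :=
  (∫⁻ x, φ x ^ 2 ∂μ) ^ (1 / 2 : ℝ)

lemma l2_sq {Ω : Type*} [MeasurableSpace Ω] (μ : Measure Ω) (φ : Ω → ENNReal) :
    l2 μ φ ^ 2 = ∫⁻ x, φ x ^ 2 ∂μ := by
  rw [l2, ← ENNReal.rpow_natCast, ← ENNReal.rpow_mul]; norm_num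

section Vector
variable {X : Type*} [NormedAddCommGroup X] [NormedSpace ℂ X]

/-- Holomorphy in a strip, with the values in discs around real points bounded by `φ`. -/
structure StripBound (ρ : ℝ) (φ : ℝ → ENNReal) (f : ℂ → X) : Prop where
  diff : DifferentiableOn ℂ f {z | |z.im| < ρ}
  bound : ∀ y : ℝ, ∀ z : ℂ, ‖z‖ < ρ → ‖f (y + z)‖ₑ ≤ φ y

lemma isOpen_strip_one (ρ : ℝ) : IsOpen {z : ℂ | |z.im| < ρ} :=
  isOpen_lt (Complex.continuous_im.abs) continuous_const

lemma StripBound.enorm_iteratedDeriv_le [CompleteSpace X] {ρ : ℝ} (hρ : 0 < ρ)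
    {φ : ℝ → ENNReal} {f : ℂ → X}
    (h : StripBound ρ φ f) (j : ℕ) (y : ℝ) :
    ‖iteratedDeriv j f y‖ₑ ≤ ENNReal.ofReal (j.factorial * (2 / ρ) ^ j) * φ y := by
  have hpos : 0 < (j.factorial : ℝ) * (2 / ρ) ^ j := by positivity
  rcases eq_or_ne (φ y) ⊤ with htop | hfin
  · rw [htop, ENNReal.mul_top (ENNReal.ofReal_pos.2 hpos).ne']
    exact le_top
  have hsub : Metric.closedBall (y : ℂ) (ρ / 2) ⊆ {z : ℂ | |z.im| < ρ} := by
    intro z hz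
    rw [Metric.mem_closedBall, dist_eq_norm] at hz
    have h1 := Complex.abs_im_le_norm (z - y)
    simp only [Complex.sub_im, Complex.ofReal_im, sub_zero] at h1
    show |z.im| < ρ
    linarith
  have hC := Complex.norm_iteratedDeriv_le_of_forall_mem_sphere_norm_le (C := (φ y).toReal) j
    (half_pos hρ) (h.diff.diffContOnCl_ball hsub) (by
      intro z hz
      rw [mem_sphere_iff_norm] at hz
      have := h.bound y (z - y) (by rw [hz]; linarith)
      rw [add_sub_cancel, ← ofReal_norm] at this
      exact (ENNReal.ofReal_le_iff_le_toReal hfin).1 this)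
  rw [← ofReal_norm, ← ENNReal.ofReal_toReal hfin, ← ENNReal.ofReal_mul hpos.le]
  refine ENNReal.ofReal_le_ofReal (hC.trans (le_of_eq ?_))
  rw [div_pow, div_pow]; field_simp

lemma memLp_of_enorm_le {g : ℝ → ℝ} (hg : Continuous g) {φ : ℝ → ENNReal} {c : ℝ} (hc : 0 ≤ c)
    (hb : ∀ x, ‖g x‖ₑ ≤ ENNReal.ofReal c * φ x) (hfin : l2 gauss φ ≠ ⊤) :
    MemLp g 2 gauss ∧ ∫ x, g x ^ 2 ∂gauss ≤ (c * (l2 gauss φ).toReal) ^ 2 := by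
  have h0 : ∀ x, ENNReal.ofReal (g x ^ 2) = ‖g x‖ₑ ^ 2 := by
    intro x
    rw [← ofReal_norm, ← ENNReal.ofReal_pow (norm_nonneg _), Real.norm_eq_abs, sq_abs]
  have h1 : ∫⁻ x, ENNReal.ofReal (g x ^ 2) ∂gauss ≤
      ENNReal.ofReal ((c * (l2 gauss φ).toReal) ^ 2) := by
    have e : ENNReal.ofReal ((c * (l2 gauss φ).toReal) ^ 2) =
        ENNReal.ofReal c ^ 2 * ∫⁻ x, φ x ^ 2 ∂gauss := by
      rw [ENNReal.ofReal_pow (by positivity), ENNReal.ofReal_mul hc, ENNReal.ofReal_toReal hfin,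
        mul_pow, l2_sq]
    rw [e, ← lintegral_const_mul' _ _ (by simp)]
    refine lintegral_mono fun x => ?_
    rw [h0, ← mul_pow]
    exact pow_le_pow_left' (hb x) 2
  have hi : Integrable (fun x => g x ^ 2) gauss := by
    refine ⟨by fun_prop, ?_⟩
    rw [hasFiniteIntegral_iff_ofReal (ae_of_all _ fun x => sq_nonneg _)]
    exact lt_of_le_of_lt h1 ENNReal.ofReal_lt_top
  refine ⟨(memLp_two_iff_integrable_sq (by fun_prop)).2 hi, ?_⟩
  rw [integral_eq_lintegral_of_nonneg_ae (ae_of_all _ fun x => sq_nonneg _) (by fun_prop)]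
  exact ENNReal.toReal_le_of_le_ofReal (sq_nonneg _) h1

/-- The constant in the decay of the interpolation increments. -/
noncomputable def decayConst (t : ℕ) (ρ₀ : ℝ) : ℝ :=
  max 2 ((2 * (t + 7)).factorial * (2 / ρ₀) ^ (2 * (t + 7) - 1) * 2)

lemma decayConst_pos (t : ℕ) (ρ₀ : ℝ) : 0 < decayConst t ρ₀ := lt_of_lt_of_le two_pos (le_max_left _ _)

/-- Continuity, square integrability and decay of the Hermite coefficients of the real functionals
of a function that is holomorphic in a strip. -/
lemma StripBound.decay [CompleteSpace X] (t : ℕ) {ρ₀ ρ : ℝ} (hρ₀ : 0 < ρ₀) (hρ : ρ₀ ≤ ρ)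
    {φ : ℝ → ENNReal}
    {f : ℂ → X} (h : StripBound ρ φ f) (hfin : l2 gauss φ ≠ ⊤) (ℓ : X →L[ℝ] ℝ) (hℓ : ‖ℓ‖ ≤ 1) :
    Continuous (fun x : ℝ => ℓ (f x)) ∧ MemLp (fun x : ℝ => ℓ (f x)) 2 gauss ∧
      ∀ k, 1 ≤ k → |hcoef (fun x : ℝ => ℓ (f x)) k| ≤
        decayConst t ρ₀ / ρ * (l2 gauss φ).toReal * (2 * (t + 7) + 1) ^ (t + 7) /
          (k + 1) ^ (t + 7) := by
  have hρpos : 0 < ρ := lt_of_lt_of_le hρ₀ hρ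
  set δ := (l2 gauss φ).toReal with hδ
  have hδ0 : 0 ≤ δ := ENNReal.toReal_nonneg
  set g : ℕ → ℝ → ℝ := fun j x => ℓ (iteratedDeriv j f x) with hg
  have han := h.diff.analyticOnNhd (isOpen_strip_one ρ)
  have hd : ∀ j x, HasDerivAt (g j) (g (j + 1) x) x := by
    intro j x
    have hx : (x : ℂ) ∈ {z : ℂ | |z.im| < ρ} := by simpa using hρpos
    have h1 : HasDerivAt (iteratedDeriv j f) (iteratedDeriv (j + 1) f x) (x : ℂ) := by
      rw [iteratedDeriv_succ]
      refine DifferentiableAt.hasDerivAt ?_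
      have := (han.iterated_deriv j) x hx
      rw [← iteratedDeriv_eq_iterate] at this
      exact this.differentiableAt
    have h2 : HasDerivAt (fun y : ℝ => iteratedDeriv j f (y : ℂ)) (iteratedDeriv (j + 1) f x) x := by
      have := HasDerivAt.scomp (𝕜 := ℝ) x h1 (Complex.ofRealCLM.hasDerivAt (x := x))
      simp only [Complex.ofRealCLM_apply, Complex.ofReal_one, one_smul] at this
      exact this
    exact (ℓ.hasFDerivAt (x := iteratedDeriv j f x)).comp_hasDerivAt x h2
  have hcont : ∀ j, Continuous (g j) := fun j =>
    continuous_iff_continuousAt.2 fun x => (hd j x).continuousAt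
  have hb : ∀ j x, ‖g j x‖ₑ ≤ ENNReal.ofReal (j.factorial * (2 / ρ) ^ j) * φ x := by
    intro j x
    refine le_trans ?_ (h.enorm_iteratedDeriv_le hρpos j x)
    rw [← ofReal_norm, ← ofReal_norm]
    refine ENNReal.ofReal_le_ofReal ((ℓ.le_opNorm _).trans ?_)
    exact mul_le_of_le_one_left (norm_nonneg _) hℓ
  have hL := fun j => memLp_of_enorm_le (hcont j) (c := j.factorial * (2 / ρ) ^ j) (by positivity)
    (hb j) hfin
  have hg0 : g 0 = fun x : ℝ => ℓ (f x) := by ext x; simp [hg]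
  have hM0 : 0 ≤ decayConst t ρ₀ / ρ * δ := by
    have := decayConst_pos t ρ₀; positivity
  have hM1 : ∫ x, g 1 x ^ 2 ∂gauss ≤ (decayConst t ρ₀ / ρ * δ) ^ 2 := by
    refine (hL 1).2.trans ?_
    have h2 : (2 : ℝ) ≤ decayConst t ρ₀ := le_max_left _ _
    rw [Nat.factorial_one, pow_one, Nat.cast_one, one_mul, ← hδ]
    gcongr
  have hM2 : ∫ x, g (2 * (t + 7)) x ^ 2 ∂gauss ≤ (decayConst t ρ₀ / ρ * δ) ^ 2 := by
    refine (hL _).2.trans ?_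
    rw [← hδ]
    have h2 : ((2 * (t + 7)).factorial : ℝ) * (2 / ρ₀) ^ (2 * (t + 7) - 1) * 2 ≤ decayConst t ρ₀ :=
      le_max_right _ _
    -- Only one factor 1/ρ is kept; in the other factors ρ is replaced by its lower bound ρ₀, so
    -- that the constant does not depend on ρ.
    have h3 : ((2 * (t + 7)).factorial : ℝ) * (2 / ρ) ^ (2 * (t + 7)) ≤ decayConst t ρ₀ / ρ := by
      rw [le_div_iff₀ hρpos]
      refine le_trans ?_ h2
      rw [show 2 * (t + 7) = 2 * (t + 7) - 1 + 1 by omega, pow_succ, Nat.add_sub_cancel]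
      calc _ = ((2 * (t + 7) - 1 + 1).factorial : ℝ) * (2 / ρ) ^ (2 * (t + 7) - 1) * 2 := by
            field_simp
        _ ≤ _ := by gcongr
    gcongr
  have hdec := fun k => abs_hcoef_decay hd (fun j => (hL j).1) (s := t + 7) hM0 hM1 hM2 (k := k)
  rw [hg0] at hdec
  refine ⟨hg0 ▸ hcont 0, hg0 ▸ (hL 0).1, fun k hk => ?_⟩
  have := hdec k hk
  push_cast at this
  exact this

lemma one_le_hsum (n : ℕ) (y : ℝ) : 1 ≤ hsum n y := by
  have : |hn 0 y| ≤ hsum n y :=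
    Finset.single_le_sum (f := fun m => |hn m y|) (fun m _ => abs_nonneg _) (by simp)
  simpa [hn, He_zero] using this

/-- The constant in the bound for the interpolation increments. -/
noncomputable def incrConst (t : ℕ) (ρ₀ : ℝ) : ℝ :=
  40 * zetaTwo * (decayConst t ρ₀ * (2 * (t + 7) + 1) ^ (t + 7))

lemma incrConst_pos (t : ℕ) (ρ₀ : ℝ) : 0 < incrConst t ρ₀ := by
  have := decayConst_pos t ρ₀
  have := zetaTwo_pos
  unfold incrConst
  positivity

/-- A norming real functional commutes with the increment and reduces the bound to scalar functions.
-/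
lemma StripBound.enorm_incr_succ_le [CompleteSpace X] (t : ℕ) {ρ₀ ρ : ℝ} (hρ₀ : 0 < ρ₀)
    (hρ : ρ₀ ≤ ρ)
    {φ : ℝ → ENNReal} {f : ℂ → X} (h : StripBound ρ φ f) (n : ℕ) (y : ℝ) :
    ‖incr (n + 1) y fun x : ℝ => f x‖ₑ ≤
      ENNReal.ofReal (incrConst t ρ₀ / ρ / (n + 2) ^ t * hsum (n + 1) y) * l2 gauss φ := by
  have hρpos : 0 < ρ := lt_of_lt_of_le hρ₀ hρ
  have hA := incrConst_pos t ρ₀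
  have hpos : 0 < incrConst t ρ₀ / ρ / (n + 2) ^ t * hsum (n + 1) y := by
    have := lt_of_lt_of_le one_pos (one_le_hsum (n + 1) y)
    positivity
  rcases eq_or_ne (l2 gauss φ) ⊤ with htop | hfin
  · rw [htop, ENNReal.mul_top (ENNReal.ofReal_pos.2 hpos).ne']
    exact le_top
  obtain ⟨ℓ, hℓ, hℓv⟩ := exists_dual_vector'' ℝ (incr (n + 1) y fun x : ℝ => f x)
  obtain ⟨h1, h2, h3⟩ := h.decay t hρ₀ hρ hfin ℓ hℓ
  have hB0 : 0 ≤ decayConst t ρ₀ / ρ * (l2 gauss φ).toReal * (2 * (t + 7) + 1) ^ (t + 7) := by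
    have := decayConst_pos t ρ₀
    positivity
  have h4 := abs_incr_le_of_decay h1 h2 hB0 h3 n y
  have h5 := map_incr ℓ.toLinearMap (n + 1) y fun x : ℝ => f x
  simp only [ContinuousLinearMap.coe_coe] at h5
  rw [← h5, hℓv] at h4
  rw [← ofReal_norm, ← ENNReal.ofReal_toReal hfin, ← ENNReal.ofReal_mul hpos.le]
  refine ENNReal.ofReal_le_ofReal ?_
  refine (le_abs_self _).trans ((le_of_eq ?_).trans (h4.trans (le_of_eq ?_)))
  · simp
  · rw [incrConst]; ring

/-- The increment bound with t = 4 gives absolute convergence at fixed y. The limit is identified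
through functionals of norm at most 1, for which the scalar interpolants converge. -/
lemma StripBound.hasSum_incr [CompleteSpace X] {ρ : ℝ} (hρ : 0 < ρ) {φ : ℝ → ENNReal} {f : ℂ → X}
    (h : StripBound ρ φ f) (hfin : l2 gauss φ ≠ ⊤) (y : ℝ) :
    HasSum (fun n => incr n y fun x : ℝ => f x) (f y) := by
  have hsummable : Summable fun n => incr n y fun x : ℝ => f x := by
    rw [← summable_nat_add_iff 1]
    refine Summable.of_norm_bounded
      (g := fun n : ℕ => incrConst 4 ρ / ρ * (2 * Real.exp (y ^ 2 / 4)) * (l2 gauss φ).toReal *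
        (1 / ((n : ℝ) + 1) ^ 2)) ((summable_inv_succ_pow le_rfl).mul_left _) fun n => ?_
    have hA := incrConst_pos 4 ρ
    have h1 := h.enorm_incr_succ_le 4 hρ le_rfl n y
    have hG := hsum_nonneg (n + 1) y
    rw [← ofReal_norm, ← ENNReal.ofReal_toReal hfin, ← ENNReal.ofReal_mul (by positivity)]
      at h1
    have h2 := (ENNReal.ofReal_le_ofReal_iff (by positivity)).1 h1
    refine h2.trans ?_
    have h3 := hsum_le (n + 1) y
    push_cast at h3
    rw [show (n : ℝ) + 1 + 1 = n + 2 by ring] at h3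
    calc incrConst 4 ρ / ρ / (n + 2) ^ 4 * hsum (n + 1) y * (l2 gauss φ).toReal
        ≤ incrConst 4 ρ / ρ / (n + 2) ^ 4 * (2 * (n + 2) ^ 2 * Real.exp (y ^ 2 / 4)) *
            (l2 gauss φ).toReal := by gcongr
      _ = incrConst 4 ρ / ρ * (2 * Real.exp (y ^ 2 / 4)) * (l2 gauss φ).toReal *
            (1 / ((n : ℝ) + 2) ^ 2) := by field_simp
      _ ≤ _ := by gcongr; norm_num
  have hlim : ∀ ℓ : X →L[ℝ] ℝ, ‖ℓ‖ ≤ 1 → ℓ (∑' n, incr n y fun x : ℝ => f x) = ℓ (f y) := by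
    intro ℓ hℓ
    obtain ⟨h1, h2, h3⟩ := h.decay 0 hρ le_rfl hfin ℓ hℓ
    have hB0 : 0 ≤ decayConst 0 ρ / ρ * (l2 gauss φ).toReal * (2 * ((0 : ℕ) + 7) + 1) ^ (0 + 7) := by
      have := decayConst_pos 0 ρ
      positivity
    have h4 := tendsto_interp_of_decay h1 h2 hB0 h3 y
    have h5 := (ℓ.hasSum hsummable.hasSum).tendsto_sum_nat
    have h6 := h5.comp (tendsto_add_atTop_nat 1)
    refine tendsto_nhds_unique h6 (h4.congr fun n => ?_)
    rw [← sum_incr]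
    refine Finset.sum_congr rfl fun k _ => ?_
    exact (map_incr ℓ.toLinearMap k y fun x : ℝ => f x).symm
  have : (∑' n, incr n y fun x : ℝ => f x) = f y := by
    obtain ⟨ℓ, hℓ, hv⟩ := exists_dual_vector'' ℝ ((∑' n, incr n y fun x : ℝ => f x) - f y)
    rw [map_sub, hlim ℓ hℓ, sub_self] at hv
    have h0 : ‖(∑' n, incr n y fun x : ℝ => f x) - f y‖ = 0 := by simpa using hv.symm
    exact sub_eq_zero.1 (norm_eq_zero.1 h0)
  rw [← this]
  exact hsummable.hasSum

/-- The Gaussian measure of a centred interval. -/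
noncomputable def ballMeas (ρ : ℝ) : ENNReal := gauss (Metric.ball 0 ρ)

/-- Every real x with |x| < ρ has 0 in its disc, so φ x dominates the value at 0; integrate over
these x. -/
lemma StripBound.enorm_zero_sq_le {ρ : ℝ} {φ : ℝ → ENNReal} {f : ℂ → X}
    (h : StripBound ρ φ f) : ‖f 0‖ₑ ^ 2 * ballMeas ρ ≤ l2 gauss φ ^ 2 := by
  rw [l2_sq, ballMeas, ← setLIntegral_const]
  refine (setLIntegral_mono' Metric.isOpen_ball.measurableSet fun x hx => ?_).trans
    (setLIntegral_le_lintegral _ _)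
  have h1 := h.bound x (-x) (by simpa using hx)
  rw [add_neg_cancel] at h1
  exact pow_le_pow_left' h1 2

end Vector

end MLSmolyak

/-! ### Tensorized increments in finitely many variables -/

namespace MLSmolyak

lemma gauss_pos_of_isOpen {U : Set ℝ} (hU : IsOpen U) (hne : U.Nonempty) : 0 < gauss U := by
  rw [pos_iff_ne_zero]
  intro h
  exact (hU.measure_pos volume hne).ne' (gaussianReal_absolutelyContinuous' 0 one_ne_zero h)

lemma ballMeas_pos {ρ : ℝ} (hρ : 0 < ρ) : 0 < ballMeas ρ :=
  gauss_pos_of_isOpen Metric.isOpen_ball ⟨0, by simpa using hρ⟩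

lemma ballMeas_le_one (ρ : ℝ) : ballMeas ρ ≤ 1 := prob_le_one

lemma ballMeas_ne_top (ρ : ℝ) : ballMeas ρ ≠ ⊤ := (ballMeas_le_one ρ).trans_lt ENNReal.one_lt_top |>.ne

/-- The factor by which an interpolation increment at `y` is bounded. -/
noncomputable def incrBound (t : ℕ) (ρ₀ ρ : ℝ) : ℕ → ℝ → ENNReal
  | 0, _ => ballMeas ρ ^ (-(1 / 2) : ℝ)
  | n + 1, y => ENNReal.ofReal (incrConst t ρ₀ / ρ / (n + 2) ^ t * hsum (n + 1) y)

lemma incrBound_ne_top (t : ℕ) (ρ₀ : ℝ) {ρ : ℝ} (hρ : 0 < ρ) (n : ℕ) (y : ℝ) :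
    incrBound t ρ₀ ρ n y ≠ ⊤ := by
  cases n with
  | zero =>
    rw [incrBound, ENNReal.rpow_neg, ENNReal.inv_ne_top]
    exact (ENNReal.rpow_pos (ballMeas_pos hρ) (ballMeas_ne_top ρ)).ne'
  | succ n => exact ENNReal.ofReal_ne_top

/-- At fixed y the Hermite sum `hsum` grows quadratically in the degree, so t = 4 leaves two powers
for summation. -/
lemma tsum_incrBound_ne_top (ρ₀ : ℝ) {ρ : ℝ} (hρ : 0 < ρ) (y : ℝ) :
    ∑' n, incrBound 4 ρ₀ ρ n y ≠ ⊤ := by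
  rw [tsum_eq_zero_add' ENNReal.summable]
  refine ENNReal.add_ne_top.2 ⟨incrBound_ne_top _ _ hρ _ _, ?_⟩
  have hA := incrConst_pos 4 ρ₀
  have hs := ((summable_inv_succ_pow le_rfl).mul_left
    (incrConst 4 ρ₀ / ρ * (2 * Real.exp (y ^ 2 / 4))))
  refine ne_top_of_le_ne_top hs.tsum_ofReal_ne_top (ENNReal.tsum_le_tsum fun n => ?_)
  refine ENNReal.ofReal_le_ofReal ?_
  have h3 := hsum_le (n + 1) y
  push_cast at h3
  rw [show (n : ℝ) + 1 + 1 = n + 2 by ring] at h3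
  calc incrConst 4 ρ₀ / ρ / (n + 2) ^ 4 * hsum (n + 1) y
      ≤ incrConst 4 ρ₀ / ρ / (n + 2) ^ 4 * (2 * (n + 2) ^ 2 * Real.exp (y ^ 2 / 4)) := by gcongr
    _ = incrConst 4 ρ₀ / ρ * (2 * Real.exp (y ^ 2 / 4)) * (1 / ((n : ℝ) + 2) ^ 2) := by field_simp
    _ ≤ _ := by gcongr; norm_num

lemma tsum_prod_pi (N : ℕ) (b : Fin N → ℕ → ENNReal) :
    ∑' ν : Fin N → ℕ, ∏ j, b j (ν j) = ∏ j, ∑' n, b j n := by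
  induction N with
  | zero => simp
  | succ N ih =>
    rw [Fin.prod_univ_succ, ← ih, ← ENNReal.tsum_mul_right,
      ← (Fin.consEquiv fun _ : Fin (N + 1) => ℕ).tsum_eq, ENNReal.tsum_prod']
    refine tsum_congr fun n => ?_
    rw [← ENNReal.tsum_mul_left]
    refine tsum_congr fun ν => ?_
    rw [Fin.prod_univ_succ]
    simp [Fin.consEquiv]

section Vector
variable {X : Type*} [NormedAddCommGroup X] [NormedSpace ℂ X]

lemma StripBound.enorm_incr_le [CompleteSpace X] (t : ℕ) {ρ₀ ρ : ℝ} (hρ₀ : 0 < ρ₀)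
    (hρ : ρ₀ ≤ ρ) {φ : ℝ → ENNReal} {f : ℂ → X} (h : StripBound ρ φ f) (n : ℕ) (y : ℝ) :
    ‖incr n y fun x : ℝ => f x‖ₑ ≤ incrBound t ρ₀ ρ n y * l2 gauss φ := by
  cases n with
  | zero =>
    have hρpos : 0 < ρ := lt_of_lt_of_le hρ₀ hρ
    have h1 := h.enorm_zero_sq_le
    rw [incr_zero, incrBound, Complex.ofReal_zero]
    have h2 : ‖f 0‖ₑ * ballMeas ρ ^ (1 / 2 : ℝ) ≤ l2 gauss φ := by
      refine (ENNReal.pow_le_pow_left_iff two_ne_zero).1 ?_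
      rw [mul_pow, ← ENNReal.rpow_natCast (_ ^ (1 / 2 : ℝ)), ← ENNReal.rpow_mul]
      simpa using h1
    have h3 := (ENNReal.rpow_pos (p := 1 / 2) (ballMeas_pos hρpos) (ballMeas_ne_top ρ)).ne'
    have h4 : ballMeas ρ ^ (1 / 2 : ℝ) ≠ ⊤ := ENNReal.rpow_ne_top_of_nonneg (by norm_num) (ballMeas_ne_top ρ)
    rw [ENNReal.rpow_neg, mul_comm, ← div_eq_mul_inv, ENNReal.le_div_iff_mul_le (Or.inl h3) (Or.inl h4)]
    exact h2
  | succ n => exact h.enorm_incr_succ_le t hρ₀ hρ n y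

/-- Holomorphy in a product of strips, with the values in polydiscs around real points bounded
by `φ`. -/
structure PolyBound {N : ℕ} (ρ : Fin N → ℝ) (φ : (Fin N → ℝ) → ENNReal) (F : (Fin N → ℂ) → X) :
    Prop where
  diff : DifferentiableOn ℂ F (strip ρ)
  bound : ∀ y : Fin N → ℝ, ∀ z ∈ polydisc ρ, ‖F (toC y + z)‖ₑ ≤ φ y

lemma toC_cons {N : ℕ} (x : ℝ) (y : Fin N → ℝ) :
    toC (Fin.cons x y : Fin (N + 1) → ℝ) = Fin.cons (x : ℂ) (toC y) := by
  ext j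
  refine Fin.cases ?_ (fun i => ?_) j <;> simp [toC]

lemma cons_add_cons {N : ℕ} (a b : ℂ) (y z : Fin N → ℂ) :
    (Fin.cons a y : Fin (N + 1) → ℂ) + Fin.cons b z = Fin.cons (a + b) (y + z) := by
  ext j
  refine Fin.cases ?_ (fun i => ?_) j <;> simp

lemma differentiable_cons_left {N : ℕ} (z : Fin N → ℂ) :
    Differentiable ℂ fun ζ : ℂ => (Fin.cons ζ z : Fin (N + 1) → ℂ) := by
  rw [differentiable_pi]
  intro j
  refine Fin.cases ?_ (fun i => ?_) j
  · simp
  · simp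

lemma differentiable_cons_right {N : ℕ} (a : ℂ) :
    Differentiable ℂ fun z : Fin N → ℂ => (Fin.cons a z : Fin (N + 1) → ℂ) := by
  rw [differentiable_pi]
  intro j
  refine Fin.cases ?_ (fun i => ?_) j
  · simp
  · simp only [Fin.cons_succ]; fun_prop

section
variable {N : ℕ} {ρ : Fin (N + 1) → ℝ} {φ : (Fin (N + 1) → ℝ) → ENNReal}
  {F : (Fin (N + 1) → ℂ) → X}

lemma PolyBound.slice (h : PolyBound ρ φ F) (y : Fin N → ℝ) {z : Fin N → ℂ}
    (hz : z ∈ polydisc (Fin.tail ρ)) :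
    StripBound (ρ 0) (fun x => φ (Fin.cons x y)) fun ζ => F (Fin.cons ζ (toC y + z)) where
  diff := by
    refine h.diff.comp (differentiable_cons_left _).differentiableOn fun ζ hζ => ?_
    intro j
    refine Fin.cases ?_ (fun i => ?_) j
    · simpa using hζ
    · have h1 := hz i
      have h2 := Complex.abs_im_le_norm (z i)
      simp only [Fin.cons_succ, Pi.add_apply, Complex.add_im, toC, Complex.ofReal_im, zero_add]
      exact lt_of_le_of_lt h2 h1
  bound := fun x ζ hζ => by
    have := h.bound (Fin.cons x y) (Fin.cons ζ z) (by
      intro j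
      refine Fin.cases ?_ (fun i => ?_) j
      · simpa using hζ
      · simp only [Fin.cons_succ]; exact hz i)
    rwa [toC_cons, cons_add_cons] at this

/-- The engine of the induction on the dimension: an increment in the first variable leaves a
holomorphic function of the others, whose majorant is the partial L²-norm of φ. By Tonelli these
partial norms combine to the full norm. -/
lemma PolyBound.incr_first [CompleteSpace X] (t : ℕ) {ρ₀ : ℝ} (hρ₀ : 0 < ρ₀)
    (hρ : ∀ j, ρ₀ ≤ ρ j) (h : PolyBound ρ φ F) (n : ℕ) (y : ℝ) :
    PolyBound (Fin.tail ρ)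
      (fun y' => incrBound t ρ₀ (ρ 0) n y * l2 gauss fun x => φ (Fin.cons x y'))
      fun z' => incr n y fun x : ℝ => F (Fin.cons (x : ℂ) z') where
  diff := by
    have h1 : ∀ x : ℝ, DifferentiableOn ℂ (fun z' : Fin N → ℂ => F (Fin.cons (x : ℂ) z'))
        (strip (Fin.tail ρ)) := by
      intro x
      refine h.diff.comp (differentiable_cons_right _).differentiableOn fun z hz => ?_
      intro j
      refine Fin.cases ?_ (fun i => ?_) j
      · simpa using lt_of_lt_of_le hρ₀ (hρ 0)
      · simp only [Fin.cons_succ]; exact hz i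
    have h2 : ∀ m, DifferentiableOn ℂ (fun z' : Fin N → ℂ =>
        interp m y fun x : ℝ => F (Fin.cons (x : ℂ) z')) (strip (Fin.tail ρ)) := by
      intro m
      unfold interp
      refine DifferentiableOn.fun_sum fun x _ => ?_
      exact (h1 x).const_smul _
    cases n with
    | zero => exact h2 0
    | succ n => exact (h2 (n + 1)).sub (h2 n)
  bound := fun y' z' hz' =>
    (h.slice y' hz').enorm_incr_le t hρ₀ (hρ 0) n y

lemma measurable_cons_pair : Measurable fun p : ℝ × (Fin N → ℝ) => (Fin.cons p.1 p.2 : Fin (N + 1) → ℝ) := by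
  rw [measurable_pi_iff]
  intro j
  refine Fin.cases ?_ (fun i => ?_) j
  · simpa using measurable_fst
  · simp only [Fin.cons_succ]
    exact (measurable_pi_apply i).comp measurable_snd

lemma lintegral_gaussN_succ {f : (Fin (N + 1) → ℝ) → ENNReal} (hf : Measurable f) :
    ∫⁻ y, f y ∂gaussN (N + 1) = ∫⁻ y', ∫⁻ x, f (Fin.cons x y') ∂gauss ∂gaussN N := by
  have h := (measurePreserving_piFinSuccAbove (fun _ : Fin (N + 1) => gauss) 0).symm
  have h1 := h.lintegral_comp hf
  have h2 : Measurable fun p : ℝ × (Fin N → ℝ) =>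
      f ((MeasurableEquiv.piFinSuccAbove (fun _ : Fin (N + 1) => ℝ) 0).symm p) :=
    hf.comp (MeasurableEquiv.measurable _)
  rw [gaussN, ← h1]
  refine (lintegral_prod_symm' _ h2).trans ?_
  refine lintegral_congr fun y' => lintegral_congr fun x => ?_
  rw [MeasurableEquiv.piFinSuccAbove_symm_apply]
  change f (Fin.insertNth 0 x y') = _
  rw [Fin.insertNth_zero']

lemma measurable_l2_cons (hφ : Measurable φ) :
    Measurable fun y' : Fin N → ℝ => l2 gauss fun x => φ (Fin.cons x y') := by
  unfold l2
  have h1 : Measurable fun p : (Fin N → ℝ) × ℝ => φ (Fin.cons p.2 p.1) ^ 2 :=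
    (hφ.comp (measurable_cons_pair.comp measurable_swap)).pow_const 2
  exact (h1.lintegral_prod_right' (ν := gauss)).pow_const _

lemma l2_const_mul {Ω : Type*} [MeasurableSpace Ω] (μ : Measure Ω) (c : ENNReal)
    {φ : Ω → ENNReal} (hφ : Measurable φ) : l2 μ (fun x => c * φ x) = c * l2 μ φ := by
  unfold l2
  simp_rw [mul_pow]
  rw [lintegral_const_mul _ (hφ.pow_const 2), ENNReal.mul_rpow_of_nonneg _ _ (by norm_num),
    ← ENNReal.rpow_natCast, ← ENNReal.rpow_mul]
  norm_num

lemma l2_l2_cons (hφ : Measurable φ) :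
    l2 (gaussN N) (fun y' => l2 gauss fun x => φ (Fin.cons x y')) = l2 (gaussN (N + 1)) φ := by
  conv_lhs => rw [l2]
  simp_rw [l2_sq]
  rw [l2, lintegral_gaussN_succ (hφ.pow_const 2)]

end

/-- The tensor product of interpolation increments, evaluated at `y`. -/
noncomputable def tincr : (N : ℕ) → (Fin N → ℕ) → (Fin N → ℝ) → ((Fin N → ℝ) → X) → X
  | 0, _, y, u => u y
  | N + 1, ν, y, u =>
    tincr N (Fin.tail ν) (Fin.tail y) fun y' => incr (ν 0) (y 0) fun x => u (Fin.cons x y')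

lemma PolyBound.enorm_tincr_le [CompleteSpace X] (t : ℕ) {ρ₀ : ℝ} (hρ₀ : 0 < ρ₀) {N : ℕ}
    {ρ : Fin N → ℝ} {φ : (Fin N → ℝ) → ENNReal} {F : (Fin N → ℂ) → X} (h : PolyBound ρ φ F)
    (hρ : ∀ j, ρ₀ ≤ ρ j) (hφ : Measurable φ) (ν : Fin N → ℕ) (y : Fin N → ℝ) :
    ‖tincr N ν y fun x => F (toC x)‖ₑ ≤
      (∏ j, incrBound t ρ₀ (ρ j) (ν j) (y j)) * l2 (gaussN N) φ := by
  induction N with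
  | zero =>
    have h1 := h.bound y 0 (fun j => j.elim0)
    rw [add_zero] at h1
    have h2 : l2 (gaussN 0) φ = φ y := by
      rw [l2, gaussN, Measure.pi_of_empty (x := y), lintegral_dirac' _ (hφ.pow_const 2),
        ← ENNReal.rpow_natCast, ← ENNReal.rpow_mul]
      norm_num
    rw [h2]
    simpa [tincr] using h1
  | succ N ih =>
    rw [tincr]
    have h1 := ih (h.incr_first t hρ₀ hρ (ν 0) (y 0)) (fun j => hρ j.succ)
      ((measurable_l2_cons hφ).const_mul _) (Fin.tail ν) (Fin.tail y)
    rw [l2_const_mul _ _ (measurable_l2_cons hφ), l2_l2_cons hφ] at h1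
    simp only [toC_cons]
    refine h1.trans (le_of_eq ?_)
    rw [Fin.prod_univ_succ]
    simp only [Fin.tail]
    ring

lemma gaussN_box_pos {N : ℕ} {r : Fin N → ℝ} (hr : ∀ j, 0 < r j) (y : Fin N → ℝ) :
    0 < gaussN N (Set.univ.pi fun j => Metric.ball (y j) (r j)) := by
  rw [gaussN, Measure.pi_pi]
  refine pos_iff_ne_zero.2 (Finset.prod_ne_zero_iff.2 fun j _ => ?_)
  exact (gauss_pos_of_isOpen Metric.isOpen_ball ⟨y j, by simpa using hr j⟩).ne'

/-- The product form of the increment bounds gives absolute convergence. The value is then found by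
summing first over the degrees in the last N variables, by induction, and then over the first
degree. -/
lemma PolyBound.hasSum_tincr [CompleteSpace X] {ρ₀ : ℝ} (hρ₀ : 0 < ρ₀) {N : ℕ}
    {ρ : Fin N → ℝ} {φ : (Fin N → ℝ) → ENNReal} {F : (Fin N → ℂ) → X} (h : PolyBound ρ φ F)
    (hρ : ∀ j, ρ₀ ≤ ρ j) (hφ : Measurable φ) (hfin : l2 (gaussN N) φ ≠ ⊤) (y : Fin N → ℝ) :
    HasSum (fun ν => tincr N ν y fun x => F (toC x)) (F (toC y)) := by
  have hρpos : ∀ j, 0 < ρ j := fun j => lt_of_lt_of_le hρ₀ (hρ j)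
  have hsummable : Summable (fun ν => tincr N ν y fun x => F (toC x)) := by
    have hs : ∑' ν : Fin N → ℕ, ‖tincr N ν y fun x => F (toC x)‖ₑ ≠ ⊤ := by
      refine ne_top_of_le_ne_top ?_
        (ENNReal.tsum_le_tsum fun ν => h.enorm_tincr_le 4 hρ₀ hρ hφ ν y)
      rw [ENNReal.tsum_mul_right, tsum_prod_pi N fun j n => incrBound 4 ρ₀ (ρ j) n (y j)]
      refine ENNReal.mul_ne_top (ENNReal.prod_ne_top fun j _ => ?_) hfin
      exact tsum_incrBound_ne_top ρ₀ (hρpos j) (y j)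
    refine Summable.of_norm ((ENNReal.summable_toReal hs).congr fun ν => ?_)
    simp
  induction N with
  | zero =>
    simp [tincr]
  | succ N ih =>
    set e := Fin.consEquiv fun _ : Fin (N + 1) => ℕ
    rw [← e.hasSum_iff]
    have hsum' := (e.summable_iff.2 hsummable).hasSum
    have hfib : ∀ n, HasSum (fun ν' : Fin N → ℕ =>
        ((fun ν => tincr (N + 1) ν y fun x => F (toC x)) ∘ e) (n, ν'))
        (incr n (y 0) fun x : ℝ => F (Fin.cons (x : ℂ) (toC (Fin.tail y)))) := by
      intro n
      have h1 := h.incr_first 4 hρ₀ hρ n (y 0)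
      have hfin' : l2 (gaussN N) (fun y' => incrBound 4 ρ₀ (ρ 0) n (y 0) *
          l2 gauss fun x => φ (Fin.cons x y')) ≠ ⊤ := by
        rw [l2_const_mul _ _ (measurable_l2_cons hφ), l2_l2_cons hφ]
        exact ENNReal.mul_ne_top (incrBound_ne_top _ _ (hρpos 0) _ _) hfin
      have h2 := ih h1 (fun j => hρ j.succ) ((measurable_l2_cons hφ).const_mul _) hfin'
        (Fin.tail y) (fun j => hρpos j.succ) (by
          have := (e.summable_iff.2 hsummable).prod_factor n
          refine this.congr fun ν' => ?_
          simp [e, Fin.consEquiv, tincr, toC_cons])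
      have h3 : (fun ν' : Fin N → ℕ => ((fun ν => tincr (N + 1) ν y fun x => F (toC x)) ∘ e) (n, ν')) =
          fun ν' => tincr N ν' (Fin.tail y) fun y' =>
            incr n (y 0) fun x : ℝ => F (Fin.cons (x : ℂ) (toC y')) := by
        ext ν'
        simp [e, Fin.consEquiv, tincr, toC_cons]
      rw [h3]
      exact h2
    have h3 := hsum'.prod_fiberwise hfib
    -- The slice of φ through y itself may have infinite norm. Almost every slice has finite norm,
    -- and the box around y has positive measure, so some nearby slice is finite and its polydisc
    -- still contains y.
    obtain ⟨y'', hy''box, hy''⟩ : ∃ y'' ∈ Set.univ.pi fun j => Metric.ball (Fin.tail y j) (Fin.tail ρ j),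
        l2 gauss (fun x => φ (Fin.cons x y'')) ≠ ⊤ := by
      by_contra hcon
      push Not at hcon
      have hpos := gaussN_box_pos (r := Fin.tail ρ) (fun j => hρpos j.succ) (Fin.tail y)
      have hae : ∀ᵐ y' ∂gaussN N, (l2 gauss fun x => φ (Fin.cons x y')) ^ 2 < ⊤ := by
        refine ae_lt_top ((measurable_l2_cons hφ).pow_const 2) ?_
        rw [← l2_sq, l2_l2_cons hφ]
        exact ENNReal.pow_ne_top hfin
      exact hpos.ne' (measure_mono_null (fun y' hy' => by simp [hcon y' hy']) hae)
    have h4 : StripBound (ρ 0) (fun x => φ (Fin.cons x y'')) fun ζ =>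
        F (Fin.cons ζ (toC (Fin.tail y))) := by
      have := h.slice y'' (z := toC (Fin.tail y) - toC y'') (by
        intro j
        have := hy''box j (Set.mem_univ j)
        rw [Metric.mem_ball, dist_comm, Real.dist_eq] at this
        simp only [toC, Pi.sub_apply]
        rw [← Complex.ofReal_sub, Complex.norm_real]
        exact this)
      simpa using this
    have h5 := h4.hasSum_incr (hρpos 0) hy'' (y 0)
    have h6 : toC y = Fin.cons (y 0 : ℂ) (toC (Fin.tail y)) := by
      rw [← toC_cons, Fin.cons_self_tail]
    rw [h6, ← h3.unique h5]
    exact hsum'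

end Vector

end MLSmolyak

/-! ### The details as tensorized increments -/

namespace MLSmolyak

/-- The coefficients of the interpolation operator, extended by zero off the nodes. -/
noncomputable def icoef (n : ℕ) (y x : ℝ) : ℝ := if x ∈ nodes n then (lag n x).eval y else 0

/-- The coefficients of the interpolation increments. -/
noncomputable def dcoef : ℕ → ℝ → ℝ → ℝ
  | 0, y, x => icoef 0 y x
  | n + 1, y, x => icoef (n + 1) y x - icoef n y x

/-- The points that enter an interpolation increment. -/
noncomputable def dnodes (n : ℕ) : Finset ℝ := nodes n ∪ nodes (n - 1)

lemma interp_eq_sum {Y : Type*} [AddCommGroup Y] [Module ℝ Y] {n : ℕ} {A : Finset ℝ}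
    (hA : nodes n ⊆ A) (y : ℝ) (f : ℝ → Y) : interp n y f = ∑ x ∈ A, icoef n y x • f x := by
  rw [interp, ← Finset.sum_subset hA fun x _ hx => by simp [icoef, hx]]
  exact Finset.sum_congr rfl fun x hx => by simp [icoef, hx]

lemma incr_eq_sum {Y : Type*} [AddCommGroup Y] [Module ℝ Y] {n : ℕ} {A : Finset ℝ}
    (hA : dnodes n ⊆ A) (y : ℝ) (f : ℝ → Y) : incr n y f = ∑ x ∈ A, dcoef n y x • f x := by
  cases n with
  | zero => exact interp_eq_sum (Finset.subset_union_left.trans hA) y f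
  | succ n =>
    rw [incr, interp_eq_sum (Finset.subset_union_left.trans hA),
      interp_eq_sum (n := n) (Finset.subset_union_right.trans hA), ← Finset.sum_sub_distrib]
    simp [dcoef, sub_smul]

lemma icoef_zero_zero (y : ℝ) : icoef 0 y 0 = 1 := by
  simp [icoef, lag, nodes_zero]

section
variable {X : Type*} [NormedAddCommGroup X] [NormedSpace ℂ X]

/-- Extending the coefficients by zero puts all interpolation operators on one common grid, on which
tensor products become plain products of coefficients. -/
lemma tincr_eq_sum {N : ℕ} {ν : Fin N → ℕ} {A : Finset ℝ} (hA : ∀ j, dnodes (ν j) ⊆ A)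
    (y : Fin N → ℝ) (u : (Fin N → ℝ) → X) :
    tincr N ν y u = ∑ x ∈ Fintype.piFinset fun _ : Fin N => A,
      (∏ j, dcoef (ν j) (y j) (x j)) • u x := by
  induction N with
  | zero =>
    simp [tincr]
    congr
    exact Subsingleton.elim _ _
  | succ N ih =>
    rw [tincr, ih (ν := Fin.tail ν) (fun j => hA j.succ)]
    simp_rw [incr_eq_sum (hA 0), Finset.smul_sum]
    rw [Finset.sum_comm, ← Finset.sum_product']
    refine Finset.sum_nbij' (fun p => Fin.cons p.1 p.2) (fun x => (x 0, Fin.tail x)) ?_ ?_ ?_ ?_ ?_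
    · rintro ⟨a, x⟩ hp
      rw [Finset.mem_product, Fintype.mem_piFinset] at hp
      rw [Fintype.mem_piFinset]
      intro j
      refine Fin.cases ?_ (fun i => ?_) j
      · exact hp.1
      · exact hp.2 i
    · intro x hx
      rw [Fintype.mem_piFinset] at hx
      rw [Finset.mem_product, Fintype.mem_piFinset]
      exact ⟨hx 0, fun j => hx j.succ⟩
    · rintro ⟨a, x⟩ _
      simp
    · intro x _
      simp
    · rintro ⟨a, x⟩ _
      rw [Fin.prod_univ_succ, smul_smul]
      simp [Fin.tail, mul_comm]
end

lemma evalFin_eq {X : Type*} {uN : ∀ N : ℕ, (Fin N → ℝ) → X}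
    (hc : ∀ N M : ℕ, 0 < N → N < M → ∀ y : Fin N → ℝ, uN N y = uN M (padZero M y))
    {N : ℕ} (hN : 0 < N) {x : ℕ →₀ ℝ} (hx : x.support ⊆ Finset.range N) :
    evalFin uN x = uN N fun j => x j := by
  have hle : x.support.sup id + 1 ≤ N := by
    rw [Nat.succ_le_iff, Finset.sup_lt_iff (by simpa using hN)]
    exact fun j hj => Finset.mem_range.1 (hx hj)
  rw [evalFin]
  rcases hle.eq_or_lt with h | h
  · subst h; rfl
  · rw [hc _ N (Nat.succ_pos _) h]
    congr 1
    ext j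
    rw [padZero]
    split_ifs with hj
    · rfl
    · by_contra hne
      have h1 : (j : ℕ) ∈ x.support := Finsupp.mem_support_iff.2 (Ne.symm hne)
      have := Finset.le_sup (f := id) h1
      simp only [id] at this
      omega

section
variable {X : Type*} [NormedAddCommGroup X] [InnerProductSpace ℂ X]

lemma tensorInterp_eq_sum {N : ℕ} {ν : MIdx} (hν : ν.support ⊆ Finset.range N) {A : Finset ℝ}
    (hA : ∀ j, nodes (ν j) ⊆ A) (v : (ℕ →₀ ℝ) → X) (y : ℕ → ℝ) :
    tensorInterp ν v y = ∑ x ∈ (Finset.range N).finsupp fun _ => A,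
      (∏ j ∈ Finset.range N, icoef (ν j) (y j) (x j)) • v x := by
  have h0 : (0 : ℝ) ∈ nodes 0 := by simp [nodes_zero]
  rw [tensorInterp, ← Finset.sum_subset (s₁ := ν.support.finsupp fun j => nodes (ν j))
    (s₂ := (Finset.range N).finsupp fun _ => A)]
  · refine Finset.sum_congr rfl fun x hx => ?_
    rw [Finset.mem_finsupp_iff] at hx
    congr 1
    rw [← Finset.prod_subset hν]
    · exact Finset.prod_congr rfl fun j hj => by simp [icoef, hx.2 j hj]
    · intro j _ hj
      rw [Finsupp.notMem_support_iff.1 hj, Finsupp.notMem_support_iff.1 (fun h => hj (hx.1 h)),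
        icoef_zero_zero]
  · intro x hx
    rw [Finset.mem_finsupp_iff] at hx ⊢
    refine ⟨hx.1.trans hν, fun j _ => ?_⟩
    by_cases hj : j ∈ ν.support
    · exact hA j (hx.2 j hj)
    · rw [Finsupp.notMem_support_iff.1 (fun h => hj (hx.1 h))]
      exact hA j (by rwa [Finsupp.notMem_support_iff.1 hj])
  · intro x hx hx'
    rw [Finset.mem_finsupp_iff] at hx hx'
    suffices h : ∃ j ∈ Finset.range N, x j ∉ nodes (ν j) by
      obtain ⟨j, hj, hj'⟩ := h
      rw [Finset.prod_eq_zero hj (by simp [icoef, hj']), zero_smul]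
    by_contra! hcon
    refine hx' ⟨fun j hj => ?_, fun j hj => hcon j (hν hj)⟩
    by_contra hj'
    have := hcon j (hx.1 hj)
    rw [Finsupp.notMem_support_iff.1 hj', nodes_zero, Finset.mem_singleton] at this
    exact (Finsupp.mem_support_iff.1 hj) this

/-- On the common grid the alternating sum over subsets of the support is the product of differences
multiplied out. Off the support the coefficients of degree 0 remain. -/
lemma detail_eq_sum {N : ℕ} {ν : MIdx} (hν : ν.support ⊆ Finset.range N) {A : Finset ℝ}
    (hA : ∀ j, dnodes (ν j) ⊆ A) (v : (ℕ →₀ ℝ) → X) (y : ℕ → ℝ) :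
    detail ν v y = ∑ x ∈ (Finset.range N).finsupp fun _ => A,
      (∏ j ∈ Finset.range N, dcoef (ν j) (y j) (x j)) • v x := by
  have h1 : ∀ S ∈ ν.support.powerset,
      (-1 : ℝ) ^ S.card • tensorInterp (ν - Finsupp.indicator S (fun _ _ => 1)) v y =
      ∑ x ∈ (Finset.range N).finsupp fun _ => A,
        ((-1 : ℝ) ^ S.card * ∏ j ∈ Finset.range N,
          icoef (ν j - if j ∈ S then 1 else 0) (y j) (x j)) • v x := by
    intro S hS
    have hval : ∀ j, (ν - Finsupp.indicator S (fun _ _ => 1) : MIdx) j =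
        ν j - if j ∈ S then 1 else 0 := by
      intro j
      simp [Finsupp.indicator_apply]
    rw [tensorInterp_eq_sum (N := N) (A := A), Finset.smul_sum]
    · simp_rw [hval, smul_smul]
    · intro j hj
      refine hν ?_
      rw [Finsupp.mem_support_iff] at hj ⊢
      rw [hval] at hj
      omega
    · intro j
      rw [hval]
      refine Finset.Subset.trans ?_ (hA j)
      split_ifs
      · exact Finset.subset_union_right
      · exact Finset.subset_union_left
  rw [detail, Finset.sum_congr rfl h1, Finset.sum_comm]
  refine Finset.sum_congr rfl fun x _ => ?_
  rw [← Finset.sum_smul]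
  congr 1
  have hsplit : ∀ f : ℕ → ℝ, ∏ j ∈ Finset.range N, f j =
      (∏ j ∈ Finset.range N \ ν.support, f j) * ∏ j ∈ ν.support, f j :=
    fun f => (Finset.prod_sdiff hν).symm
  have h2 : ∏ j ∈ ν.support, dcoef (ν j) (y j) (x j) =
      ∏ j ∈ ν.support, (icoef (ν j) (y j) (x j) - icoef (ν j - 1) (y j) (x j)) := by
    refine Finset.prod_congr rfl fun j hj => ?_
    rw [Finsupp.mem_support_iff] at hj
    obtain ⟨m, hm⟩ := Nat.exists_eq_succ_of_ne_zero hj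
    rw [hm]
    rfl
  rw [hsplit fun j => dcoef (ν j) (y j) (x j), h2, Finset.prod_sub, Finset.mul_sum]
  refine Finset.sum_congr rfl fun S hS => ?_
  rw [Finset.mem_powerset] at hS
  rw [hsplit fun j => icoef (ν j - if j ∈ S then 1 else 0) (y j) (x j), ← Finset.prod_sdiff hS]
  have e1 : ∏ j ∈ Finset.range N \ ν.support, icoef (ν j - if j ∈ S then 1 else 0) (y j) (x j) =
      ∏ j ∈ Finset.range N \ ν.support, dcoef (ν j) (y j) (x j) := by
    refine Finset.prod_congr rfl fun j hj => ?_
    rw [Finset.mem_sdiff, Finsupp.notMem_support_iff] at hj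
    rw [hj.2, Nat.zero_sub]
    rfl
  have e2 : ∏ j ∈ ν.support \ S, icoef (ν j - if j ∈ S then 1 else 0) (y j) (x j) =
      ∏ j ∈ ν.support \ S, icoef (ν j) (y j) (x j) := by
    refine Finset.prod_congr rfl fun j hj => ?_
    rw [if_neg (Finset.mem_sdiff.1 hj).2, Nat.sub_zero]
  have e3 : ∏ j ∈ S, icoef (ν j - if j ∈ S then 1 else 0) (y j) (x j) =
      ∏ j ∈ S, icoef (ν j - 1) (y j) (x j) :=
    Finset.prod_congr rfl fun j hj => by rw [if_pos hj]
  rw [e1, e2, e3]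
  ring

lemma detail_evalFin {uN : ∀ N : ℕ, (Fin N → ℝ) → X}
    (hc : ∀ N M : ℕ, 0 < N → N < M → ∀ y : Fin N → ℝ, uN N y = uN M (padZero M y))
    {N : ℕ} (hN : 0 < N) {ν : MIdx} (hν : ν.support ⊆ Finset.range N) (y : ℕ → ℝ) :
    detail ν (evalFin uN) y = tincr N (fun j => ν j) (fun j => y j) (uN N) := by
  -- The point 0 serves the inactive coordinates, whose only node it is.
  set A : Finset ℝ := {0} ∪ ν.support.biUnion fun j => dnodes (ν j) with hAdef
  have hA : ∀ j, dnodes (ν j) ⊆ A := by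
    intro j
    by_cases hj : j ∈ ν.support
    · exact (Finset.subset_biUnion_of_mem (fun j => dnodes (ν j)) hj).trans Finset.subset_union_right
    · rw [Finsupp.notMem_support_iff.1 hj]
      simp [dnodes, nodes_zero, hAdef]
  rw [detail_eq_sum hν hA, tincr_eq_sum fun j : Fin N => hA j]
  refine Finset.sum_bij (fun x _ => fun j : Fin N => x j) ?_ ?_ ?_ ?_
  · intro x hx
    rw [Finset.mem_finsupp_iff] at hx
    rw [Fintype.mem_piFinset]
    exact fun j => hx.2 j (Finset.mem_range.2 j.2)
  · intro x hx x' hx' h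
    rw [Finset.mem_finsupp_iff] at hx hx'
    ext j
    by_cases hj : j < N
    · exact congrFun h ⟨j, hj⟩
    · rw [Finsupp.notMem_support_iff.1 fun h => hj (Finset.mem_range.1 (hx.1 h)),
        Finsupp.notMem_support_iff.1 fun h => hj (Finset.mem_range.1 (hx'.1 h))]
  · intro z hz
    rw [Fintype.mem_piFinset] at hz
    refine ⟨Finsupp.indicator (Finset.range N) fun j hj => z ⟨j, Finset.mem_range.1 hj⟩, ?_, ?_⟩
    · rw [Finset.mem_finsupp_iff]
      refine ⟨Finsupp.support_indicator_subset _ _, fun j hj => ?_⟩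
      rw [Finsupp.indicator_of_mem hj]
      exact hz _
    · ext j
      rw [Finsupp.indicator_of_mem (Finset.mem_range.2 j.2)]
  · intro x hx
    rw [Finset.mem_finsupp_iff] at hx
    rw [evalFin_eq hc hN hx.1, Finset.prod_range]

end

end MLSmolyak

/-! ### L² bounds for details and the error of truncated detail series -/

namespace MLSmolyak

lemma l2_enorm {Ω E : Type*} [MeasurableSpace Ω] [NormedAddCommGroup E] (μ : Measure Ω)
    (f : Ω → E) : l2 μ (fun x => ‖f x‖ₑ) = eLpNorm f 2 μ := by
  rw [l2, eLpNorm_eq_lintegral_rpow_enorm_toReal (by norm_num) (by norm_num)]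
  norm_num

lemma l2_mono {Ω : Type*} [MeasurableSpace Ω] (μ : Measure Ω) {φ ψ : Ω → ENNReal}
    (h : ∀ x, φ x ≤ ψ x) : l2 μ φ ≤ l2 μ ψ := by
  unfold l2
  gcongr with x
  exact h x

lemma eLpNorm_fun_sum_le {Ω E ι : Type*} [MeasurableSpace Ω] [NormedAddCommGroup E]
    {μ : Measure Ω} {f : ι → Ω → E} {s : Finset ι} (hf : ∀ i, AEStronglyMeasurable (f i) μ) :
    eLpNorm (fun x => ∑ i ∈ s, f i x) 2 μ ≤ ∑ i ∈ s, eLpNorm (f i) 2 μ := by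
  have h : (fun x => ∑ i ∈ s, f i x) = ∑ i ∈ s, f i := by
    ext x
    rw [Finset.sum_apply]
  rw [h]
  exact eLpNorm_sum_le (fun i _ => hf i) (by norm_num)

lemma eLpNorm_hn (m : ℕ) : eLpNorm (hn m) 2 gauss = 1 := by
  rw [(memLp_hn m).eLpNorm_eq_integral_rpow_norm (by norm_num) (by norm_num)]
  have : ∀ x, ‖hn m x‖ ^ (2 : ENNReal).toReal = hn m x ^ 2 := by
    intro x
    rw [ENNReal.toReal_ofNat, Real.rpow_ofNat, Real.norm_eq_abs, sq_abs]
  simp_rw [this]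
  rw [integral_hn_sq]
  simp

lemma l2_hsum_le (n : ℕ) : l2 gauss (fun x => ENNReal.ofReal (hsum n x)) ≤ n + 1 := by
  have h1 : ∀ x, ENNReal.ofReal (hsum n x) = ‖∑ m ∈ Finset.range (n + 1), |hn m x|‖ₑ := by
    intro x
    have h0 : 0 ≤ ∑ m ∈ Finset.range (n + 1), |hn m x| := hsum_nonneg n x
    rw [← ofReal_norm, Real.norm_of_nonneg h0]
    rfl
  simp_rw [h1]
  rw [l2_enorm gauss fun x => ∑ m ∈ Finset.range (n + 1), |hn m x|]
  refine (eLpNorm_fun_sum_le (f := fun m x => |hn m x|)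
    fun m => (continuous_hn m).abs.aestronglyMeasurable).trans ?_
  have h2 : ∀ m, eLpNorm (fun x => |hn m x|) 2 gauss = 1 := fun m =>
    (eLpNorm_norm (hn m)).trans (eLpNorm_hn m)
  simp [h2]

lemma l2_gaussU_prod (s : Finset ℕ) {f : ℕ → ℝ → ENNReal} (hf : ∀ j, Measurable (f j)) :
    l2 gaussU (fun y => ∏ j ∈ s, f j (y j)) = ∏ j ∈ s, l2 gauss (f j) := by
  unfold l2
  simp_rw [← Finset.prod_pow]
  rw [gaussU, lintegral_prod_eq_prod_lintegral_of_indepFun s (fun j (y : ℕ → ℝ) => f j (y j) ^ 2)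
    (iIndepFun_infinitePi (X := fun j x => f j x ^ 2) fun j => (hf j).pow_const 2)
    fun j => ((hf j).comp (measurable_pi_apply j)).pow_const 2,
    ← ENNReal.prod_rpow_of_nonneg (by norm_num)]
  refine Finset.prod_congr rfl fun j _ => ?_
  congr 1
  have h := measurePreserving_eval_infinitePi (fun _ : ℕ => gauss) j
  exact h.lintegral_comp ((hf j).pow_const 2)

section
variable {X : Type*} [NormedAddCommGroup X] [NormedSpace ℂ X]

/-- The part of `HolomorphicFamily` that does not refer to the limit, with extended nonnegative
bounds. -/
structure HolFam (b : ℕ → ℝ) (ξ : ℝ) (δ : ENNReal) (uN : ∀ N : ℕ, (Fin N → ℝ) → X) : Prop where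
  consistent : ∀ N M : ℕ, 0 < N → N < M → ∀ y : Fin N → ℝ, uN N y = uN M (padZero M y)
  extension : ∀ N : ℕ, 0 < N → ∃ φ : (Fin N → ℝ) → ENNReal, Measurable φ ∧
    l2 (gaussN N) φ ≤ δ ∧ ∀ ρ : Fin N → ℝ, Admissible b ξ ρ →
      ∃ F : (Fin N → ℂ) → X, PolyBound ρ φ F ∧ ∀ y : Fin N → ℝ, F (toC y) = uN N y

/-- The bound φ in the definition of holomorphy is only a.e. measurable, whereas pointwise bounds
must hold everywhere and Tonelli needs measurability. Setting the majorant to ∞ on a null set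
reconciles the two. -/
lemma exists_measurable_majorant {Ω : Type*} [MeasurableSpace Ω] {μ : Measure Ω} {f : Ω → ENNReal}
    (hf : AEMeasurable f μ) : ∃ g : Ω → ENNReal, Measurable g ∧ (∀ x, f x ≤ g x) ∧ g =ᵐ[μ] f := by
  classical
  set T := toMeasurable μ {x | f x ≠ hf.mk f x}
  have hT : MeasurableSet T := measurableSet_toMeasurable _ _
  have hT0 : μ T = 0 := by
    rw [measure_toMeasurable]
    exact hf.ae_eq_mk
  refine ⟨T.piecewise (fun _ => ⊤) (hf.mk f), measurable_const.piecewise hT hf.measurable_mk,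
    fun x => ?_, ?_⟩
  · by_cases hx : x ∈ T
    · simp [hx]
    · have : f x = hf.mk f x := by
        by_contra hne
        exact hx (subset_toMeasurable _ _ hne)
      simp [hx, this]
  · have h1 : ∀ᵐ x ∂μ, x ∉ T := measure_eq_zero_iff_ae_notMem.1 hT0
    filter_upwards [h1, hf.ae_eq_mk] with x hx hx'
    simp [hx, hx']

/-- A larger sequence admits fewer radii. -/
lemma HolFam.mono {b b' : ℕ → ℝ} {ξ : ℝ} {δ : ENNReal} {uN : ∀ N : ℕ, (Fin N → ℝ) → X}
    (h : HolFam b ξ δ uN) (hb : ∀ j, b j ≤ b' j) : HolFam b' ξ δ uN where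
  consistent := h.consistent
  extension N hN := by
    obtain ⟨φ, hφ, hδ, hF⟩ := h.extension N hN
    refine ⟨φ, hφ, hδ, fun ρ hρ => hF ρ ⟨hρ.1, le_trans ?_ hρ.2⟩⟩
    exact Finset.sum_le_sum fun j _ => mul_le_mul_of_nonneg_right (hb j) (hρ.1 j).le

lemma HolFam.sub {b : ℕ → ℝ} {ξ : ℝ} {δ δ' : ENNReal} {uN vN : ∀ N : ℕ, (Fin N → ℝ) → X}
    (hu : HolFam b ξ δ uN) (hv : HolFam b ξ δ' vN) :
    HolFam b ξ (δ + δ') fun N y => uN N y - vN N y where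
  consistent N M hN hM y := by rw [hu.consistent N M hN hM, hv.consistent N M hN hM]
  extension N hN := by
    obtain ⟨φ, hφ, hδ, hF⟩ := hu.extension N hN
    obtain ⟨ψ, hψ, hδ', hG⟩ := hv.extension N hN
    refine ⟨fun y => φ y + ψ y, hφ.add hψ, ?_, fun ρ hρ => ?_⟩
    · refine le_trans ?_ (add_le_add hδ hδ')
      have := ENNReal.lintegral_Lp_add_le (p := 2) (μ := gaussN N) hφ.aemeasurable
        hψ.aemeasurable (by norm_num)
      simpa [l2] using this
    · obtain ⟨F, hF1, hF2⟩ := hF ρ hρ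
      obtain ⟨G, hG1, hG2⟩ := hG ρ hρ
      refine ⟨fun z => F z - G z, ⟨hF1.diff.sub hG1.diff, fun y z hz => ?_⟩, fun y => ?_⟩
      · exact (enorm_sub_le).trans (add_le_add (hF1.bound y z hz) (hG1.bound y z hz))
      · change F (toC y) - G (toC y) = _
        rw [hF2, hG2]

lemma exists_admissible_const {b : ℕ → ℝ} (hb : ∀ j, 0 < b j) {ξ : ℝ} (hξ : 0 < ξ) (N : ℕ) :
    ∃ c : ℝ, 0 < c ∧ Admissible b ξ (fun _ : Fin N => c) := by
  have hs : 0 ≤ ∑ j : Fin N, b j := Finset.sum_nonneg fun j _ => (hb j).le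
  refine ⟨ξ / (∑ j : Fin N, b j + 1), by positivity, fun _ => by positivity, ?_⟩
  rw [← Finset.sum_mul, mul_div_assoc', div_le_iff₀ (by positivity)]
  nlinarith

lemma HolFam.continuous {b : ℕ → ℝ} (hb : ∀ j, 0 < b j) {ξ : ℝ} (hξ : 0 < ξ) {δ : ENNReal}
    {uN : ∀ N : ℕ, (Fin N → ℝ) → X} (h : HolFam b ξ δ uN) {N : ℕ} (hN : 0 < N) :
    Continuous (uN N) := by
  obtain ⟨c, hc, hadm⟩ := exists_admissible_const hb hξ N
  obtain ⟨φ, -, -, hF⟩ := h.extension N hN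
  obtain ⟨F, hF1, hF2⟩ := hF _ hadm
  have h1 : Continuous (toC : (Fin N → ℝ) → Fin N → ℂ) := by
    unfold toC
    fun_prop
  have h2 := hF1.diff.continuousOn.comp_continuous h1 fun y j => by simpa [toC] using hc
  exact h2.congr hF2

end

section
variable {X : Type*} [NormedAddCommGroup X] [InnerProductSpace ℂ X]

lemma HolomorphicFamily.holFam {b : ℕ → ℝ} {ξ δ : ℝ} {u : (ℕ → ℝ) → X}
    {uN : ∀ N : ℕ, (Fin N → ℝ) → X} (h : HolomorphicFamily b ξ δ u uN) :
    HolFam b ξ (ENNReal.ofReal δ) uN where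
  consistent := h.consistent
  extension N hN := by
    obtain ⟨φ, hφ0, hφm, hφδ, hF⟩ := h.extension N hN
    obtain ⟨g, hg, hge, hgae⟩ := exists_measurable_majorant
      (hφm.aestronglyMeasurable.aemeasurable.ennreal_ofReal)
    refine ⟨g, hg, ?_, fun ρ hρ => ?_⟩
    · refine le_trans (le_of_eq ?_) hφδ
      rw [← l2_enorm, l2, l2]
      congr 1
      refine lintegral_congr_ae ?_
      filter_upwards [hgae] with x hx
      rw [hx, ← ofReal_norm, Real.norm_of_nonneg (hφ0 x)]
    · obtain ⟨F, hF1, hF2, hF3⟩ := hF ρ hρ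
      refine ⟨F, ⟨hF1, fun y z hz => ?_⟩, hF2⟩
      refine le_trans ?_ (hge y)
      rw [← ofReal_norm]
      exact ENNReal.ofReal_le_ofReal (hF3 y z hz)

lemma continuous_detail (ν : MIdx) (v : (ℕ →₀ ℝ) → X) : Continuous (detail ν v) := by
  unfold detail tensorInterp
  have h : ∀ (s : Finset ℕ) (P : ℕ → Polynomial ℝ),
      Continuous fun y : ℕ → ℝ => ∏ j ∈ s, (P j).eval (y j) := fun s P =>
    continuous_finsetProd s fun j _ => (P j).continuous.comp (continuous_apply j)
  exact continuous_finsetSum _ fun S _ => Continuous.const_smul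
    (continuous_finsetSum _ fun x _ => Continuous.smul (h _ _) continuous_const) _

/-- Inactive directions contribute only ball measures, whose total cost is B; active ones contribute
the univariate increment bounds, whose L²-norms multiply by independence. The radii are free, so
they may depend on ν. -/
lemma HolFam.eLpNorm_detail_le [CompleteSpace X] {b : ℕ → ℝ} {ξ : ℝ} {δ : ENNReal}
    {uN : ∀ N : ℕ, (Fin N → ℝ) → X} (h : HolFam b ξ δ uN) (t : ℕ) {ρ₀ : ℝ} (hρ₀ : 0 < ρ₀)
    {ρ : ℕ → ℝ} (hρ : ∀ j, ρ₀ ≤ ρ j) (hb : ∀ N : ℕ, ∑ j ∈ Finset.range N, b j * ρ j ≤ ξ)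
    {B : ENNReal} (hB : ∀ s : Finset ℕ, ∏ j ∈ s, ballMeas (ρ j) ^ (-(1 / 2) : ℝ) ≤ B)
    (ν : MIdx) :
    eLpNorm (detail ν (evalFin uN)) 2 gaussU ≤
      B * δ * ∏ j ∈ ν.support, ENNReal.ofReal (incrConst t ρ₀ / ρ j / (ν j + 1) ^ t * (ν j + 1)) := by
  set N := ν.support.sup id + 1 with hN
  have hνN : ν.support ⊆ Finset.range N := fun j hj =>
    Finset.mem_range.2 (Nat.lt_succ_of_le (Finset.le_sup (f := id) hj))
  obtain ⟨φ, hφ, hφδ, hF⟩ := h.extension N (Nat.succ_pos _)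
  obtain ⟨F, hF1, hF2⟩ := hF (fun j => ρ j) ⟨fun j => lt_of_lt_of_le hρ₀ (hρ j), by
    have := hb N
    rwa [Finset.sum_range] at this⟩
  have hpt : ∀ y : ℕ → ℝ, ‖detail ν (evalFin uN) y‖ₑ ≤ B * δ * ∏ j ∈ ν.support,
      ENNReal.ofReal (incrConst t ρ₀ / ρ j / (ν j + 1) ^ t * hsum (ν j) (y j)) := by
    intro y
    rw [detail_evalFin h.consistent (Nat.succ_pos _) hνN]
    have h1 := hF1.enorm_tincr_le t hρ₀ (fun j => hρ j) hφ (fun j => ν j) (fun j => y j)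
    simp_rw [hF2] at h1
    refine h1.trans ?_
    have h2 : ∏ j : Fin N, incrBound t ρ₀ (ρ j) (ν j) (y j) =
        (∏ j ∈ Finset.range N \ ν.support, ballMeas (ρ j) ^ (-(1 / 2) : ℝ)) *
        ∏ j ∈ ν.support,
          ENNReal.ofReal (incrConst t ρ₀ / ρ j / (ν j + 1) ^ t * hsum (ν j) (y j)) := by
      rw [← Finset.prod_range fun j => incrBound t ρ₀ (ρ j) (ν j) (y j), ← Finset.prod_sdiff hνN]
      congr 1
      · refine Finset.prod_congr rfl fun j hj => ?_
        rw [Finset.mem_sdiff, Finsupp.notMem_support_iff] at hj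
        rw [hj.2]
        rfl
      · refine Finset.prod_congr rfl fun j hj => ?_
        rw [Finsupp.mem_support_iff] at hj
        obtain ⟨m, hm⟩ := Nat.exists_eq_succ_of_ne_zero hj
        rw [hm, incrBound]
        push_cast
        rw [show (m : ℝ) + 1 + 1 = m + 2 by ring]
    calc _ ≤ (B * ∏ j ∈ ν.support,
          ENNReal.ofReal (incrConst t ρ₀ / ρ j / (ν j + 1) ^ t * hsum (ν j) (y j))) * δ := by
            rw [h2]
            gcongr
            exact hB _
      _ = _ := by ring
  rw [← l2_enorm]
  refine (l2_mono gaussU hpt).trans ?_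
  have hm : ∀ j, Measurable fun x : ℝ =>
      ENNReal.ofReal (incrConst t ρ₀ / ρ j / (ν j + 1) ^ t * hsum (ν j) x) := fun j =>
    ((continuous_hsum _).measurable.const_mul _).ennreal_ofReal
  have hmp : Measurable fun y : ℕ → ℝ => ∏ j ∈ ν.support,
      ENNReal.ofReal (incrConst t ρ₀ / ρ j / (ν j + 1) ^ t * hsum (ν j) (y j)) :=
    Finset.measurable_prod _ fun j _ => (hm j).comp (measurable_pi_apply j)
  rw [l2_const_mul _ _ hmp, l2_gaussU_prod _ hm]
  gcongr with j hj
  have hc : 0 ≤ incrConst t ρ₀ / ρ j / (ν j + 1) ^ t := by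
    have := incrConst_pos t ρ₀
    have := lt_of_lt_of_le hρ₀ (hρ j)
    positivity
  simp_rw [ENNReal.ofReal_mul hc]
  rw [l2_const_mul _ _ (continuous_hsum _).measurable.ennreal_ofReal]
  gcongr
  refine (l2_hsum_le _).trans (le_of_eq ?_)
  rw [ENNReal.ofReal_add (by positivity) zero_le_one]
  simp

/-- The multiindex with the given first entries. -/
noncomputable def toMIdx {N : ℕ} (ν : Fin N → ℕ) : MIdx :=
  Finsupp.indicator (Finset.range N) fun j hj => ν ⟨j, Finset.mem_range.1 hj⟩

lemma toMIdx_apply {N : ℕ} (ν : Fin N → ℕ) (j : Fin N) : toMIdx ν j = ν j := by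
  rw [toMIdx, Finsupp.indicator_of_mem (Finset.mem_range.2 j.2)]

lemma toMIdx_injective {N : ℕ} : Function.Injective (toMIdx (N := N)) := by
  intro ν ν' h
  ext j
  rw [← toMIdx_apply ν, h, toMIdx_apply]

lemma support_toMIdx {N : ℕ} (ν : Fin N → ℕ) : (toMIdx ν).support ⊆ Finset.range N :=
  Finsupp.support_indicator_subset _ _

lemma toMIdx_restrict {N : ℕ} {ν : MIdx} (hν : ν.support ⊆ Finset.range N) :
    toMIdx (fun j : Fin N => ν j) = ν := by
  ext j
  by_cases hj : j < N
  · exact toMIdx_apply _ ⟨j, hj⟩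
  · rw [Finsupp.notMem_support_iff.1 fun h => hj (Finset.mem_range.1 (hν h)),
      Finsupp.notMem_support_iff.1 fun h => hj (Finset.mem_range.1 (support_toMIdx _ h))]

lemma HolFam.hasSum_detail [CompleteSpace X] {b : ℕ → ℝ} (hb : ∀ j, 0 < b j) {ξ : ℝ} (hξ : 0 < ξ)
    {δ : ENNReal} (hδ : δ ≠ ⊤) {uN : ∀ N : ℕ, (Fin N → ℝ) → X} (h : HolFam b ξ δ uN) {N : ℕ}
    (hN : 0 < N) (y : ℕ → ℝ) :
    HasSum (fun ν : Fin N → ℕ => detail (toMIdx ν) (evalFin uN) y) (uN N fun j => y j) := by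
  obtain ⟨c, hc, hadm⟩ := exists_admissible_const hb hξ N
  obtain ⟨φ, hφ, hφδ, hF⟩ := h.extension N hN
  obtain ⟨F, hF1, hF2⟩ := hF _ hadm
  have h1 := hF1.hasSum_tincr hc (fun _ => le_rfl) hφ (ne_top_of_le_ne_top hδ hφδ) fun j => y j
  simp_rw [hF2] at h1
  refine h1.congr_fun fun ν => ?_
  rw [detail_evalFin h.consistent hN (support_toMIdx ν)]
  simp_rw [toMIdx_apply]

/-- For fixed N the details in the first N variables sum pointwise to uN N, and Fatou's lemma
transfers the bound T on finite partial sums outside Λ to that limit. Then N tends to infinity in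
L². -/
lemma HolFam.eLpNorm_sub_sum_le [CompleteSpace X] {b : ℕ → ℝ} (hb : ∀ j, 0 < b j) {ξ : ℝ}
    (hξ : 0 < ξ) {δ : ENNReal} (hδ : δ ≠ ⊤) {uN : ∀ N : ℕ, (Fin N → ℝ) → X}
    (h : HolFam b ξ δ uN) {u : (ℕ → ℝ) → X} (hu : AEStronglyMeasurable u gaussU)
    (hlim : Tendsto (fun N : ℕ => eLpNorm (fun y => u y - uN N (fun j : Fin N => y j)) 2 gaussU)
      atTop (𝓝 0))
    {a : MIdx → ENNReal} (ha : ∀ ν, eLpNorm (detail ν (evalFin uN)) 2 gaussU ≤ a ν)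
    (Λ : Finset MIdx) {T : ENNReal} (hT : ∀ s : Finset MIdx, Disjoint s Λ → ∑ ν ∈ s, a ν ≤ T) :
    eLpNorm (fun y => u y - ∑ ν ∈ Λ, detail ν (evalFin uN) y) 2 gaussU ≤ T := by
  classical
  have hmd : ∀ ν, AEStronglyMeasurable (detail ν (evalFin uN)) gaussU := fun ν =>
    (continuous_detail ν _).aestronglyMeasurable
  have hmΛ : ∀ s : Finset MIdx, AEStronglyMeasurable (fun y => ∑ ν ∈ s, detail ν (evalFin uN) y)
      gaussU := fun s => (continuous_finsetSum _ fun ν _ => continuous_detail ν _).aestronglyMeasurable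
  have hmN : ∀ N : ℕ, 0 < N → AEStronglyMeasurable (fun y : ℕ → ℝ => uN N fun j => y j) gaussU :=
    fun N hN => ((h.continuous hb hξ hN).comp (by fun_prop)).aestronglyMeasurable
  have hfin : ∀ᶠ N : ℕ in atTop,
      eLpNorm (fun y => uN N (fun j : Fin N => y j) - ∑ ν ∈ Λ, detail ν (evalFin uN) y) 2 gaussU ≤ T := by
    filter_upwards [eventually_gt_atTop ((Λ.biUnion Finsupp.support).sup id)] with N hN
    have hN0 : 0 < N := by omega
    have hΛN : ∀ ν ∈ Λ, ν.support ⊆ Finset.range N := by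
      intro ν hν j hj
      have := Finset.le_sup (f := id) (Finset.mem_biUnion.2 ⟨ν, hν, hj⟩)
      simp only [id] at this
      rw [Finset.mem_range]
      omega
    set Λ' : Finset (Fin N → ℕ) := Λ.image fun ν => fun j : Fin N => ν j
    have hΛ' : Λ'.image toMIdx = Λ := by
      rw [Finset.image_image]
      ext ν
      simp only [Finset.mem_image, Function.comp]
      constructor
      · rintro ⟨μ, hμ, rfl⟩
        rwa [toMIdx_restrict (hΛN μ hμ)]
      · intro hν
        exact ⟨ν, hν, toMIdx_restrict (hΛN ν hν)⟩
    -- Fatou's lemma needs a sequence, so an exhausting sequence of finite sets replaces the net of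
    -- partial sums.
    obtain ⟨s, hs⟩ := exists_seq_tendsto (atTop : Filter (Finset (Fin N → ℕ)))
    obtain ⟨k₀, hk₀⟩ := (hs.eventually (eventually_ge_atTop Λ')).exists_forall_of_atTop
    have hk : ∀ k, eLpNorm (fun y => ∑ ν ∈ s (k + k₀), detail (toMIdx ν) (evalFin uN) y -
        ∑ ν ∈ Λ, detail ν (evalFin uN) y) 2 gaussU ≤ T := by
      intro k
      have hsub := hk₀ (k + k₀) (Nat.le_add_left _ _)
      have h1 : ∀ y, ∑ ν ∈ s (k + k₀), detail (toMIdx ν) (evalFin uN) y -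
          ∑ ν ∈ Λ, detail ν (evalFin uN) y =
          ∑ ν ∈ (s (k + k₀)).image toMIdx \ Λ, detail ν (evalFin uN) y := by
        intro y
        rw [sub_eq_iff_eq_add, Finset.sum_sdiff, Finset.sum_image toMIdx_injective.injOn]
        rw [← hΛ']
        exact Finset.image_subset_image hsub
      simp_rw [h1]
      refine (eLpNorm_fun_sum_le hmd).trans ?_
      exact (Finset.sum_le_sum fun ν _ => ha ν).trans (hT _ Finset.sdiff_disjoint)
    refine (Lp.eLpNorm_lim_le_liminf_eLpNorm (f := fun k y =>
      ∑ ν ∈ s (k + k₀), detail (toMIdx ν) (evalFin uN) y - ∑ ν ∈ Λ, detail ν (evalFin uN) y)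
      (fun k => ?_) _ (ae_of_all _ fun y => ?_)).trans ?_
    · exact (continuous_finsetSum _ fun ν _ => continuous_detail _ _).aestronglyMeasurable.sub (hmΛ Λ)
    · refine Tendsto.sub_const ?_ _
      exact (h.hasSum_detail hb hξ hδ hN0 y).comp (hs.comp (tendsto_add_atTop_nat k₀))
    · exact liminf_le_of_le (by isBoundedDefault) fun b hb => by
        obtain ⟨k, hk'⟩ := hb.exists
        exact hk'.trans (hk k)
  have h1 : ∀ᶠ N : ℕ in atTop,
      eLpNorm (fun y => u y - ∑ ν ∈ Λ, detail ν (evalFin uN) y) 2 gaussU ≤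
        eLpNorm (fun y => u y - uN N (fun j : Fin N => y j)) 2 gaussU + T := by
    filter_upwards [hfin, eventually_gt_atTop 0] with N hN hN0
    have h2 : (fun y => u y - ∑ ν ∈ Λ, detail ν (evalFin uN) y) =
        (fun y => u y - uN N (fun j : Fin N => y j)) +
        fun y => uN N (fun j : Fin N => y j) - ∑ ν ∈ Λ, detail ν (evalFin uN) y := by
      ext y
      simp
    rw [h2]
    refine (eLpNorm_add_le (hu.sub (hmN N hN0)) ((hmN N hN0).sub (hmΛ Λ)) (by norm_num)).trans ?_
    exact add_le_add le_rfl hN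
  have h3 := ge_of_tendsto (hlim.add_const T) h1
  simpa using h3

end

end MLSmolyak

/-! ### Boxes of positive measure and a Schwarz estimate -/

namespace MLSmolyak

lemma exists_prod_ge_of_summable {f : ℕ → ℝ} (hf : ∀ j, 0 < f j) (hs : Summable fun j => 1 - f j) :
    ∃ κ : ℝ, 0 < κ ∧ ∀ s : Finset ℕ, κ ≤ ∏ j ∈ s, f j := by
  have h1 : Summable fun j => Real.log (f j) := by
    have := Real.summable_log_one_add_of_summable hs.neg
    refine this.congr fun j => ?_
    congr 1
    ring
  refine ⟨Real.exp (-∑' j, |Real.log (f j)|), Real.exp_pos _, fun s => ?_⟩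
  have h2 : ∏ j ∈ s, f j = Real.exp (∑ j ∈ s, Real.log (f j)) := by
    rw [Real.exp_sum]
    exact Finset.prod_congr rfl fun j _ => (Real.exp_log (hf j)).symm
  rw [h2, Real.exp_le_exp]
  have h3 : ∑ j ∈ s, |Real.log (f j)| ≤ ∑' j, |Real.log (f j)| :=
    h1.abs.sum_le_tsum s fun _ _ => abs_nonneg _
  have h4 := Finset.abs_sum_le_sum_abs (fun j => Real.log (f j)) s
  have h5 := neg_abs_le (∑ j ∈ s, Real.log (f j))
  linarith

lemma exists_gauss_compl_ball_le {m : ℝ} (hm : 0 < m) :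
    ∃ C : ℝ, 0 ≤ C ∧ ∀ ρ : ℝ, 0 < ρ → gauss.real (Metric.ball 0 ρ)ᶜ ≤ C * ρ ^ (-m) := by
  have hL := memLp_id_gaussianReal' (μ := 0) (v := 1) (ENNReal.ofReal m) ENNReal.ofReal_ne_top
  have hp0 : ENNReal.ofReal m ≠ 0 := (ENNReal.ofReal_pos.2 hm).ne'
  refine ⟨(eLpNorm id (ENNReal.ofReal m) gauss).toReal ^ m, by positivity, fun ρ hρ => ?_⟩
  have h1 := meas_ge_le_mul_pow_eLpNorm_enorm gauss hp0 ENNReal.ofReal_ne_top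
    hL.aestronglyMeasurable (ε := ENNReal.ofReal ρ) (ENNReal.ofReal_pos.2 hρ).ne' (by simp)
  rw [ENNReal.toReal_ofReal hm.le] at h1
  have h2 : (Metric.ball (0 : ℝ) ρ)ᶜ = {x : ℝ | ENNReal.ofReal ρ ≤ ‖id x‖ₑ} := by
    ext x
    rw [Set.mem_compl_iff, Metric.mem_ball, dist_zero_right, not_lt, Set.mem_ofPred_eq, id,
      ← ofReal_norm, ENNReal.ofReal_le_ofReal_iff (norm_nonneg x)]
  rw [measureReal_def, h2]
  refine (ENNReal.toReal_mono ?_ h1).trans (le_of_eq ?_)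
  · refine ENNReal.mul_ne_top (ENNReal.rpow_ne_top_of_nonneg hm.le ?_)
      (ENNReal.rpow_ne_top_of_nonneg hm.le hL.2.ne)
    simp [hρ]
  · rw [ENNReal.toReal_mul, ← ENNReal.toReal_rpow, ← ENNReal.toReal_rpow, ENNReal.toReal_inv,
      ENNReal.toReal_ofReal hρ.le, Real.inv_rpow hρ.le, Real.rpow_neg hρ.le, mul_comm]

/-- By Markov's inequality with moment m = p/(1 - p), the complement of the ball of radius c
b_j^{p-1} has measure O(b_j^p), which is summable; an infinite product with summable defects stays
away from zero. -/
lemma exists_prod_ballMeas_ge {b : ℕ → ℝ} (hb : ∀ j, 0 < b j) {p : ℝ} (hp : 0 < p) (hp1 : p < 1)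
    (hs : Summable fun j => b j ^ p) {c : ℝ} (hc : 0 < c) :
    ∃ κ : ENNReal, κ ≠ 0 ∧ κ ≠ ⊤ ∧ ∀ s : Finset ℕ, κ ≤ ∏ j ∈ s, ballMeas (c * b j ^ (p - 1)) := by
  have hp2 : 0 < 1 - p := by linarith
  obtain ⟨C, hC0, hC⟩ := exists_gauss_compl_ball_le (div_pos hp hp2)
  have hρ : ∀ j, 0 < c * b j ^ (p - 1) := fun j => mul_pos hc (Real.rpow_pos_of_pos (hb j) _)
  have hball : ∀ j, (ballMeas (c * b j ^ (p - 1))).toReal =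
      1 - gauss.real (Metric.ball 0 (c * b j ^ (p - 1)))ᶜ := by
    intro j
    rw [probReal_compl_eq_one_sub Metric.isOpen_ball.measurableSet]
    simp [ballMeas, measureReal_def]
  obtain ⟨κ, hκ, hκs⟩ := exists_prod_ge_of_summable
    (f := fun j => (ballMeas (c * b j ^ (p - 1))).toReal)
    (fun j => ENNReal.toReal_pos (ballMeas_pos (hρ j)).ne' (ballMeas_ne_top _)) (by
      refine Summable.of_nonneg_of_le (fun j => ?_) (fun j => ?_)
        (hs.mul_left (C * c ^ (-(p / (1 - p)))))
      · rw [hball, sub_sub_cancel]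
        exact measureReal_nonneg
      · rw [hball, sub_sub_cancel]
        refine (hC _ (hρ j)).trans (le_of_eq ?_)
        rw [Real.mul_rpow hc.le (Real.rpow_nonneg (hb j).le _), ← Real.rpow_mul (hb j).le,
          show (p - 1) * -(p / (1 - p)) = p by field_simp; ring]
        ring)
  refine ⟨ENNReal.ofReal κ, (ENNReal.ofReal_pos.2 hκ).ne', ENNReal.ofReal_ne_top, fun s => ?_⟩
  rw [ENNReal.ofReal_le_iff_le_toReal (ENNReal.prod_ne_top fun j _ => ballMeas_ne_top _),
    ENNReal.toReal_prod]
  exact hκs s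

lemma exists_prod_ge_of_eventually {f g : ℕ → ENNReal} {κ : ENNReal} (hκ : κ ≠ 0) (hκ' : κ ≠ ⊤)
    (hg : ∀ s : Finset ℕ, κ ≤ ∏ j ∈ s, g j) (hf : ∀ j, f j ≠ 0) (hf1 : ∀ j, f j ≤ 1) (J : ℕ)
    (hJ : ∀ j, J ≤ j → g j ≤ f j) :
    ∃ κ' : ENNReal, κ' ≠ 0 ∧ κ' ≠ ⊤ ∧ ∀ s : Finset ℕ, κ' ≤ ∏ j ∈ s, f j := by
  refine ⟨(∏ j ∈ Finset.range J, f j) * κ, mul_ne_zero (Finset.prod_ne_zero_iff.2 fun j _ => hf j) hκ,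
    ENNReal.mul_ne_top (ENNReal.prod_ne_top fun j _ => ne_top_of_le_ne_top ENNReal.one_ne_top (hf1 j))
      hκ', fun s => ?_⟩
  rw [← Finset.prod_inter_mul_prod_sdiff s (Finset.range J)]
  gcongr ?_ * ?_
  · rw [← Finset.prod_sdiff (Finset.inter_subset_right (s₁ := s) (s₂ := Finset.range J))]
    exact mul_le_of_le_one_left' (Finset.prod_le_one' fun j _ => hf1 j)
  · refine (hg _).trans (Finset.prod_le_prod' fun j hj => hJ j ?_)
    simpa using (Finset.mem_sdiff.1 hj).2

section
variable {X : Type*} [NormedAddCommGroup X] [NormedSpace ℂ X]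

/-- Every real x in the box of half radii around y has y + z in its polydisc, so φ x dominates the
value there. Averaging turns the L² bound into a pointwise one. -/
lemma PolyBound.enorm_sq_mul_le {N : ℕ} {ρ : Fin N → ℝ} {φ : (Fin N → ℝ) → ENNReal}
    {F : (Fin N → ℂ) → X} (h : PolyBound ρ φ F) (y : Fin N → ℝ) {z : Fin N → ℂ}
    (hz : ∀ j, ‖z j‖ < ρ j / 2) :
    ‖F (toC y + z)‖ₑ ^ 2 * gaussN N (Set.univ.pi fun j => Metric.ball (y j) (ρ j / 2)) ≤
      l2 (gaussN N) φ ^ 2 := by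
  set Q : Set (Fin N → ℝ) := Set.univ.pi fun j => Metric.ball (y j) (ρ j / 2)
  have hQ : MeasurableSet Q := MeasurableSet.univ_pi fun j => Metric.isOpen_ball.measurableSet
  rw [l2_sq, ← setLIntegral_const]
  refine (setLIntegral_mono' hQ fun x hx => ?_).trans (setLIntegral_le_lintegral Q _)
  gcongr
  have h1 := h.bound x (toC y - toC x + z) fun j => ?_
  · rwa [show toC x + (toC y - toC x + z) = toC y + z by abel] at h1
  · have h2 := hx j (Set.mem_univ j)
    rw [Metric.mem_ball, dist_comm, Real.dist_eq] at h2
    have h3 : ‖toC y j - toC x j‖ < ρ j / 2 := by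
      simp only [toC]
      rwa [← Complex.ofReal_sub, Complex.norm_real, Real.norm_eq_abs]
    calc ‖(toC y - toC x + z) j‖ ≤ ‖toC y j - toC x j‖ + ‖z j‖ := norm_add_le _ _
      _ < ρ j := by linarith [hz j]

lemma differentiable_update {N : ℕ} (z : Fin N → ℂ) (i : Fin N) :
    Differentiable ℂ fun ζ : ℂ => Function.update z i ζ := by
  rw [differentiable_pi]
  intro j
  by_cases hj : j = i
  · subst hj; simp
  · simp [hj]

/-- If the values of `F` in the polydisc are bounded by `S`, then `F` varies slowly in directions
of large radius. -/
lemma PolyBound.norm_update_sub_le {N : ℕ} {ρ : Fin N → ℝ} {φ : (Fin N → ℝ) → ENNReal}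
    {F : (Fin N → ℂ) → X} (h : PolyBound ρ φ F) {y x : Fin N → ℝ} {S : ℝ}
    (hS : ∀ z : Fin N → ℂ, (∀ j, ‖z j‖ < ρ j / 2) → ‖F (toC y + z)‖ ≤ S)
    (hx : ∀ j, |x j - y j| < ρ j / 2) {i : Fin N} (hy : y i = 0) :
    ‖F (toC x) - F (toC (Function.update x i 0))‖ ≤ 2 * S / (ρ i / 2) * |x i| := by
  have hupd : ∀ a : ℝ, toC (Function.update x i a) = Function.update (toC x) i (a : ℂ) := by
    intro a
    ext j
    by_cases hj : j = i
    · subst hj; simp [toC]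
    · simp [toC, hj]
  set g : ℂ → X := fun ζ => F (Function.update (toC x) i ζ) with hg
  have hρ : ∀ j, 0 < ρ j := fun j => by linarith [abs_nonneg (x j - y j), hx j]
  have hz : ∀ ζ : ℂ, ‖ζ‖ < ρ i / 2 → ∀ j, ‖(Function.update (toC x) i ζ - toC y) j‖ < ρ j / 2 := by
    intro ζ hζ j
    by_cases hj : j = i
    · subst hj; simpa [toC, hy] using hζ
    · simp only [Pi.sub_apply, Function.update_of_ne hj, toC]
      rw [← Complex.ofReal_sub, Complex.norm_real]
      exact hx j
  have hgS : ∀ ζ : ℂ, ‖ζ‖ < ρ i / 2 → ‖g ζ‖ ≤ S := by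
    intro ζ hζ
    have := hS _ (hz ζ hζ)
    rwa [add_sub_cancel] at this
  have hd : DifferentiableOn ℂ g (Metric.ball 0 (ρ i / 2)) := by
    refine h.diff.comp (differentiable_update _ _).differentiableOn fun ζ hζ j => ?_
    have h1 := hz ζ (by simpa using hζ) j
    have h2 := (Complex.abs_im_le_norm _).trans_lt h1
    simp only [Pi.sub_apply, Complex.sub_im, toC, Complex.ofReal_im, sub_zero] at h2
    exact h2.trans (by linarith [hρ j])
  have hmaps : Set.MapsTo g (Metric.ball 0 (ρ i / 2)) (Metric.closedBall (g 0) (2 * S)) := by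
    intro ζ hζ
    rw [Metric.mem_closedBall, dist_eq_norm]
    have h1 := hgS ζ (by simpa using hζ)
    have h2 := hgS 0 (by simpa using hρ i)
    linarith [norm_sub_le (g ζ) (g 0)]
  have hxi : (x i : ℂ) ∈ Metric.ball (0 : ℂ) (ρ i / 2) := by
    have := hx i
    rw [hy, sub_zero] at this
    simpa using this
  -- The Schwarz lemma in the i-th variable, on the disc of radius ρ i / 2.
  have h1 := Complex.dist_le_div_mul_dist_of_mapsTo_ball hd hmaps hxi
  rw [dist_eq_norm, dist_zero_right, Complex.norm_real, Real.norm_eq_abs] at h1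
  have e1 : g (x i : ℂ) = F (toC x) := by
    rw [hg]
    simp only
    rw [← hupd, Function.update_eq_self]
  have e2 : g 0 = F (toC (Function.update x i 0)) := by
    rw [hg]
    simp only
    rw [hupd, Complex.ofReal_zero]
  rwa [e1, e2] at h1
end

end MLSmolyak

/-! ### Uniqueness of the finite-dimensional functions -/

namespace MLSmolyak

section
variable {b : ℕ → ℝ} {p : ℝ}

lemma tsum_rpow_pos (hb : ∀ j, 0 < b j) (hs : Summable fun j => b j ^ p) : 0 < ∑' j, b j ^ p :=
  hs.tsum_pos (fun j => Real.rpow_nonneg (hb j).le _) 0 (Real.rpow_pos_of_pos (hb 0) _)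

lemma exists_le_of_summable_rpow (hb : ∀ j, 0 < b j) (hp : 0 < p)
    (hs : Summable fun j => b j ^ p) : ∃ β : ℝ, 0 < β ∧ ∀ j, b j ≤ β := by
  refine ⟨(∑' j, b j ^ p) ^ (1 / p), Real.rpow_pos_of_pos (tsum_rpow_pos hb hs) _, fun j => ?_⟩
  have h1 : b j ^ p ≤ ∑' j, b j ^ p := hs.le_tsum j fun i _ => Real.rpow_nonneg (hb i).le _
  calc b j = (b j ^ p) ^ (1 / p) := by
        rw [← Real.rpow_mul (hb j).le, mul_one_div_cancel hp.ne', Real.rpow_one]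
    _ ≤ _ := Real.rpow_le_rpow (Real.rpow_nonneg (hb j).le _) h1 (by positivity)

lemma summable_rpow_of_le (hb : ∀ j, 0 < b j) (hp : 0 < p) (hs : Summable fun j => b j ^ p)
    {q : ℝ} (hpq : p ≤ q) : Summable fun j => b j ^ q := by
  obtain ⟨β, hβ, hbβ⟩ := exists_le_of_summable_rpow hb hp hs
  refine Summable.of_nonneg_of_le (fun j => Real.rpow_nonneg (hb j).le _) (fun j => ?_)
    (hs.mul_left (β ^ (q - p)))
  rw [show q = (q - p) + p by ring, Real.rpow_add (hb j), show q - p + p - p = q - p by ring]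
  exact mul_le_mul_of_nonneg_right (Real.rpow_le_rpow (hb j).le (hbβ j) (by linarith))
    (Real.rpow_nonneg (hb j).le _)

lemma exists_sum_mul_rpow_le (hb : ∀ j, 0 < b j) (hs : Summable fun j => b j ^ p)
    {ξ : ℝ} (hξ : 0 < ξ) :
    ∃ c : ℝ, 0 < c ∧ ∀ n, ∑ j ∈ Finset.range n, b j * (c * b j ^ (p - 1)) ≤ ξ := by
  have hT := tsum_rpow_pos hb hs
  refine ⟨ξ / ∑' j, b j ^ p, by positivity, fun n => ?_⟩
  have hbρ : ∀ j, b j * (ξ / (∑' j, b j ^ p) * b j ^ (p - 1)) = ξ / (∑' j, b j ^ p) * b j ^ p := by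
    intro j
    rw [Real.rpow_sub_one (hb j).ne']
    have := (hb j).ne'
    field_simp
  simp_rw [hbρ]
  rw [← Finset.mul_sum]
  calc _ ≤ ξ / (∑' j, b j ^ p) * ∑' j, b j ^ p := by
        gcongr
        exact hs.sum_le_tsum _ fun j _ => Real.rpow_nonneg (hb j).le _
    _ = ξ := by field_simp

end

section
variable {X : Type*} [NormedAddCommGroup X] [NormedSpace ℂ X]

/-- Consistency makes wN n the restriction of wN (n + 1) to x_n = 0, so the Schwarz estimate applies
with the large radius available in the n-th direction. The bound S on the values does not depend on
n, because the boxes have measure at least κ in every dimension. -/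
lemma HolFam.exists_norm_succ_sub_le {b : ℕ → ℝ} (hb : ∀ j, 0 < b j) {ξ : ℝ} (hξ : 0 < ξ)
    {δ : ENNReal} (hδ : δ ≠ ⊤) {wN : ∀ N : ℕ, (Fin N → ℝ) → X} (h : HolFam b ξ δ wN)
    {ρ : ℕ → ℝ} (hρ : ∀ j, 0 < ρ j) (hρξ : ∀ n, ∑ j ∈ Finset.range n, b j * ρ j ≤ ξ / 2)
    {N : ℕ} (hN : 0 < N) {y : ℕ → ℝ} (hy : ∀ j, N ≤ j → y j = 0) {κ : ENNReal} (hκ : κ ≠ 0)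
    (hκρ : ∀ s : Finset ℕ, κ ≤ ∏ j ∈ s, gauss (Metric.ball (y j) (ρ j / 2))) :
    ∃ C : ℝ, 0 ≤ C ∧ ∀ n, N ≤ n → ∀ x : ℕ → ℝ, (∀ j, |x j - y j| < ρ j / 2) →
      ‖wN (n + 1) (fun j => x j) - wN n (fun j => x j)‖ ≤ C * (b n * |x n|) := by
  set S : ℝ := Real.sqrt (δ ^ 2 / κ).toReal with hSdef
  have hfin : δ ^ 2 / κ ≠ ⊤ := ENNReal.div_ne_top (ENNReal.pow_ne_top hδ) hκ
  refine ⟨8 * S / ξ, by positivity, fun n hn x hx => ?_⟩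
  obtain ⟨φ, hφ, hφδ, hF⟩ := h.extension (n + 1) (Nat.succ_pos n)
  -- The radii ρ spend half of the budget ξ; the other half goes to the direction n.
  set ρ' : Fin (n + 1) → ℝ := fun j => ρ j + if (j : ℕ) = n then ξ / (2 * b n) else 0 with hρ'
  have hle : ∀ j : Fin (n + 1), ρ j ≤ ρ' j := by
    intro j
    have := hb n
    simp only [hρ']
    split_ifs
    · exact le_add_of_nonneg_right (by positivity)
    · simp
  have hadm : Admissible b ξ ρ' := by
    refine ⟨fun j => lt_of_lt_of_le (hρ j) (hle j), ?_⟩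
    have h1 : ∑ j : Fin (n + 1), b j * ρ' j =
        ∑ j ∈ Finset.range (n + 1), (b j * ρ j + if j = n then ξ / 2 else 0) := by
      rw [Finset.sum_range]
      refine Finset.sum_congr rfl fun j _ => ?_
      simp only [hρ', mul_add]
      congr 1
      split_ifs with hj
      · rw [hj]
        have := (hb n).ne'
        field_simp
      · simp
    rw [h1, Finset.sum_add_distrib, Finset.sum_ite_eq', if_pos (Finset.self_mem_range_succ n)]
    linarith [hρξ (n + 1)]
  obtain ⟨F, hF1, hF2⟩ := hF ρ' hadm
  have hS : ∀ z : Fin (n + 1) → ℂ, (∀ j, ‖z j‖ < ρ' j / 2) →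
      ‖F (toC (fun j : Fin (n + 1) => y j) + z)‖ ≤ S := by
    intro z hz
    have h1 := hF1.enorm_sq_mul_le (fun j : Fin (n + 1) => y j) hz
    have h2 : κ ≤ gaussN (n + 1)
        (Set.univ.pi fun j : Fin (n + 1) => Metric.ball (y j) (ρ' j / 2)) := by
      rw [gaussN, Measure.pi_pi]
      refine (hκρ (Finset.range (n + 1))).trans ?_
      rw [Finset.prod_range]
      refine Finset.prod_le_prod' fun j _ => measure_mono (Metric.ball_subset_ball ?_)
      linarith [hle j]
    have h3 : ‖F (toC (fun j : Fin (n + 1) => y j) + z)‖ₑ ^ 2 ≤ δ ^ 2 / κ := by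
      refine ENNReal.le_div_iff_mul_le (Or.inl hκ) (Or.inr (ENNReal.pow_ne_top hδ)) |>.2 ?_
      calc _ ≤ _ := by gcongr
        _ ≤ _ := h1
        _ ≤ δ ^ 2 := by gcongr
    rw [hSdef]
    refine Real.le_sqrt_of_sq_le ?_
    have h4 := ENNReal.toReal_mono hfin h3
    simpa using h4
  have hx' : ∀ j : Fin (n + 1), |x j - y j| < ρ' j / 2 := fun j => by linarith [hx j, hle j]
  have h1 := hF1.norm_update_sub_le (x := fun j : Fin (n + 1) => x j) hS hx' (i := Fin.last n)
    (hy n hn)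
  rw [hF2, hF2] at h1
  have h2 : Function.update (fun j : Fin (n + 1) => x j) (Fin.last n) 0 =
      padZero (n + 1) fun j : Fin n => x j := by
    ext j
    rw [padZero]
    by_cases hj : j = Fin.last n
    · subst hj; simp
    · have : (j : ℕ) < n := Fin.val_lt_last hj
      simp [hj, this]
  rw [h2, ← h.consistent n (n + 1) (lt_of_lt_of_le hN hn) (Nat.lt_succ_self n)] at h1
  refine h1.trans ?_
  have h5 : ξ / (2 * b n) ≤ ρ' (Fin.last n) := by
    simp only [hρ', Fin.val_last, if_true]
    linarith [hρ n]
  have hbn := hb n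
  have hS0 : 0 ≤ S := Real.sqrt_nonneg _
  calc 2 * S / (ρ' (Fin.last n) / 2) * |x (Fin.last n : ℕ)|
      ≤ 2 * S / (ξ / (2 * b n) / 2) * |x n| := by
        rw [Fin.val_last]
        gcongr
    _ = 8 * S / ξ * (b n * |x n|) := by field_simp; ring

/-- Telescoping bounds the difference of wN M and wN N at x by C times the sum of b_n |x_n|. This is
small on a box around (y, 0, …) whose measure is bounded below uniformly in M. For large M the
L²-norm of wN M is so small that the box contains a point where wN M is small; hence wN N y is
small. -/
lemma HolFam.eq_zero {b : ℕ → ℝ} (hb : ∀ j, 0 < b j) {p : ℝ} (hp : 0 < p) (hp1 : p < 1)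
    (hs : Summable fun j => b j ^ p) {ξ : ℝ} (hξ : 0 < ξ) {δ : ENNReal} (hδ : δ ≠ ⊤)
    {wN : ∀ N : ℕ, (Fin N → ℝ) → X} (h : HolFam b ξ δ wN)
    (hlim : Tendsto (fun N : ℕ => eLpNorm (fun y => wN N (fun j : Fin N => y j)) 2 gaussU)
      atTop (𝓝 0)) {N : ℕ} (hN : 0 < N) (y : Fin N → ℝ) : wN N y = 0 := by
  set y' : ℕ → ℝ := fun j => if hj : j < N then y ⟨j, hj⟩ else 0 with hy'
  have hy'0 : ∀ j, N ≤ j → y' j = 0 := fun j hj => dif_neg (by omega)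
  have hy'y : (fun j : Fin N => y' j) = y := by
    ext j
    simp [hy']
  obtain ⟨c, hc0, hρξ⟩ := exists_sum_mul_rpow_le hb hs (half_pos hξ)
  set ρ : ℕ → ℝ := fun j => c * b j ^ (p - 1) with hρdef
  have hρ : ∀ j, 0 < ρ j := fun j => mul_pos hc0 (Real.rpow_pos_of_pos (hb j) _)
  have hsum : Summable fun j => b j * ρ j :=
    summable_of_sum_range_le (fun j => mul_nonneg (hb j).le (hρ j).le) hρξ
  obtain ⟨κ₀, hκ₀, hκ₀', hκ₀s⟩ := exists_prod_ballMeas_ge hb hp hp1 hs (half_pos hc0)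
  have hκ₀ρ : ∀ s : Finset ℕ, κ₀ ≤ ∏ j ∈ s, ballMeas (ρ j / 2) := by
    intro s
    refine (hκ₀s s).trans (le_of_eq (Finset.prod_congr rfl fun j _ => ?_))
    simp only [hρdef]
    congr 1
    ring
  have hboxes : ∀ (r : ℕ → ℝ) (J : ℕ), N ≤ J → (∀ j, 0 < r j) → (∀ j, J ≤ j → r j = ρ j / 2) →
      ∃ κ' : ENNReal, κ' ≠ 0 ∧ κ' ≠ ⊤ ∧
        ∀ s : Finset ℕ, κ' ≤ ∏ j ∈ s, gauss (Metric.ball (y' j) (r j)) := by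
    intro r J hJ hr hrJ
    refine exists_prod_ge_of_eventually hκ₀ hκ₀' hκ₀ρ (fun j => ?_) (fun j => prob_le_one) J
      fun j hj => ?_
    · exact (gauss_pos_of_isOpen Metric.isOpen_ball ⟨y' j, by simpa using hr j⟩).ne'
    · rw [hy'0 j (hJ.trans hj), hrJ j hj, ballMeas]
  obtain ⟨κ, hκ, hκ', hκs⟩ := hboxes (fun j => ρ j / 2) N le_rfl (fun j => half_pos (hρ j))
    fun _ _ => rfl
  obtain ⟨C, hC0, hC⟩ := h.exists_norm_succ_sub_le hb hξ hδ hρ hρξ hN hy'0 hκ hκs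
  have htel : ∀ M, N ≤ M → ∀ x : ℕ → ℝ, (∀ j, |x j - y' j| < ρ j / 2) →
      ‖wN M (fun j => x j) - wN N (fun j => x j)‖ ≤ C * ∑ n ∈ Finset.Ico N M, b n * |x n| := by
    intro M hM x hx
    induction M, hM using Nat.le_induction with
    | base => simp
    | succ M hM ih =>
      rw [Finset.sum_Ico_succ_top hM, mul_add]
      have h1 := hC M hM x hx
      have h2 := norm_add_le (wN M (fun j => x j) - wN N fun j => x j)
        (wN (M + 1) (fun j => x j) - wN M fun j => x j)
      rw [show wN M (fun j => x j) - wN N (fun j => x j) +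
        (wN (M + 1) (fun j => x j) - wN M fun j => x j) =
        wN (M + 1) (fun j => x j) - wN N fun j => x j by abel] at h2
      linarith
  have hcont := h.continuous hb hξ hN
  have key : ∀ ε : ℝ, 0 < ε → ‖wN N y‖ ≤ ε + (ε + C * (ε + ε)) := by
    intro ε hε
    obtain ⟨σ₀, hσ₀, hσ₀c⟩ := Metric.continuousAt_iff.1 (hcont.continuousAt (x := y)) ε hε
    obtain ⟨s₀, hs₀⟩ := summable_iff_vanishing_norm.1 hsum ε hε
    -- Beyond J the directions contribute at most ε in total even with the full radii ρ j, so only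
    -- finitely many sides of the box must shrink with ε.
    set J := N + s₀.sup id + 1 with hJ
    have hJN : N ≤ J := by omega
    have hBpos : 0 < ∑ j ∈ Finset.range J, b j + 1 := by
      have : 0 ≤ ∑ j ∈ Finset.range J, b j := Finset.sum_nonneg fun j _ => (hb j).le
      linarith
    -- The first bound is the modulus of continuity of wN N at y; the second makes the directions
    -- below J contribute at most ε.
    set σ := min σ₀ (ε / (∑ j ∈ Finset.range J, b j + 1)) with hσ
    have hσ0 : 0 < σ := lt_min hσ₀ (div_pos hε hBpos)
    set η : ℕ → ℝ := fun j => if j < J then min (ρ j / 2) σ else ρ j / 2 with hη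
    have hηρ : ∀ j, η j ≤ ρ j / 2 := by
      intro j
      simp only [hη]
      split_ifs
      · exact min_le_left _ _
      · exact le_rfl
    have hη0 : ∀ j, 0 < η j := by
      intro j
      have := hρ j
      simp only [hη]
      split_ifs
      · exact lt_min (by linarith) hσ0
      · linarith
    obtain ⟨κ', hκ'0, hκ't, hκ's⟩ := hboxes η J hJN hη0 fun j hj => by
      simp only [hη, if_neg (not_lt.2 hj)]
    have hpos : 0 < ENNReal.ofReal ε * κ' ^ (1 / 2 : ℝ) :=
      ENNReal.mul_pos (ENNReal.ofReal_pos.2 hε).ne'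
        (ENNReal.rpow_pos (pos_iff_ne_zero.2 hκ'0) hκ't).ne'
    obtain ⟨M, hMlim, hMJ⟩ := ((hlim.eventually_lt_const hpos).and (eventually_ge_atTop J)).exists
    set Q : Set (ℕ → ℝ) := Set.pi (Finset.range M) fun j => Metric.ball (y' j) (η j) with hQ
    have hQm : MeasurableSet Q := MeasurableSet.pi (Finset.range M).countable_toSet
      fun j _ => Metric.isOpen_ball.measurableSet
    have hQμ : κ' ≤ gaussU Q := by
      rw [hQ, gaussU, Measure.infinitePi_pi _ fun j _ => Metric.isOpen_ball.measurableSet]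
      exact hκ's _
    -- Otherwise the integral over Q alone would make the L²-norm of wN M at least ε κ'^{1/2}.
    obtain ⟨x, hxQ, hxs⟩ : ∃ x ∈ Q, ‖wN M fun j => x j‖ < ε := by
      by_contra! hcon
      refine hMlim.not_ge ?_
      rw [← l2_enorm, l2]
      have h1 : ENNReal.ofReal ε ^ 2 * κ' ≤ ∫⁻ x, ‖wN M fun j => x j‖ₑ ^ 2 ∂gaussU := by
        calc ENNReal.ofReal ε ^ 2 * κ' ≤ ENNReal.ofReal ε ^ 2 * gaussU Q := by gcongr
          _ = ∫⁻ _ in Q, ENNReal.ofReal ε ^ 2 ∂gaussU := (setLIntegral_const _ _).symm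
          _ ≤ ∫⁻ x in Q, ‖wN M fun j => x j‖ₑ ^ 2 ∂gaussU := by
            refine setLIntegral_mono' hQm fun x hx => ?_
            gcongr
            rw [← ofReal_norm]
            exact ENNReal.ofReal_le_ofReal (hcon x hx)
          _ ≤ _ := setLIntegral_le_lintegral _ _
      refine le_trans (le_of_eq ?_) (ENNReal.rpow_le_rpow h1 (by norm_num : (0 : ℝ) ≤ 1 / 2))
      rw [ENNReal.mul_rpow_of_nonneg _ _ (by norm_num), ← ENNReal.rpow_natCast, ← ENNReal.rpow_mul]
      norm_num
    set x' : ℕ → ℝ := fun j => if j < M then x j else y' j with hx'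
    have hx'η : ∀ j, |x' j - y' j| < η j := by
      intro j
      simp only [hx']
      split_ifs with hj
      · have := hxQ j (by simpa using hj)
        rwa [Metric.mem_ball, Real.dist_eq] at this
      · simpa using hη0 j
    have hx'M : (fun j : Fin M => x' j) = fun j : Fin M => x j := by
      ext j
      simp [hx']
    have h1 := htel M (hJN.trans hMJ) x' fun j => (hx'η j).trans_le (hηρ j)
    rw [hx'M] at h1
    have h2 : ‖wN N y - wN N fun j => x' j‖ ≤ ε := by
      rw [← dist_eq_norm, dist_comm]
      refine (hσ₀c ?_).le
      rw [dist_pi_lt_iff hσ₀]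
      intro j
      rw [Real.dist_eq, ← hy'y]
      refine (hx'η j).trans_le ?_
      have : (j : ℕ) < J := by omega
      simp only [hη, if_pos this]
      exact (min_le_right _ _).trans (min_le_left _ _)
    have h3 : ∑ n ∈ Finset.Ico N M, b n * |x' n| ≤ ε + ε := by
      have h4 : ∑ n ∈ Finset.Ico N M, b n * |x' n| ≤ ∑ n ∈ Finset.Ico N M, b n * η n := by
        refine Finset.sum_le_sum fun n hn => mul_le_mul_of_nonneg_left ?_ (hb n).le
        have := hx'η n
        rw [hy'0 n (Finset.mem_Ico.1 hn).1, sub_zero] at this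
        exact this.le
      refine h4.trans ?_
      rw [← Finset.sum_Ico_consecutive _ hJN hMJ]
      refine add_le_add ?_ ?_
      · calc ∑ n ∈ Finset.Ico N J, b n * η n ≤
            ∑ n ∈ Finset.Ico N J, b n * (ε / (∑ j ∈ Finset.range J, b j + 1)) := by
              refine Finset.sum_le_sum fun n hn => mul_le_mul_of_nonneg_left ?_ (hb n).le
              simp only [hη, if_pos (Finset.mem_Ico.1 hn).2]
              exact (min_le_right _ _).trans (min_le_right _ _)
          _ ≤ ∑ n ∈ Finset.range J, b n * (ε / (∑ j ∈ Finset.range J, b j + 1)) := by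
              refine Finset.sum_le_sum_of_subset_of_nonneg ?_ fun j _ _ =>
                mul_nonneg (hb j).le (div_pos hε hBpos).le
              intro j hj
              exact Finset.mem_range.2 (Finset.mem_Ico.1 hj).2
          _ ≤ ε := by
              rw [← Finset.sum_mul, mul_div_assoc', div_le_iff₀ hBpos]
              nlinarith
      · have h5 := hs₀ (Finset.Ico J M) (by
          rw [Finset.disjoint_left]
          intro j hj hj'
          have := Finset.le_sup (f := id) hj'
          simp only [id] at this
          have := (Finset.mem_Ico.1 hj).1
          omega)
        refine le_trans (Finset.sum_le_sum fun n hn => ?_) ((le_abs_self _).trans h5.le)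
        have := hηρ n
        exact mul_le_mul_of_nonneg_left (by linarith [hρ n]) (hb n).le
    have h6 := mul_le_mul_of_nonneg_left h3 hC0
    have h7 := norm_add₃_le (a := wN N y - wN N fun j => x' j)
      (b := (wN N fun j => x' j) - wN M fun j => x j) (c := wN M fun j => x j)
    rw [show (wN N y - wN N fun j => x' j) + ((wN N fun j => x' j) - wN M fun j => x j) +
      (wN M fun j => x j) = wN N y by abel, norm_sub_rev (wN N fun j => x' j)] at h7
    linarith
  by_contra hne
  have hpos : 0 < ‖wN N y‖ := norm_pos_iff.2 hne
  have h1 := key (‖wN N y‖ / (2 * (2 + 2 * C))) (by positivity)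
  have h2 : ‖wN N y‖ / (2 * (2 + 2 * C)) + (‖wN N y‖ / (2 * (2 + 2 * C)) +
      C * (‖wN N y‖ / (2 * (2 + 2 * C)) + ‖wN N y‖ / (2 * (2 + 2 * C)))) = ‖wN N y‖ / 2 := by
    field_simp
    ring
  linarith

/-- Two families with the same limit that are holomorphic for summable sequences coincide. -/
lemma HolFam.eq_of_tendsto {b b' : ℕ → ℝ} (hb : ∀ j, 0 < b j) (hb' : ∀ j, 0 < b' j) {p : ℝ}
    (hp : 0 < p) (hp1 : p < 1) (hs : Summable fun j => b j ^ p) (hs' : Summable fun j => b' j ^ p)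
    {ξ : ℝ} (hξ : 0 < ξ) {δ δ' : ENNReal} (hδ : δ ≠ ⊤) (hδ' : δ' ≠ ⊤)
    {uN vN : ∀ N : ℕ, (Fin N → ℝ) → X} (hu : HolFam b ξ δ uN) (hv : HolFam b' ξ δ' vN)
    {u : (ℕ → ℝ) → X} (hum : AEStronglyMeasurable u gaussU)
    (hulim : Tendsto (fun N : ℕ => eLpNorm (fun y => u y - uN N (fun j : Fin N => y j)) 2 gaussU)
      atTop (𝓝 0))
    (hvlim : Tendsto (fun N : ℕ => eLpNorm (fun y => u y - vN N (fun j : Fin N => y j)) 2 gaussU)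
      atTop (𝓝 0)) {N : ℕ} (hN : 0 < N) (y : Fin N → ℝ) : uN N y = vN N y := by
  -- Radii admissible for b + b' are admissible for both sequences, and b + b' is again in ℓ^p.
  have h1 : HolFam (fun j => b j + b' j) ξ (δ + δ') fun N y => uN N y - vN N y :=
    (hu.mono fun j => le_add_of_nonneg_right (hb' j).le).sub
      (hv.mono fun j => le_add_of_nonneg_left (hb j).le)
  have hs'' : Summable fun j => (b j + b' j) ^ p := by
    refine Summable.of_nonneg_of_le (fun j => Real.rpow_nonneg (add_pos (hb j) (hb' j)).le _)
      (fun j => ?_) (hs.add hs')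
    exact Real.rpow_add_le_add_rpow (hb j).le (hb' j).le hp.le hp1.le
  have h2 := h1.eq_zero (fun j => add_pos (hb j) (hb' j)) hp hp1 hs'' hξ
    (ENNReal.add_ne_top.2 ⟨hδ, hδ'⟩) (by
      have h3 := hulim.add hvlim
      rw [add_zero] at h3
      refine tendsto_of_tendsto_of_tendsto_of_le_of_le' tendsto_const_nhds h3
        (Eventually.of_forall fun _ => zero_le) ?_
      filter_upwards [eventually_gt_atTop 0] with M hM
      have e : (fun y : ℕ → ℝ => uN M (fun j => y j) - vN M fun j => y j) =
          (fun y => u y - vN M fun j => y j) - fun y => u y - uN M fun j => y j := by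
        ext y
        simp
      rw [e]
      have hmu : AEStronglyMeasurable (fun y : ℕ → ℝ => uN M fun j => y j) gaussU :=
        ((hu.continuous hb hξ hM).comp (by fun_prop)).aestronglyMeasurable
      have hmv : AEStronglyMeasurable (fun y : ℕ → ℝ => vN M fun j => y j) gaussU :=
        ((hv.continuous hb' hξ hM).comp (by fun_prop)).aestronglyMeasurable
      refine (eLpNorm_sub_le (hum.sub hmv) (hum.sub hmu) (by norm_num)).trans (le_of_eq ?_)
      rw [add_comm]
      rfl) hN y
  exact sub_eq_zero.1 h2

end

end MLSmolyak

/-! ### Sums of products over multiindices, and the weights -/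

namespace MLSmolyak

lemma prod_toMIdx {N : ℕ} (ν : Fin N → ℕ) {f : ℕ → ℕ → ENNReal} (hf : ∀ j, f j 0 = 1) :
    (toMIdx ν).prod f = ∏ j : Fin N, f j (ν j) := by
  rw [Finsupp.prod_of_support_subset _ (support_toMIdx ν) f fun j _ => hf j, Finset.prod_range]
  exact Finset.prod_congr rfl fun j _ => by rw [toMIdx_apply]

/-- Finitely many multiindices live in finitely many coordinates, where the sum factorizes. -/
lemma tsum_finsupp_prod_le {f : ℕ → ℕ → ENNReal} (hf : ∀ j, f j 0 = 1) {T : ENNReal}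
    (hT : ∀ N, ∏ j ∈ Finset.range N, ∑' n, f j n ≤ T) : ∑' ν : MIdx, ν.prod f ≤ T := by
  classical
  rw [ENNReal.tsum_eq_iSup_sum]
  refine iSup_le fun s => ?_
  set N := (s.biUnion Finsupp.support).sup id + 1
  have hN : ∀ ν ∈ s, ν.support ⊆ Finset.range N := by
    intro ν hν j hj
    have := Finset.le_sup (f := id) (Finset.mem_biUnion.2 ⟨ν, hν, hj⟩)
    exact Finset.mem_range.2 (Nat.lt_succ_of_le this)
  calc ∑ ν ∈ s, ν.prod f
      = ∑ ν ∈ s.image fun ν => fun j : Fin N => ν j, (toMIdx ν).prod f := by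
        rw [Finset.sum_image]
        · exact Finset.sum_congr rfl fun ν hν => by rw [toMIdx_restrict (hN ν hν)]
        · intro ν hν μ hμ h
          rw [← toMIdx_restrict (hN ν hν), ← toMIdx_restrict (hN μ hμ)]
          exact congrArg toMIdx h
    _ ≤ ∑' ν : Fin N → ℕ, (toMIdx ν).prod f := ENNReal.sum_le_tsum _
    _ = ∏ j ∈ Finset.range N, ∑' n, f j n := by
        rw [Finset.prod_range, ← tsum_prod_pi]
        exact tsum_congr fun ν => prod_toMIdx ν hf
    _ ≤ T := hT N

/-- Sums of products over multiindices are bounded by an exponential. -/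
lemma tsum_finsupp_prod_le_exp {y g : ℕ → ℝ} (hy : ∀ j, 0 ≤ y j) (hg : ∀ n, 0 ≤ g n)
    (hgs : Summable fun n => g (n + 1)) {H : ℝ}
    (hH : ∀ N, (∑ j ∈ Finset.range N, y j) * ∑' n, g (n + 1) ≤ H) :
    ∑' ν : MIdx, (ν.prod fun j n => if n = 0 then 1 else ENNReal.ofReal (y j * g n)) ≤
      ENNReal.ofReal (Real.exp H) := by
  refine tsum_finsupp_prod_le (fun j => by simp) fun N => ?_
  have h1 : ∀ j, (∑' n, if n = 0 then (1 : ENNReal) else ENNReal.ofReal (y j * g n)) ≤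
      ENNReal.ofReal (Real.exp (y j * ∑' n, g (n + 1))) := by
    intro j
    rw [tsum_eq_zero_add' ENNReal.summable]
    simp only [if_true, Nat.succ_ne_zero, if_false]
    rw [← ENNReal.ofReal_tsum_of_nonneg (fun n => mul_nonneg (hy j) (hg _)) (hgs.mul_left _),
      tsum_mul_left, ← ENNReal.ofReal_one,
      ← ENNReal.ofReal_add zero_le_one (mul_nonneg (hy j) (tsum_nonneg fun n => hg _))]
    refine ENNReal.ofReal_le_ofReal ?_
    rw [add_comm]
    exact Real.add_one_le_exp _
  refine (Finset.prod_le_prod' fun j _ => h1 j).trans ?_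
  rw [← ENNReal.ofReal_prod_of_nonneg fun j _ => (Real.exp_pos _).le, ← Real.exp_sum,
    ← Finset.sum_mul]
  exact ENNReal.ofReal_le_ofReal (Real.exp_le_exp.2 (hH N))

section
variable {b : ℕ → ℝ} {p : ℝ}

lemma rho_pos (hb : ∀ j, 0 < b j) (hs : Summable fun j => b j ^ p) {ξ : ℝ} (hξ : 0 < ξ) (j : ℕ) :
    0 < rho b p ξ j := by
  have := tsum_rpow_pos hb hs
  have := Real.rpow_pos_of_pos (hb j) (p - 1)
  unfold rho
  positivity

lemma rho_eq (b : ℕ → ℝ) (p ξ : ℝ) : ∃ c : ℝ, ∀ j, rho b p ξ j = c * b j ^ (p - 1) :=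
  ⟨_, fun _ => mul_comm _ _⟩

/-- The radii are multiples of b_j^{p-1}, and b_j · b_j^{p-1} = b_j^p. -/
lemma summable_mul_max_rho (hb : ∀ j, 0 < b j) (hp : 0 < p) (hp1 : p < 1)
    (hs : Summable fun j => b j ^ p) {ξ K : ℝ} (hξ : 0 < ξ) (hK : 0 < K) :
    Summable fun j => b j * max 1 (K * rho b p ξ j) := by
  obtain ⟨c, hc⟩ := rho_eq b p ξ
  have hs1 : Summable b := by
    have := summable_rpow_of_le hb hp hs hp1.le
    simpa using this
  have hρ := rho_pos hb hs hξ
  refine Summable.of_nonneg_of_le (fun j => mul_nonneg (hb j).le (by positivity)) (fun j => ?_)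
    (hs1.add (hs.mul_left (K * c)))
  have h1 : max 1 (K * rho b p ξ j) ≤ 1 + K * rho b p ξ j := by
    have := mul_pos hK (hρ j)
    exact max_le (by linarith) (by linarith)
  refine (mul_le_mul_of_nonneg_left h1 (hb j).le).trans (le_of_eq ?_)
  rw [hc, Real.rpow_sub_one (hb j).ne']
  have := (hb j).ne'
  field_simp

end

/-- The decay in the univariate degree that remains after multiplication by the weight. -/
noncomputable def degDecay (t : ℕ) (r : ℝ) (n : ℕ) : ℝ :=
  (n : ℝ) ^ ((r - 3) / 2) * ((n + 1) / (n + 1) ^ t)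

lemma degDecay_nonneg (t : ℕ) (r : ℝ) (n : ℕ) : 0 ≤ degDecay t r n := by
  unfold degDecay; positivity

lemma summable_degDecay {t : ℕ} {r : ℝ} (hr : 3 ≤ r) (ht : (r - 3) / 2 + 3 ≤ t) :
    Summable fun n => degDecay t r (n + 1) := by
  have h1 : Summable fun n : ℕ => 1 / (((n + 2 : ℕ) : ℝ)) ^ 2 :=
    (summable_nat_add_iff 2).2 (Real.summable_one_div_nat_pow.2 one_lt_two)
  refine Summable.of_nonneg_of_le (fun n => degDecay_nonneg _ _ _) (fun n => ?_) h1
  unfold degDecay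
  have hn : (1 : ℝ) ≤ n + 2 := by
    have : (0 : ℝ) ≤ n := n.cast_nonneg
    linarith
  have hn0 : (0 : ℝ) < n + 2 := by linarith
  push_cast
  rw [show (n : ℝ) + 1 + 1 = n + 2 by ring]
  have h2 : ((n : ℝ) + 1) ^ ((r - 3) / 2) ≤ ((n : ℝ) + 2) ^ ((r - 3) / 2) :=
    Real.rpow_le_rpow (by positivity) (by linarith) (by linarith)
  have h3 : ((n : ℝ) + 2) ^ ((r - 3) / 2) * (n + 2) ^ 3 ≤ (n + 2) ^ t := by
    rw [← Real.rpow_natCast, ← Real.rpow_natCast, ← Real.rpow_add hn0]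
    exact Real.rpow_le_rpow_of_exponent_le hn (by push_cast; linarith)
  rw [mul_div_assoc', div_le_div_iff₀ (by positivity) (by positivity)]
  calc ((n : ℝ) + 1) ^ ((r - 3) / 2) * (n + 2) * (n + 2) ^ 2
      ≤ ((n : ℝ) + 2) ^ ((r - 3) / 2) * (n + 2) * (n + 2) ^ 2 := by gcongr
    _ = ((n : ℝ) + 2) ^ ((r - 3) / 2) * (n + 2) ^ 3 := by ring
    _ ≤ _ := by rw [one_mul]; exact h3

lemma weight_rpow_neg_half {K r : ℝ} {ρ : ℕ → ℝ} (ν : MIdx) :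
    weight K r ρ ν ^ (-(1 / 2) : ℝ) =
      ∏ j ∈ ν.support, ((max 1 (K * ρ j))⁻¹ * ((ν j : ℝ) ^ ((r - 3) / 2))⁻¹) := by
  unfold weight Finsupp.prod
  rw [← Real.finsetProd_rpow _ _ fun j _ => by positivity]
  refine Finset.prod_congr rfl fun j _ => ?_
  have h1 : (0 : ℝ) ≤ max 1 (K * ρ j) := le_max_of_le_left zero_le_one
  rw [Real.mul_rpow (by positivity) (by positivity), ← Real.rpow_natCast, ← Real.rpow_mul h1,
    ← Real.rpow_mul (by positivity), ← Real.rpow_neg_one, ← Real.rpow_neg (by positivity)]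
  norm_num
  left
  congr 1
  ring

end MLSmolyak

/-! ### Summable bounds for the details -/

namespace MLSmolyak

/-- Radii adapted to a multiindex: the base radii, enlarged in the `k` active directions beyond
`J`. -/
noncomputable def adaptedRadius (b : ℕ → ℝ) (ξ c p : ℝ) (J : ℕ) (ν : MIdx) (j : ℕ) : ℝ :=
  c * b j ^ (p - 1) + if j ∈ ν.support.filter (J ≤ ·) then
    ξ / (2 * (ν.support.filter (J ≤ ·)).card * b j) else 0

/-- The base radii spend at most ξ/2, and the k enlargements spend ξ/(2k) each. -/
lemma sum_mul_adaptedRadius_le {b : ℕ → ℝ} (hb : ∀ j, 0 < b j) {ξ c p : ℝ} (hξ : 0 < ξ)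
    (hc : ∀ n, ∑ j ∈ Finset.range n, b j * (c * b j ^ (p - 1)) ≤ ξ / 2) (J : ℕ) (ν : MIdx) (n : ℕ) :
    ∑ j ∈ Finset.range n, b j * adaptedRadius b ξ c p J ν j ≤ ξ := by
  set A := ν.support.filter (J ≤ ·) with hA
  have h1 : ∀ j, b j * adaptedRadius b ξ c p J ν j = b j * (c * b j ^ (p - 1)) +
      if j ∈ A then ξ / (2 * A.card) else 0 := by
    intro j
    rw [adaptedRadius, mul_add]
    congr 1
    split_ifs with hj
    · have := (hb j).ne'
      have : (A.card : ℝ) ≠ 0 := by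
        rw [Nat.cast_ne_zero]
        exact (Finset.card_pos.2 ⟨j, hj⟩).ne'
      rw [← hA]
      field_simp
    · simp
  simp_rw [h1]
  rw [Finset.sum_add_distrib, ← Finset.sum_filter]
  have h2 : ∑ j ∈ (Finset.range n).filter (· ∈ A), ξ / (2 * (A.card : ℝ)) ≤
      ∑ j ∈ A, ξ / (2 * (A.card : ℝ)) :=
    Finset.sum_le_sum_of_subset_of_nonneg (fun j hj => (Finset.mem_filter.1 hj).2)
      fun _ _ _ => by positivity
  have h3 : ∑ j ∈ A, ξ / (2 * (A.card : ℝ)) ≤ ξ / 2 := by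
    rw [Finset.sum_const, nsmul_eq_mul]
    rcases A.card.eq_zero_or_pos with h | h
    · rw [h]; simp; positivity
    · have : (0 : ℝ) < A.card := by exact_mod_cast h
      refine le_of_eq ?_
      field_simp
  linarith [hc n]

/-- The product-form majorants, summed over the number `m` of directions in the tail. -/
noncomputable def detailMajorant (B : ENNReal) (A₀ A₁ : ℝ) (x M : ℕ → ℝ) (J t : ℕ) (r : ℝ)
    (ν : MIdx) : ENNReal :=
  B * ∑' m : ℕ, ENNReal.ofReal (Real.exp (-m)) * ν.prod fun j n =>
    if n = 0 then 1 else
      ENNReal.ofReal ((if j < J then A₀ * M j else Real.exp 1 * m * (A₁ * x j)) * degDecay t r n)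

/-- For fixed m the sum over ν is at most exp(H + m/2): the directions below J give H, and J is so
large that the tail contributes at most m/2. The prefactor exp(-m) leaves a geometric series. -/
lemma tsum_detailMajorant_ne_top {B : ENNReal} (hB : B ≠ ⊤) {A₀ A₁ : ℝ} (hA₀ : 0 ≤ A₀)
    (hA₁ : 0 ≤ A₁) {x M : ℕ → ℝ} (hx : ∀ j, 0 ≤ x j) (hM : ∀ j, 0 ≤ M j) {J t : ℕ} {r : ℝ}
    (hr : 3 ≤ r) (ht : (r - 3) / 2 + 3 ≤ t)
    (hJ : ∀ s : Finset ℕ, (∀ j ∈ s, J ≤ j) →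
      Real.exp 1 * A₁ * (∑ j ∈ s, x j) * ∑' n, degDecay t r (n + 1) ≤ 1 / 2) :
    ∑' ν, detailMajorant B A₀ A₁ x M J t r ν ≠ ⊤ := by
  set γ := ∑' n, degDecay t r (n + 1) with hγ
  have hγ0 : 0 ≤ γ := tsum_nonneg fun n => degDecay_nonneg _ _ _
  unfold detailMajorant
  rw [ENNReal.tsum_mul_left, ENNReal.tsum_comm]
  refine ENNReal.mul_ne_top hB ?_
  simp_rw [ENNReal.tsum_mul_left]
  set H := (∑ j ∈ Finset.range J, A₀ * M j) * γ with hH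
  have key : ∀ m : ℕ, ∑' ν : MIdx, (ν.prod fun j n => if n = 0 then 1 else
      ENNReal.ofReal ((if j < J then A₀ * M j else Real.exp 1 * m * (A₁ * x j)) * degDecay t r n)) ≤
      ENNReal.ofReal (Real.exp (H + m * (1 / 2))) := by
    intro m
    have hnn : ∀ j, 0 ≤ if j < J then A₀ * M j else Real.exp 1 * m * (A₁ * x j) := by
      intro j
      have := hx j
      have := hM j
      split_ifs <;> positivity
    refine tsum_finsupp_prod_le_exp hnn (degDecay_nonneg t r) (summable_degDecay hr ht) fun N => ?_
    rw [Finset.sum_ite, add_mul, ← hγ]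
    refine add_le_add ?_ ?_
    · refine mul_le_mul_of_nonneg_right ?_ hγ0
      refine Finset.sum_le_sum_of_subset_of_nonneg (fun j hj => ?_) fun j _ _ =>
        mul_nonneg hA₀ (hM j)
      exact Finset.mem_range.2 (Finset.mem_filter.1 hj).2
    · have h1 := hJ ((Finset.range N).filter fun j => ¬ j < J) fun j hj =>
        not_lt.1 (Finset.mem_filter.1 hj).2
      rw [← Finset.mul_sum, ← Finset.mul_sum]
      calc _ = m * (Real.exp 1 * A₁ * (∑ j ∈ (Finset.range N).filter fun j => ¬ j < J, x j) * γ) := by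
            ring
        _ ≤ _ := by gcongr
  have h2 : Summable fun m : ℕ => Real.exp H * Real.exp (-(1 / 2)) ^ m :=
    (summable_geometric_of_lt_one (Real.exp_pos _).le (Real.exp_zero ▸ Real.exp_lt_exp.2 (by norm_num))).mul_left _
  refine ne_top_of_le_ne_top h2.tsum_ofReal_ne_top (ENNReal.tsum_le_tsum fun m => ?_)
  refine (mul_le_mul' le_rfl (key m)).trans (le_of_eq ?_)
  rw [← ENNReal.ofReal_mul (Real.exp_pos _).le, ← Real.exp_nat_mul, ← Real.exp_add, ← Real.exp_add]
  congr 2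
  ring

/-- With base radii of order b_j^{p-1} the gain 1/ρ_j would merely cancel the factor max(1, K ϱ_j)
lost to the weight. In the k active directions beyond J the enlarged radius gives instead 2 k b_j/ξ,
and b_j max(1, K ϱ_j) is summable. The price k^k is not of product form; dominating the term with m
= k by the sum over all m restores products. -/
lemma exists_detail_bound {b : ℕ → ℝ} (hb : ∀ j, 0 < b j) {p : ℝ} (hp : 0 < p) (hp1 : p < 1)
    (hs : Summable fun j => b j ^ p) {ξ K r : ℝ} (hξ : 0 < ξ) (hK : 0 < K) (hr : 3 ≤ r)
    (X : Type*) [NormedAddCommGroup X] [InnerProductSpace ℂ X] [CompleteSpace X] :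
    ∃ a : MIdx → ENNReal, ∑' ν, a ν ≠ ⊤ ∧ ∀ (δ : ENNReal) (uN : ∀ N : ℕ, (Fin N → ℝ) → X),
      HolFam b ξ δ uN → ∀ ν, eLpNorm (detail ν (evalFin uN)) 2 gaussU ≤
        δ * a ν * ENNReal.ofReal (weight K r (rho b p ξ) ν ^ (-(1 / 2) : ℝ)) := by
  obtain ⟨t, ht⟩ := exists_nat_ge ((r - 3) / 2 + 3)
  obtain ⟨c, hc, hcξ⟩ := exists_sum_mul_rpow_le hb hs (half_pos hξ)
  obtain ⟨β, hβ, hbβ⟩ := exists_le_of_summable_rpow hb hp hs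
  obtain ⟨κ, hκ, hκ', hκs⟩ := exists_prod_ballMeas_ge hb hp hp1 hs hc
  set ρ₀ := c * β ^ (p - 1) with hρ₀def
  have hρ₀ : 0 < ρ₀ := mul_pos hc (Real.rpow_pos_of_pos hβ _)
  have hρ₀b : ∀ j, ρ₀ ≤ c * b j ^ (p - 1) := fun j =>
    mul_le_mul_of_nonneg_left (Real.rpow_le_rpow_of_nonpos (hb j) (hbβ j) (by linarith)) hc.le
  set A := incrConst t ρ₀ with hA
  have hA0 : 0 < A := incrConst_pos t ρ₀
  set M : ℕ → ℝ := fun j => max 1 (K * rho b p ξ j) with hM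
  have hM1 : ∀ j, 1 ≤ M j := fun j => le_max_left _ _
  set x : ℕ → ℝ := fun j => b j * M j with hx
  have hxs : Summable x := summable_mul_max_rho hb hp hp1 hs hξ hK
  have hx0 : ∀ j, 0 ≤ x j := fun j => mul_nonneg (hb j).le (zero_le_one.trans (hM1 j))
  set A₁ := 2 * A / ξ with hA₁
  have hA₁0 : 0 < A₁ := by positivity
  set γ := ∑' n, degDecay t r (n + 1) with hγ
  have hγ0 : 0 ≤ γ := tsum_nonneg fun n => degDecay_nonneg _ _ _
  have hE : 0 < 2 * (Real.exp 1 * A₁ * γ + 1) := by positivity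
  obtain ⟨s₀, hs₀⟩ := summable_iff_vanishing_norm.1 hxs (1 / (2 * (Real.exp 1 * A₁ * γ + 1)))
    (by positivity)
  set J := s₀.sup id + 1 with hJdef
  have hJ : ∀ s : Finset ℕ, (∀ j ∈ s, J ≤ j) →
      Real.exp 1 * A₁ * (∑ j ∈ s, x j) * γ ≤ 1 / 2 := by
    intro s hs
    have h1 := hs₀ s (by
      rw [Finset.disjoint_left]
      intro j hj hj'
      have := Finset.le_sup (f := id) hj'
      simp only [id] at this
      have := hs j hj
      omega)
    have h2 := (le_abs_self _).trans h1.le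
    rw [le_div_iff₀ hE] at h2
    have h3 : 0 ≤ ∑ j ∈ s, x j := Finset.sum_nonneg fun j _ => hx0 j
    nlinarith
  set B : ENNReal := κ ^ (-(1 / 2) : ℝ) with hB
  have hBtop : B ≠ ⊤ := by
    rw [hB, ENNReal.rpow_neg, ENNReal.inv_ne_top]
    exact (ENNReal.rpow_pos (pos_iff_ne_zero.2 hκ) hκ').ne'
  refine ⟨detailMajorant B (A / ρ₀) A₁ x M J t r,
    tsum_detailMajorant_ne_top hBtop (by positivity) hA₁0.le hx0
      (fun j => zero_le_one.trans (hM1 j)) hr ht hJ, fun δ uN h ν => ?_⟩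
  have hle : ∀ j, c * b j ^ (p - 1) ≤ adaptedRadius b ξ c p J ν j := by
    intro j
    unfold adaptedRadius
    have := hb j
    split_ifs
    · exact le_add_of_nonneg_right (by positivity)
    · simp
  have hBs : ∀ s : Finset ℕ,
      ∏ j ∈ s, ballMeas (adaptedRadius b ξ c p J ν j) ^ (-(1 / 2) : ℝ) ≤ B := by
    intro s
    simp_rw [ENNReal.rpow_neg, hB]
    rw [← ENNReal.prod_inv_distrib, ENNReal.prod_rpow_of_nonneg (by norm_num), ENNReal.rpow_neg,
      ENNReal.inv_le_inv]
    · refine ENNReal.rpow_le_rpow ((hκs s).trans (Finset.prod_le_prod' fun j _ => ?_)) (by norm_num)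
      exact measure_mono (Metric.ball_subset_ball (hle j))
    · intro i _ j _ _
      right
      exact ENNReal.rpow_ne_top_of_nonneg (by norm_num) (ballMeas_ne_top _)
  have hmain := h.eLpNorm_detail_le t hρ₀ (fun j => (hρ₀b j).trans (hle j))
    (sum_mul_adaptedRadius_le hb hξ hcξ J ν) hBs ν
  refine hmain.trans ?_
  set T := ν.support.filter (J ≤ ·) with hT
  set k := T.card with hk
  rw [weight_rpow_neg_half]
  set W : ℕ → ℝ := fun j => (M j)⁻¹ * ((ν j : ℝ) ^ ((r - 3) / 2))⁻¹ with hW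
  have hW0 : ∀ j, 0 ≤ W j := by
    intro j
    have := hM1 j
    have : 0 ≤ M j := zero_le_one.trans (hM1 j)
    simp only [hW]
    positivity
  set Y : ℕ → ℝ := fun j => if j < J then A / ρ₀ * M j else Real.exp 1 * k * (A₁ * x j) with hY
  have hY0 : ∀ j, 0 ≤ Y j := by
    intro j
    have := hx0 j
    have : 0 ≤ M j := zero_le_one.trans (hM1 j)
    simp only [hY]
    split_ifs <;> positivity
  have hWd : ∀ j ∈ ν.support, degDecay t r (ν j) * W j = (ν j + 1) / (ν j + 1) ^ t * (M j)⁻¹ := by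
    intro j hj
    have h1 : (0 : ℝ) < ν j := by
      exact_mod_cast Nat.pos_of_ne_zero (Finsupp.mem_support_iff.1 hj)
    have h2 := (Real.rpow_pos_of_pos h1 ((r - 3) / 2)).ne'
    simp only [hW, degDecay]
    field_simp
  have hpt : ∀ j ∈ ν.support, A / adaptedRadius b ξ c p J ν j / (ν j + 1) ^ t * (ν j + 1) ≤
      (if J ≤ j then Real.exp (-1) else 1) * (Y j * degDecay t r (ν j) * W j) := by
    intro j hj
    have hMj : 0 < M j := zero_lt_one.trans_le (hM1 j)
    have hbj := hb j
    rw [mul_assoc, hWd j hj]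
    have h0 : (0 : ℝ) ≤ (ν j + 1) / (ν j + 1) ^ t := by positivity
    have hgoal : ∀ D : ℝ, A / adaptedRadius b ξ c p J ν j ≤ D * (M j)⁻¹ →
        A / adaptedRadius b ξ c p J ν j / (ν j + 1) ^ t * (ν j + 1) ≤
          D * ((ν j + 1) / (ν j + 1) ^ t * (M j)⁻¹) := by
      intro D hD
      calc _ = A / adaptedRadius b ξ c p J ν j * ((ν j + 1) / (ν j + 1) ^ t) := by ring
        _ ≤ D * (M j)⁻¹ * ((ν j + 1) / (ν j + 1) ^ t) := by gcongr
        _ = _ := by ring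
    by_cases hjJ : J ≤ j
    · rw [if_pos hjJ, ← mul_assoc]
      refine hgoal _ ?_
      have hjT : j ∈ T := Finset.mem_filter.2 ⟨hj, hjJ⟩
      have hk0 : (0 : ℝ) < k := by exact_mod_cast Finset.card_pos.2 ⟨j, hjT⟩
      have h1 : ξ / (2 * k * b j) ≤ adaptedRadius b ξ c p J ν j := by
        rw [adaptedRadius, if_pos hjT]
        exact le_add_of_nonneg_left (mul_nonneg hc.le (Real.rpow_nonneg hbj.le _))
      simp only [hY, if_neg (not_lt.2 hjJ), hx, hA₁]
      calc A / adaptedRadius b ξ c p J ν j ≤ A / (ξ / (2 * k * b j)) := by gcongr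
        -- The inserted factors e⁻¹, one for each of the k tail directions, multiply to the exp(-k)
        -- of the majorant.
        _ = (Real.exp (-1) * Real.exp 1) * (k * (2 * A / ξ * (b j * M j))) * (M j)⁻¹ := by
            rw [← Real.exp_add, neg_add_cancel, Real.exp_zero]
            field_simp
        _ = _ := by ring
    · rw [if_neg hjJ, one_mul]
      refine hgoal _ ?_
      simp only [hY, if_pos (not_le.1 hjJ)]
      rw [mul_inv_cancel_right₀ hMj.ne']
      have h1 := (hρ₀b j).trans (hle j)
      gcongr
  have hprod : ∏ j ∈ ν.support,
      ENNReal.ofReal (A / adaptedRadius b ξ c p J ν j / (ν j + 1) ^ t * (ν j + 1)) ≤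
      ENNReal.ofReal (Real.exp (-k)) * (∏ j ∈ ν.support, ENNReal.ofReal (Y j * degDecay t r (ν j))) *
        ENNReal.ofReal (∏ j ∈ ν.support, W j) := by
    have h1 : Real.exp (-k) = ∏ j ∈ ν.support, if J ≤ j then Real.exp (-1) else 1 := by
      rw [← Finset.prod_filter, Finset.prod_const, ← Real.exp_nat_mul]
      congr 1
      ring
    have he : ∀ j, (0 : ℝ) ≤ if J ≤ j then Real.exp (-1) else 1 := by
      intro j
      split_ifs <;> positivity
    rw [h1, ENNReal.ofReal_prod_of_nonneg fun j _ => he j,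
      ENNReal.ofReal_prod_of_nonneg fun j _ => hW0 j, ← Finset.prod_mul_distrib,
      ← Finset.prod_mul_distrib]
    refine Finset.prod_le_prod' fun j hj => ?_
    rw [← ENNReal.ofReal_mul (he j), ← ENNReal.ofReal_mul (mul_nonneg (he j)
      (mul_nonneg (hY0 j) (degDecay_nonneg _ _ _)))]
    refine ENNReal.ofReal_le_ofReal ((hpt j hj).trans (le_of_eq ?_))
    ring
  have hmaj : B * (ENNReal.ofReal (Real.exp (-k)) *
      ∏ j ∈ ν.support, ENNReal.ofReal (Y j * degDecay t r (ν j))) ≤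
      detailMajorant B (A / ρ₀) A₁ x M J t r ν := by
    unfold detailMajorant
    gcongr
    refine le_trans (le_of_eq ?_) (ENNReal.le_tsum k)
    congr 1
    unfold Finsupp.prod
    refine Finset.prod_congr rfl fun j hj => ?_
    exact (if_neg (Finsupp.mem_support_iff.1 hj)).symm
  calc _ ≤ B * δ * (ENNReal.ofReal (Real.exp (-k)) *
        (∏ j ∈ ν.support, ENNReal.ofReal (Y j * degDecay t r (ν j))) *
        ENNReal.ofReal (∏ j ∈ ν.support, W j)) := by gcongr
    _ = δ * (B * (ENNReal.ofReal (Real.exp (-k)) *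
        ∏ j ∈ ν.support, ENNReal.ofReal (Y j * degDecay t r (ν j)))) *
        ENNReal.ofReal (∏ j ∈ ν.support, W j) := by ring
    _ ≤ _ := by gcongr

end MLSmolyak

/-! ### Regrouping by multiindices, the level choice, and weighted point counts -/

namespace MLSmolyak

section
variable {X : Type*} [NormedAddCommGroup X] [InnerProductSpace ℂ X]

lemma detail_sub (ν : MIdx) (v v' : (ℕ →₀ ℝ) → X) (y : ℕ → ℝ) :
    detail ν (fun x => v x - v' x) y = detail ν v y - detail ν v' y := by
  simp only [detail, tensorInterp, smul_sub, Finset.sum_sub_distrib]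

variable {l : MIdx → ℕ} {Λ : Finset MIdx}

lemma le_maxLevel (hl : ∀ ν ∉ Λ, l ν = 0) (ν : MIdx) : l ν ≤ maxLevel l := by
  refine le_csSup ⟨Λ.sup l, ?_⟩ ⟨ν, rfl⟩
  rintro _ ⟨μ, rfl⟩
  by_cases hμ : μ ∈ Λ
  · exact Finset.le_sup hμ
  · rw [hl μ hμ]
    exact Nat.zero_le _

lemma levelSet_eq (hl : ∀ ν ∉ Λ, l ν = 0) {j : ℕ} (hj : 1 ≤ j) :
    levelSet l j = ((Λ.filter fun ν => j ≤ l ν : Finset MIdx) : Set MIdx) := by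
  ext ν
  simp only [levelSet, Set.mem_ofPred_eq, Finset.coe_filter]
  refine ⟨fun h => ⟨?_, h⟩, fun h => h.2⟩
  by_contra hν
  have := hl ν hν
  omega

lemma mlInterp_eq_sum (hl : ∀ ν ∉ Λ, l ν = 0) (ul : ℕ → ∀ N : ℕ, (Fin N → ℝ) → X) (y : ℕ → ℝ) :
    mlInterp l ul y =
      ∑ ν ∈ Λ, if 1 ≤ l ν then detail ν (evalFin (ul (l ν))) y else 0 := by
  have h1 : ∀ j ∈ Finset.Icc 1 (maxLevel l),
      smolyak (levelSet l j) (evalFin (ul j)) y - smolyak (levelSet l (j + 1)) (evalFin (ul j)) y =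
      ∑ ν ∈ Λ, if j = l ν then detail ν (evalFin (ul (l ν))) y else 0 := by
    intro j hj
    have hj1 := (Finset.mem_Icc.1 hj).1
    rw [smolyak, smolyak, levelSet_eq hl hj1, levelSet_eq hl (Nat.le_succ_of_le hj1),
      finsum_mem_coe_finset, finsum_mem_coe_finset, Finset.sum_filter, Finset.sum_filter,
      ← Finset.sum_sub_distrib]
    refine Finset.sum_congr rfl fun ν _ => ?_
    rcases lt_trichotomy j (l ν) with h | h | h
    · rw [if_pos h.le, if_pos (Nat.succ_le_of_lt h), if_neg h.ne, sub_self]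
    · rw [if_pos h.le, if_neg (by omega), if_pos h, sub_zero, h]
    · rw [if_neg (by omega), if_neg (by omega), if_neg h.ne', sub_zero]
  rw [mlInterp, Finset.sum_congr rfl h1, Finset.sum_comm]
  refine Finset.sum_congr rfl fun ν _ => ?_
  rw [Finset.sum_ite_eq']
  have := le_maxLevel hl ν
  simp [this]

/-- The differences over nested level sets leave each multiindex exactly at its own level. A
multiindex in Λ of level 0 is interpolated not at all, so its error is the detail of u itself. -/
lemma sub_mlInterp_eq (hl : ∀ ν ∉ Λ, l ν = 0) (u : X) (uN : ∀ N : ℕ, (Fin N → ℝ) → X)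
    (ul : ℕ → ∀ N : ℕ, (Fin N → ℝ) → X) (y : ℕ → ℝ) :
    u - mlInterp l ul y = (u - ∑ ν ∈ Λ, detail ν (evalFin uN) y) +
      ∑ ν ∈ Λ, detail ν (evalFin fun N y => uN N y - if 1 ≤ l ν then ul (l ν) N y else 0) y := by
  rw [mlInterp_eq_sum hl, sub_add, ← Finset.sum_sub_distrib]
  congr 1
  refine Finset.sum_congr rfl fun ν _ => ?_
  split_ifs
  · have h := detail_sub ν (evalFin uN) (evalFin (ul (l ν))) y
    change _ = _ - detail ν (fun x => evalFin uN x - evalFin (ul (l ν)) x) y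
    rw [h]
    abel
  · simp

end

variable {l : MIdx → ℕ} {Λ : Finset MIdx}

lemma work_eq_sum (w : ℕ → ℕ) (hl : ∀ ν ∉ Λ, l ν = 0) :
    work w l = ∑ ν ∈ Λ, (ν.prod fun _ m => 1 + m) * ∑ j ∈ Finset.Icc 1 (l ν), w j := by
  have h1 : ∀ j ∈ Finset.Icc 1 (maxLevel l),
      w j * ∑ᶠ (ν : MIdx) (_ : ν ∈ levelSet l j), (ν.prod fun _ m => 1 + m) =
      ∑ ν ∈ Λ, if j ≤ l ν then (ν.prod fun _ m => 1 + m) * w j else 0 := by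
    intro j hj
    rw [levelSet_eq hl (Finset.mem_Icc.1 hj).1, finsum_mem_coe_finset, Finset.sum_filter,
      Finset.mul_sum]
    refine Finset.sum_congr rfl fun ν _ => ?_
    split_ifs
    · exact mul_comm _ _
    · rfl
  rw [work, Finset.sum_congr rfl h1, Finset.sum_comm]
  refine Finset.sum_congr rfl fun ν _ => ?_
  rw [← Finset.sum_filter, Finset.mul_sum]
  refine Finset.sum_congr ?_ fun _ _ => rfl
  ext j
  have := le_maxLevel hl ν
  simp only [Finset.mem_filter, Finset.mem_Icc]
  omega

/-- The level chosen for the threshold `T`. -/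
lemma level_spec {w : ℕ → ℕ} (hw : StrictMono w) (hw0 : w 0 = 0) {T : ℝ} (hT : 0 ≤ T) :
    (w (sSup {j : ℕ | (w j : ℝ) ≤ T}) : ℝ) ≤ T ∧ T < w (sSup {j : ℕ | (w j : ℝ) ≤ T} + 1) := by
  set S := {j : ℕ | (w j : ℝ) ≤ T} with hS
  have hbdd : BddAbove S := by
    refine ⟨⌊T⌋₊, fun j hj => Nat.le_floor ?_⟩
    refine le_trans ?_ hj
    exact_mod_cast hw.le_apply
  have hne : S.Nonempty := ⟨0, by simpa [hS, hw0] using hT⟩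
  refine ⟨Nat.sSup_mem hne hbdd, ?_⟩
  by_contra! hcon
  have := le_csSup hbdd (show sSup S + 1 ∈ S from hcon)
  omega

lemma constructLevels_of_mem {w : ℕ → ℕ} {c d : MIdx → ℝ} {q α ε : ℝ} {ν : MIdx}
    (hΛ : activeSet c ε = Λ) (hν : ν ∈ Λ) :
    constructLevels w c d q α ε ν = sSup {j : ℕ | (w j : ℝ) ≤
      ε ^ (-((1 / 2 - q / 4) / α)) * d ν ^ (-1 / (1 + 2 * α)) *
        (∑ μ ∈ Λ, d μ ^ (-1 / (1 + 2 * α))) ^ (1 / (2 * α))} := by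
  rw [constructLevels, if_pos (by rw [hΛ]; exact hν), hΛ, finsum_mem_coe_finset]

lemma constructLevels_of_notMem {w : ℕ → ℕ} {c d : MIdx → ℝ} {q α ε : ℝ} {ν : MIdx}
    (hΛ : activeSet c ε = Λ) (hν : ν ∉ Λ) : constructLevels w c d q α ε ν = 0 := by
  rw [constructLevels, if_neg (by rw [hΛ]; exact hν)]

/-- The dependence of the number of points, times a power of the weights, on a degree. -/
noncomputable def degSum (s : ℝ) (n : ℕ) : ℝ := (1 + n) * (n : ℝ) ^ (-s)

lemma summable_degSum {s : ℝ} (hs : 2 < s) : Summable fun n => degSum s (n + 1) := by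
  have h1 : Summable fun n : ℕ => 2 * ((n + 1 : ℕ) : ℝ) ^ (1 - s) :=
    ((summable_nat_add_iff 1).2 (Real.summable_nat_rpow.2 (by linarith))).mul_left 2
  refine Summable.of_nonneg_of_le (fun n => by unfold degSum; positivity) (fun n => ?_) h1
  have hn : (0 : ℝ) < ((n + 1 : ℕ) : ℝ) := by positivity
  have hn1 : (1 : ℝ) ≤ ((n + 1 : ℕ) : ℝ) := by push_cast; linarith [n.cast_nonneg (α := ℝ)]
  rw [degSum, sub_eq_add_neg, Real.rpow_add hn, Real.rpow_one, ← mul_assoc]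
  gcongr
  linarith

lemma weight_rpow {K r a : ℝ} {ρ : ℕ → ℝ} (ν : MIdx) : weight K r ρ ν ^ (-a) =
    ∏ j ∈ ν.support, (max 1 (K * ρ j) ^ (-(2 * a)) * (ν j : ℝ) ^ (-((r - 3) * a))) := by
  unfold weight Finsupp.prod
  rw [← Real.finsetProd_rpow _ _ fun j _ => by positivity]
  refine Finset.prod_congr rfl fun j _ => ?_
  have h1 : (0 : ℝ) ≤ max 1 (K * ρ j) := le_max_of_le_left zero_le_one
  rw [Real.mul_rpow (by positivity) (by positivity), ← Real.rpow_natCast, ← Real.rpow_mul h1,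
    ← Real.rpow_mul (by positivity)]
  norm_num

lemma weight_ge_prod {K r : ℝ} {ρ : ℕ → ℝ} (hr : 3 ≤ r) (ν : MIdx) :
    ∏ j ∈ ν.support, max 1 (K * ρ j) ^ 2 ≤ weight K r ρ ν := by
  unfold weight Finsupp.prod
  refine Finset.prod_le_prod (fun j _ => by positivity) fun j hj => ?_
  have h1 : (1 : ℝ) ≤ ν j := by
    exact_mod_cast Nat.one_le_iff_ne_zero.2 (Finsupp.mem_support_iff.1 hj)
  exact le_mul_of_one_le_right (by positivity) (Real.one_le_rpow h1 (by linarith))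

lemma one_le_weight {K r : ℝ} {ρ : ℕ → ℝ} (hr : 3 ≤ r) (ν : MIdx) : 1 ≤ weight K r ρ ν := by
  refine le_trans ?_ (weight_ge_prod hr ν)
  calc (1 : ℝ) = ∏ j ∈ ν.support, 1 := by simp
    _ ≤ _ := Finset.prod_le_prod (fun _ _ => zero_le_one) fun j _ =>
      one_le_pow₀ (le_max_left _ _)

lemma weight_zero {K r : ℝ} {ρ : ℕ → ℝ} : weight K r ρ 0 = 1 := by simp [weight]

/-- All factors are products over the support, so the sum is an exponential of a sum over directions
times a sum over degrees. The latter behaves like the sum of n^{1-s} with s = (r - 3)(a + t), hence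
the condition s > 2. -/
lemma summable_points_mul_weights {K r a t : ℝ} {ρ₁ ρ₂ : ℕ → ℝ}
    (hs : Summable fun j => max 1 (K * ρ₂ j) ^ (-(2 * a)) * max 1 (K * ρ₁ j) ^ (-(2 * t)))
    (hr : 2 < (r - 3) * (a + t)) :
    Summable fun ν : MIdx => ((ν.prod fun _ m => 1 + m : ℕ) : ℝ) *
      (weight K r ρ₂ ν ^ (-a) * weight K r ρ₁ ν ^ (-t)) := by
  set y : ℕ → ℝ := fun j => max 1 (K * ρ₂ j) ^ (-(2 * a)) * max 1 (K * ρ₁ j) ^ (-(2 * t)) with hy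
  have hM : ∀ (ρ : ℕ → ℝ) (j : ℕ), (0 : ℝ) ≤ max 1 (K * ρ j) := fun ρ j =>
    le_max_of_le_left zero_le_one
  have hy0 : ∀ j, 0 ≤ y j := fun j => mul_nonneg (Real.rpow_nonneg (hM _ _) _)
    (Real.rpow_nonneg (hM _ _) _)
  have hg0 : ∀ n, 0 ≤ degSum ((r - 3) * (a + t)) n := fun n => by unfold degSum; positivity
  have h1 := tsum_finsupp_prod_le_exp (y := y) (g := degSum ((r - 3) * (a + t))) hy0 hg0
    (summable_degSum hr) (H := (∑' j, y j) * ∑' n, degSum ((r - 3) * (a + t)) (n + 1)) fun N =>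
      mul_le_mul_of_nonneg_right (hs.sum_le_tsum _ fun j _ => hy0 j) (tsum_nonneg fun n => hg0 _)
  have h2 := ENNReal.summable_toReal (ne_top_of_le_ne_top ENNReal.ofReal_ne_top h1)
  refine h2.congr fun ν => ?_
  rw [weight_rpow, weight_rpow, Finsupp.prod, Finsupp.prod, ENNReal.toReal_prod, Nat.cast_prod,
    ← Finset.prod_mul_distrib, ← Finset.prod_mul_distrib]
  refine Finset.prod_congr rfl fun j hj => ?_
  have hj0 := Finsupp.mem_support_iff.1 hj
  have h3 : (0 : ℝ) < ν j := by exact_mod_cast Nat.pos_of_ne_zero hj0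
  rw [if_neg hj0, ENNReal.toReal_ofReal (mul_nonneg (hy0 j) (hg0 _)), degSum,
    show -((r - 3) * (a + t)) = -((r - 3) * a) + -((r - 3) * t) by ring, Real.rpow_add h3]
  push_cast
  ring

/-- Weighted arithmetic-geometric mean inequality, with weights proportional to A/p₂ and B/p₁. -/
lemma summable_rpow_mul_rpow {b₁ b₂ : ℕ → ℝ} (hb₁ : ∀ j, 0 < b₁ j) (hb₂ : ∀ j, 0 < b₂ j)
    {p₁ p₂ : ℝ} (hp₁ : 0 < p₁) (hp₂ : 0 < p₂) (hs₁ : Summable fun j => b₁ j ^ p₁)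
    (hs₂ : Summable fun j => b₂ j ^ p₂) {A B : ℝ} (hA : 0 ≤ A) (hB : 0 ≤ B)
    (hAB : 1 ≤ A / p₂ + B / p₁) : Summable fun j => b₂ j ^ A * b₁ j ^ B := by
  set σ := A / p₂ + B / p₁ with hσ
  have hσ0 : 0 < σ := by linarith
  have h1 := summable_rpow_of_le hb₁ hp₁ hs₁ (q := p₁ * σ) (le_mul_of_one_le_right hp₁.le hAB)
  have h2 := summable_rpow_of_le hb₂ hp₂ hs₂ (q := p₂ * σ) (le_mul_of_one_le_right hp₂.le hAB)
  refine Summable.of_nonneg_of_le (fun j => mul_nonneg (Real.rpow_nonneg (hb₂ j).le _)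
    (Real.rpow_nonneg (hb₁ j).le _)) (fun j => ?_)
    ((h2.mul_left (A / p₂ / σ)).add (h1.mul_left (B / p₁ / σ)))
  have h3 := Real.geom_mean_le_arith_mean2_weighted (w₁ := A / p₂ / σ) (w₂ := B / p₁ / σ)
    (p₁ := b₂ j ^ (p₂ * σ)) (p₂ := b₁ j ^ (p₁ * σ)) (by positivity) (by positivity)
    (Real.rpow_nonneg (hb₂ j).le _) (Real.rpow_nonneg (hb₁ j).le _) (by
      rw [← add_div, ← hσ, div_self hσ0.ne'])
  rw [← Real.rpow_mul (hb₂ j).le, ← Real.rpow_mul (hb₁ j).le] at h3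
  have e1 : p₂ * σ * (A / p₂ / σ) = A := by field_simp
  have e2 : p₁ * σ * (B / p₁ / σ) = B := by field_simp
  rwa [e1, e2] at h3

lemma max_rho_rpow_le {b : ℕ → ℝ} (hb : ∀ j, 0 < b j) {p : ℝ}
    (hs : Summable fun j => b j ^ p) {ξ K : ℝ} (hξ : 0 < ξ) (hK : 0 < K) {a : ℝ} (ha : 0 ≤ a) :
    ∃ C : ℝ, 0 ≤ C ∧ ∀ j, max 1 (K * rho b p ξ j) ^ (-(2 * a)) ≤ C * b j ^ (2 * a * (1 - p)) := by
  obtain ⟨c, hc⟩ := rho_eq b p ξ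
  have hρ := rho_pos hb hs hξ
  have hc0 : 0 < c := by
    have := hρ 0
    rw [hc] at this
    exact pos_of_mul_pos_left this (Real.rpow_nonneg (hb 0).le _)
  refine ⟨(K * c) ^ (-(2 * a)), by positivity, fun j => ?_⟩
  have h1 := mul_pos hK (hρ j)
  calc max 1 (K * rho b p ξ j) ^ (-(2 * a)) ≤ (K * rho b p ξ j) ^ (-(2 * a)) :=
        Real.rpow_le_rpow_of_nonpos h1 (le_max_right _ _) (by linarith)
    _ = _ := by
        rw [hc, ← mul_assoc, Real.mul_rpow (by positivity) (Real.rpow_nonneg (hb j).le _),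
          ← Real.rpow_mul (hb j).le]
        congr 2
        ring

end MLSmolyak

/-! ### Finiteness of the active sets, work, and the error per multiindex -/

namespace MLSmolyak

lemma exists_le_mul_rho {b : ℕ → ℝ} (hb : ∀ j, 0 < b j) {p : ℝ} (hp : 0 < p) (hp1 : p < 1)
    (hs : Summable fun j => b j ^ p) {ξ : ℝ} (hξ : 0 < ξ) :
    ∃ K : ℝ, 0 < K ∧ ∀ K', K ≤ K' → ∀ j, 2 ≤ K' * rho b p ξ j := by
  obtain ⟨β, hβ, hbβ⟩ := exists_le_of_summable_rpow hb hp hs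
  obtain ⟨c, hc⟩ := rho_eq b p ξ
  have hρ := rho_pos hb hs hξ
  have hc0 : 0 < c := by
    have := hρ 0
    rw [hc] at this
    exact pos_of_mul_pos_left this (Real.rpow_nonneg (hb 0).le _)
  have hlow : 0 < c * β ^ (p - 1) := mul_pos hc0 (Real.rpow_pos_of_pos hβ _)
  refine ⟨2 / (c * β ^ (p - 1)), by positivity, fun K' hK' j => ?_⟩
  rw [div_le_iff₀ hlow] at hK'
  refine hK'.trans ?_
  have hK'0 : 0 ≤ K' := by
    by_contra! hneg
    nlinarith
  rw [hc]
  exact mul_le_mul_of_nonneg_left (mul_le_mul_of_nonneg_left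
    (Real.rpow_le_rpow_of_nonpos (hb j) (hbβ j) (by linarith)) hc0.le) hK'0

lemma one_le_points (ν : MIdx) : (1 : ℝ) ≤ ((ν.prod fun _ m => 1 + m : ℕ) : ℝ) := by
  have : 0 < ν.prod fun _ m => 1 + m := Finset.prod_pos fun j _ => Nat.add_pos_left one_pos _
  exact_mod_cast this

lemma activeSet_finite {b : ℕ → ℝ} (hb : ∀ j, 0 < b j) {p : ℝ} (hp : 0 < p) (hp1 : p < 1)
    (hs : Summable fun j => b j ^ p) {ξ K r : ℝ} (hξ : 0 < ξ) (hK : 0 < K) (hr : 3 < r) {ε : ℝ}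
    (hε : 0 < ε) : (activeSet (weight K r (rho b p ξ)) ε).Finite := by
  have hr3 : 0 < r - 3 := by linarith
  have hp2 : 0 < 1 - p := by linarith
  -- The first summand makes the sum over directions converge, the second the sum over degrees. Any
  -- such power of the weights tends to zero, so only finitely many weights are at most 1/ε.
  set t : ℝ := p / (2 * (1 - p)) + 3 / (r - 3) with ht
  have ht0 : 0 < t := by positivity
  have ht1 : p ≤ 2 * t * (1 - p) := by
    have h1 : p = 2 * (p / (2 * (1 - p))) * (1 - p) := by field_simp
    have h2 : p / (2 * (1 - p)) ≤ t := le_add_of_nonneg_right (by positivity)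
    calc p = 2 * (p / (2 * (1 - p))) * (1 - p) := h1
      _ ≤ _ := by gcongr
  have ht2 : 2 < (r - 3) * (0 + t) := by
    have h2 : 3 / (r - 3) ≤ t := le_add_of_nonneg_left (by positivity)
    have h3 : (r - 3) * (3 / (r - 3)) = 3 := by field_simp
    have := mul_le_mul_of_nonneg_left h2 hr3.le
    rw [zero_add]
    linarith
  obtain ⟨C, hC0, hC⟩ := max_rho_rpow_le hb hs hξ hK ht0.le
  have hsum := summable_points_mul_weights (K := K) (r := r) (a := 0) (t := t)
    (ρ₁ := rho b p ξ) (ρ₂ := rho b p ξ) (by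
      refine Summable.of_nonneg_of_le (fun j => ?_) (fun j => ?_)
        ((summable_rpow_of_le hb hp hs ht1).mul_left C)
      · have : (0 : ℝ) ≤ max 1 (K * rho b p ξ j) := le_max_of_le_left zero_le_one
        positivity
      · simpa using hC j) ht2
  have h1 := hsum.tendsto_cofinite_zero.eventually_lt_const (Real.rpow_pos_of_pos hε t)
  rw [eventually_cofinite] at h1
  refine h1.subset fun ν hν => ?_
  rw [Set.mem_ofPred_eq, not_lt]
  have hc := one_le_weight (K := K) (ρ := rho b p ξ) hr.le ν
  have hν' : ε ≤ (weight K r (rho b p ξ) ν)⁻¹ := hν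
  have h2 : ε ^ t ≤ weight K r (rho b p ξ) ν ^ (-t) := by
    rw [Real.rpow_neg (by linarith), ← Real.inv_rpow (by linarith)]
    exact Real.rpow_le_rpow hε.le hν' ht0.le
  rw [neg_zero, Real.rpow_zero, one_mul]
  exact h2.trans (le_mul_of_one_le_left (by positivity) (one_le_points ν))

/-- Rankin's trick: on the active set ε c_ν ≤ 1, so each term may be multiplied by (ε c_ν)^{-t} ≥ 1
before the sum is extended to all ν. -/
lemma sum_activeSet_le {c d : MIdx → ℝ} {Λ : Finset MIdx} {ε a t : ℝ} (hε : 0 < ε) (ht : 0 ≤ t)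
    (hc : ∀ ν, 1 ≤ c ν) (hd : ∀ ν, 1 ≤ d ν) (hΛ : activeSet c ε = Λ)
    (hs : Summable fun ν : MIdx => ((ν.prod fun _ m => 1 + m : ℕ) : ℝ) * (d ν ^ (-a) * c ν ^ (-t))) :
    ∑ ν ∈ Λ, ((ν.prod fun _ m => 1 + m : ℕ) : ℝ) * d ν ^ (-a) ≤
      ε ^ (-t) * ∑' ν : MIdx, ((ν.prod fun _ m => 1 + m : ℕ) : ℝ) * (d ν ^ (-a) * c ν ^ (-t)) := by
  have hnn : ∀ ν : MIdx, 0 ≤ ((ν.prod fun _ m => 1 + m : ℕ) : ℝ) * (d ν ^ (-a) * c ν ^ (-t)) := by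
    intro ν
    have := hc ν
    have := hd ν
    positivity
  refine le_trans ?_ (mul_le_mul_of_nonneg_left (hs.sum_le_tsum Λ fun ν _ => hnn ν)
    (Real.rpow_nonneg hε.le _))
  rw [Finset.mul_sum]
  refine Finset.sum_le_sum fun ν hν => ?_
  have hν' : ν ∈ activeSet c ε := by rw [hΛ]; exact hν
  have h0 : ε ≤ (c ν)⁻¹ := hν'
  have hcν : 0 < c ν := zero_lt_one.trans_le (hc ν)
  have hdν : 0 < d ν := zero_lt_one.trans_le (hd ν)
  have h1 : ε * c ν ≤ 1 := by
    calc ε * c ν ≤ (c ν)⁻¹ * c ν := by gcongr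
      _ = 1 := inv_mul_cancel₀ hcν.ne'
  have h2 : 1 ≤ ε ^ (-t) * c ν ^ (-t) := by
    rw [← Real.mul_rpow hε.le hcν.le]
    exact Real.one_le_rpow_of_pos_of_le_one_of_nonpos (by positivity) h1 (by linarith)
  calc _ ≤ ((ν.prod fun _ m => 1 + m : ℕ) : ℝ) * d ν ^ (-a) * (ε ^ (-t) * c ν ^ (-t)) :=
        le_mul_of_one_le_right (by positivity) h2
    _ = _ := by ring

/-- The cost of all levels up to l_ν is comparable to that of l_ν alone, which is at most the
threshold. The sum in the threshold carries no point counts, but it is at most P as well, whence the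
exponent 1 + 1/(2α). -/
lemma work_constructLevels_le {w : ℕ → ℕ} (hw : StrictMono w) (hw0 : w 0 = 0) {KW : ℝ}
    (hKW0 : 0 ≤ KW) (hKW : ∀ l : ℕ, 1 ≤ l → ∑ j ∈ Finset.range (l + 1), (w j : ℝ) ≤ KW * w l)
    {c d : MIdx → ℝ} {q α ε P : ℝ} (hα : 0 < α) (hε : 0 < ε) (hd : ∀ ν, 1 ≤ d ν)
    {Λ : Finset MIdx} (hΛ : activeSet c ε = Λ)
    (hP : ∑ ν ∈ Λ, ((ν.prod fun _ m => 1 + m : ℕ) : ℝ) * d ν ^ (-1 / (1 + 2 * α)) ≤ P) :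
    (work w (constructLevels w c d q α ε) : ℝ) ≤
      KW * (ε ^ (-((1 / 2 - q / 4) / α)) * P ^ (1 + 1 / (2 * α))) := by
  have hd0 : ∀ ν, 0 ≤ d ν ^ (-1 / (1 + 2 * α)) := fun ν =>
    Real.rpow_nonneg (zero_le_one.trans (hd ν)) _
  set D := ∑ μ ∈ Λ, d μ ^ (-1 / (1 + 2 * α)) with hD
  have hD0 : 0 ≤ D := Finset.sum_nonneg fun ν _ => hd0 ν
  have hDP : D ≤ P := by
    refine le_trans (Finset.sum_le_sum fun ν _ => ?_) hP
    exact le_mul_of_one_le_left (hd0 ν) (one_le_points ν)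
  have hP0 : 0 ≤ P := hD0.trans hDP
  set E := ε ^ (-((1 / 2 - q / 4) / α)) with hE
  have hE0 : 0 < E := Real.rpow_pos_of_pos hε _
  have hl : ∀ ν ∉ Λ, constructLevels w c d q α ε ν = 0 := fun ν hν => constructLevels_of_notMem hΛ hν
  rw [work_eq_sum w hl]
  push_cast
  have hterm : ∀ ν ∈ Λ, ((ν.prod fun _ m => 1 + m : ℕ) : ℝ) *
      ∑ j ∈ Finset.Icc 1 (constructLevels w c d q α ε ν), (w j : ℝ) ≤
      KW * E * D ^ (1 / (2 * α)) *
        (((ν.prod fun _ m => 1 + m : ℕ) : ℝ) * d ν ^ (-1 / (1 + 2 * α))) := by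
    intro ν hν
    set l := constructLevels w c d q α ε ν with hlν
    have hT0 : 0 ≤ E * d ν ^ (-1 / (1 + 2 * α)) * D ^ (1 / (2 * α)) :=
      mul_nonneg (mul_nonneg hE0.le (hd0 ν)) (Real.rpow_nonneg hD0 _)
    have hwl : (w l : ℝ) ≤ E * d ν ^ (-1 / (1 + 2 * α)) * D ^ (1 / (2 * α)) := by
      rw [hlν, constructLevels_of_mem hΛ hν]
      exact (level_spec hw hw0 hT0).1
    have hsum : ∑ j ∈ Finset.Icc 1 l, (w j : ℝ) ≤ KW * w l := by
      rcases Nat.eq_zero_or_pos l with h | h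
      · rw [h]
        simp
        positivity
      · refine le_trans ?_ (hKW l h)
        refine Finset.sum_le_sum_of_subset_of_nonneg (fun j hj => ?_) fun _ _ _ => Nat.cast_nonneg _
        rw [Finset.mem_range]
        have := (Finset.mem_Icc.1 hj).2
        omega
    calc _ ≤ ((ν.prod fun _ m => 1 + m : ℕ) : ℝ) *
          (KW * (E * d ν ^ (-1 / (1 + 2 * α)) * D ^ (1 / (2 * α)))) := by
            gcongr
            exact hsum.trans (by gcongr)
      _ = _ := by ring
  calc _ ≤ ∑ ν ∈ Λ, KW * E * D ^ (1 / (2 * α)) *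
        (((ν.prod fun _ m => 1 + m : ℕ) : ℝ) * d ν ^ (-1 / (1 + 2 * α))) := by
          refine le_trans (le_of_eq ?_) (Finset.sum_le_sum hterm)
          push_cast
          rfl
    _ ≤ KW * E * P ^ (1 / (2 * α)) * P := by
        rw [← Finset.mul_sum]
        have := Real.rpow_nonneg hP0 (1 / (2 * α))
        refine mul_le_mul ?_ hP (Finset.sum_nonneg fun ν _ =>
          mul_nonneg (Nat.cast_nonneg _) (hd0 ν)) (by positivity)
        gcongr
    _ = _ := by
        rw [Real.rpow_add_of_nonneg hP0 zero_le_one (by positivity), Real.rpow_one]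
        ring

/-- The threshold T is below w (l + 1), which is comparable to 1 + w l, so the level error is
O(T^{-α}). In T^{-α} d^{-1/2} the total exponent of d is nonpositive and D enters with exponent
-1/2; since d, D ≥ 1, only ε^κ remains. -/
lemma level_decay {w : ℕ → ℕ} (hw : StrictMono w) (hw0 : w 0 = 0) {KW : ℝ} (hKW1 : 1 ≤ KW) {l : ℕ}
    (hKW : (w (l + 1) : ℝ) ≤ KW * (1 + w l)) {α κ ε d D : ℝ} (hα : 0 < α) (hε : 0 < ε)
    (hd : 1 ≤ d) (hD : 1 ≤ D)
    (hT : ε ^ (-(κ / α)) * d ^ (-1 / (1 + 2 * α)) * D ^ (1 / (2 * α)) < w (l + 1)) :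
    (if 1 ≤ l then (w l : ℝ) ^ (-α) else 1) * d ^ (-(1 / 2) : ℝ) ≤ (2 * KW) ^ α * ε ^ κ := by
  have hd0 : 0 < d := zero_lt_one.trans_le hd
  have hD0 : 0 < D := zero_lt_one.trans_le hD
  set T := ε ^ (-(κ / α)) * d ^ (-1 / (1 + 2 * α)) * D ^ (1 / (2 * α)) with hTdef
  have hT0 : 0 < T := by positivity
  have hTα : T ^ (-α) = ε ^ κ * d ^ (α / (1 + 2 * α)) * D ^ (-(1 / 2) : ℝ) := by
    rw [hTdef, Real.mul_rpow (by positivity) (by positivity),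
      Real.mul_rpow (by positivity) (by positivity), ← Real.rpow_mul hε.le, ← Real.rpow_mul hd0.le,
      ← Real.rpow_mul hD0.le]
    congr 3 <;> field_simp
  -- For l ≥ 1 use 1 + w l ≤ 2 w l. For l = 0 the growth condition gives T < w 1 ≤ KW, and the right
  -- side is at least 1.
  have hw' : (if 1 ≤ l then (w l : ℝ) ^ (-α) else 1) ≤ (2 * KW) ^ α * T ^ (-α) := by
    have h2 : (2 * KW) ^ α * T ^ (-α) = (T / (2 * KW)) ^ (-α) := by
      rw [Real.div_rpow hT0.le (by positivity), Real.rpow_neg (by positivity : 0 ≤ 2 * KW),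
        div_inv_eq_mul, mul_comm]
    rw [h2]
    have hTpos : 0 < T / (2 * KW) := by positivity
    split_ifs with h
    · have h1 : (1 : ℝ) ≤ w l := by
        have : w 0 < w l := hw h
        exact_mod_cast (by omega : 1 ≤ w l)
      refine Real.rpow_le_rpow_of_nonpos hTpos ?_ (by linarith)
      rw [div_le_iff₀ (by positivity)]
      nlinarith
    · have hl : l = 0 := by omega
      subst hl
      rw [hw0, Nat.cast_zero, add_zero, mul_one] at hKW
      refine Real.one_le_rpow_of_pos_of_le_one_of_nonpos hTpos ?_ (by linarith)
      rw [div_le_one (by positivity)]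
      linarith
  have h3 : d ^ (α / (1 + 2 * α)) * d ^ (-(1 / 2) : ℝ) ≤ 1 := by
    rw [← Real.rpow_add hd0]
    refine Real.rpow_le_one_of_one_le_of_nonpos hd ?_
    have : α / (1 + 2 * α) ≤ 1 / 2 := by
      rw [div_le_div_iff₀ (by positivity) (by positivity)]
      linarith
    linarith
  have h4 : D ^ (-(1 / 2) : ℝ) ≤ 1 := Real.rpow_le_one_of_one_le_of_nonpos hD (by norm_num)
  calc _ ≤ (2 * KW) ^ α * T ^ (-α) * d ^ (-(1 / 2) : ℝ) := by gcongr
    _ = (2 * KW) ^ α * ε ^ κ * (d ^ (α / (1 + 2 * α)) * d ^ (-(1 / 2) : ℝ)) *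
        D ^ (-(1 / 2) : ℝ) := by
        rw [hTα]
        ring
    _ ≤ (2 * KW) ^ α * ε ^ κ * 1 * 1 := by gcongr
    _ = _ := by ring

end MLSmolyak

/-! ### Error bound, exponents, and the convergence theorem -/

namespace MLSmolyak

lemma HolFam.congr {X : Type*} [NormedAddCommGroup X] [NormedSpace ℂ X] {b : ℕ → ℝ} {ξ : ℝ}
    {δ : ENNReal} {uN vN : ∀ N : ℕ, (Fin N → ℝ) → X} (h : HolFam b ξ δ vN)
    (he : ∀ N, 0 < N → ∀ y : Fin N → ℝ, uN N y = vN N y) : HolFam b ξ δ uN where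
  consistent N M hN hM y := by
    rw [he N hN, he M (hN.trans hM)]
    exact h.consistent N M hN hM y
  extension N hN := by
    obtain ⟨φ, hφ, hφδ, hF⟩ := h.extension N hN
    refine ⟨φ, hφ, hφδ, fun ρ hρ => ?_⟩
    obtain ⟨F, hF1, hF2⟩ := hF ρ hρ
    exact ⟨F, hF1, fun y => (hF2 y).trans (he N hN y).symm⟩

section
variable {X : Type*} [NormedAddCommGroup X] [InnerProductSpace ℂ X]

/-- Holomorphy with respect to a second sequence is witnessed by the same finite-dimensional
functions. -/
lemma HolomorphicFamily.holFam_of_isHolomorphic {b₁ b₂ : ℕ → ℝ} (hb₁ : ∀ j, 0 < b₁ j)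
    (hb₂ : ∀ j, 0 < b₂ j) {p₁ p₂ : ℝ} (hp₁ : 0 < p₁) (hp₁₂ : p₁ ≤ p₂) (hp₂ : p₂ < 1)
    (hs₁ : Summable fun j => b₁ j ^ p₁) (hs₂ : Summable fun j => b₂ j ^ p₂) {ξ : ℝ} (hξ : 0 < ξ)
    {δ₁ δ₂ : ℝ} {u : (ℕ → ℝ) → X} {uN : ∀ N : ℕ, (Fin N → ℝ) → X}
    (h₁ : HolomorphicFamily b₁ ξ δ₁ u uN) (h₂ : IsHolomorphic b₂ ξ δ₂ u) :
    HolFam b₂ ξ (ENNReal.ofReal δ₂) uN := by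
  obtain ⟨vN, hv⟩ := h₂
  refine hv.holFam.congr fun N hN y => ?_
  exact h₁.holFam.eq_of_tendsto hb₁ hb₂ (hp₁.trans_le hp₁₂) hp₂
    (summable_rpow_of_le hb₁ hp₁ hs₁ hp₁₂) hs₂ hξ ENNReal.ofReal_ne_top ENNReal.ofReal_ne_top
    hv.holFam h₁.memLp.aestronglyMeasurable h₁.tendsto hv.tendsto hN y

/-- The truncation error sums a₁ with c_ν < ε^{-1/2}-type decay off Λ, that is c_ν^{-1/2} < ε^{1/2}.
The level errors on Λ are at most a constant times a₂ ν ε^κ each. Both sequences are summed without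
loss in ε. -/
lemma eLpNorm_sub_mlInterp_le [CompleteSpace X] {b : ℕ → ℝ} (hb : ∀ j, 0 < b j) {ξ : ℝ}
    (hξ : 0 < ξ) {δ : ℝ} (hδ : 0 ≤ δ) {u : (ℕ → ℝ) → X} {uN : ∀ N : ℕ, (Fin N → ℝ) → X}
    {ulN : ℕ → ∀ N : ℕ, (Fin N → ℝ) → X} (hu : HolomorphicFamily b ξ δ u uN)
    {c d : MIdx → ℝ} (hc : ∀ ν, 1 ≤ c ν) (hd : ∀ ν, 1 ≤ d ν) {a₁ a₂ : MIdx → ENNReal}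
    (ha₁ : ∀ ν, eLpNorm (detail ν (evalFin uN)) 2 gaussU ≤
      ENNReal.ofReal δ * a₁ ν * ENNReal.ofReal (c ν ^ (-(1 / 2) : ℝ)))
    {w : ℕ → ℕ} (hw : StrictMono w) (hw0 : w 0 = 0) {KW : ℝ} (hKW1 : 1 ≤ KW)
    (hKW : ∀ l, (w (l + 1) : ℝ) ≤ KW * (1 + w l)) {q α ε : ℝ} (hα : 0 < α)
    (ha₂ : ∀ l ν, eLpNorm (detail ν (evalFin fun N y => uN N y - if 1 ≤ l then ulN l N y else 0)) 2
      gaussU ≤ ENNReal.ofReal (δ * if 1 ≤ l then (w l : ℝ) ^ (-α) else 1) * a₂ ν *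
        ENNReal.ofReal (d ν ^ (-(1 / 2) : ℝ)))
    (hq : 0 ≤ q) (hε : 0 < ε) (hε1 : ε ≤ 1) {Λ : Finset MIdx} (hΛ : activeSet c ε = Λ)
    (h0 : (0 : MIdx) ∈ Λ) (hd0 : d 0 = 1) :
    eLpNorm (fun y => u y - mlInterp (constructLevels w c d q α ε) ulN y) 2 gaussU ≤
      (ENNReal.ofReal δ * ∑' ν, a₁ ν + ENNReal.ofReal (δ * (2 * KW) ^ α) * ∑' ν, a₂ ν) *
        ENNReal.ofReal (ε ^ (1 / 2 - q / 4)) := by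
  set l := constructLevels w c d q α ε with hldef
  have hl : ∀ ν ∉ Λ, l ν = 0 := fun ν hν => constructLevels_of_notMem hΛ hν
  have h1 : eLpNorm (fun y => u y - ∑ ν ∈ Λ, detail ν (evalFin uN) y) 2 gaussU ≤
      ENNReal.ofReal δ * (∑' ν, a₁ ν) * ENNReal.ofReal (ε ^ (1 / 2 - q / 4)) := by
    refine hu.holFam.eLpNorm_sub_sum_le hb hξ ENNReal.ofReal_ne_top hu.memLp.aestronglyMeasurable
      hu.tendsto ha₁ Λ fun s hs => ?_
    have hterm : ∀ ν ∈ s, ENNReal.ofReal δ * a₁ ν * ENNReal.ofReal (c ν ^ (-(1 / 2) : ℝ)) ≤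
        ENNReal.ofReal δ * a₁ ν * ENNReal.ofReal (ε ^ (1 / 2 - q / 4)) := by
      intro ν hν
      gcongr
      have hν' : ν ∉ activeSet c ε := by
        rw [hΛ]
        exact Finset.disjoint_left.1 hs hν
      have hlt : (c ν)⁻¹ < ε := not_le.1 hν'
      have hcν : 0 < c ν := zero_lt_one.trans_le (hc ν)
      rw [Real.rpow_neg hcν.le, ← Real.inv_rpow hcν.le]
      -- Truncation even yields ε^{1/2}; the exponent is lowered to 1/2 - q/4 to match the level
      -- errors.
      refine (Real.rpow_le_rpow (inv_pos.2 hcν).le hlt.le (by norm_num)).trans ?_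
      exact Real.rpow_le_rpow_of_exponent_ge hε hε1 (by linarith)
    refine (Finset.sum_le_sum hterm).trans ?_
    rw [← Finset.sum_mul, ← Finset.mul_sum]
    gcongr
    exact ENNReal.sum_le_tsum s
  set D := ∑ μ ∈ Λ, d μ ^ (-1 / (1 + 2 * α)) with hD
  have hdn : ∀ ν, 0 ≤ d ν ^ (-1 / (1 + 2 * α)) := fun ν =>
    Real.rpow_nonneg (zero_le_one.trans (hd ν)) _
  have hD1 : 1 ≤ D := by
    have := Finset.single_le_sum (f := fun μ => d μ ^ (-1 / (1 + 2 * α))) (fun ν _ => hdn ν) h0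
    simpa only [hd0, Real.one_rpow] using this
  have h2 : eLpNorm (fun y => ∑ ν ∈ Λ,
      detail ν (evalFin fun N y => uN N y - if 1 ≤ l ν then ulN (l ν) N y else 0) y) 2 gaussU ≤
      ENNReal.ofReal (δ * (2 * KW) ^ α) * (∑' ν, a₂ ν) * ENNReal.ofReal (ε ^ (1 / 2 - q / 4)) := by
    refine (eLpNorm_fun_sum_le fun ν => (continuous_detail ν _).aestronglyMeasurable).trans ?_
    have hterm : ∀ ν ∈ Λ, eLpNorm
        (detail ν (evalFin fun N y => uN N y - if 1 ≤ l ν then ulN (l ν) N y else 0)) 2 gaussU ≤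
        ENNReal.ofReal (δ * (2 * KW) ^ α) * a₂ ν * ENNReal.ofReal (ε ^ (1 / 2 - q / 4)) := by
      intro ν hν
      refine (ha₂ (l ν) ν).trans ?_
      have hT0 : 0 ≤ ε ^ (-((1 / 2 - q / 4) / α)) * d ν ^ (-1 / (1 + 2 * α)) * D ^ (1 / (2 * α)) :=
        mul_nonneg (mul_nonneg (Real.rpow_nonneg hε.le _) (hdn ν))
          (Real.rpow_nonneg (zero_le_one.trans hD1) _)
      have hT : ε ^ (-((1 / 2 - q / 4) / α)) * d ν ^ (-1 / (1 + 2 * α)) * D ^ (1 / (2 * α)) <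
          w (l ν + 1) := by
        rw [hldef, constructLevels_of_mem hΛ hν]
        exact (level_spec hw hw0 hT0).2
      have h3 := level_decay hw hw0 hKW1 (hKW (l ν)) hα hε (hd ν) hD1 hT
      have h4 : (0 : ℝ) ≤ if 1 ≤ l ν then (w (l ν) : ℝ) ^ (-α) else 1 := by
        split_ifs <;> positivity
      rw [mul_right_comm, mul_right_comm (ENNReal.ofReal (δ * (2 * KW) ^ α)),
        ← ENNReal.ofReal_mul (mul_nonneg hδ h4), ← ENNReal.ofReal_mul (by positivity)]
      gcongr ENNReal.ofReal ?_ * _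
      rw [mul_assoc, mul_assoc]
      exact mul_le_mul_of_nonneg_left h3 hδ
    refine (Finset.sum_le_sum hterm).trans ?_
    rw [← Finset.sum_mul, ← Finset.mul_sum]
    gcongr
    exact ENNReal.sum_le_tsum Λ
  have h3 : (fun y => u y - mlInterp l ulN y) =
      (fun y => u y - ∑ ν ∈ Λ, detail ν (evalFin uN) y) + fun y => ∑ ν ∈ Λ,
        detail ν (evalFin fun N y => uN N y - if 1 ≤ l ν then ulN (l ν) N y else 0) y := by
    ext y
    exact sub_mlInterp_eq hl (u y) uN ulN y
  have hm : ∀ v : MIdx → (ℕ →₀ ℝ) → X,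
      AEStronglyMeasurable (fun y => ∑ ν ∈ Λ, detail ν (v ν) y) gaussU := fun v =>
    (continuous_finsetSum _ fun ν _ => continuous_detail ν _).aestronglyMeasurable
  rw [h3, add_mul]
  exact (eLpNorm_add_le (hu.memLp.aestronglyMeasurable.sub (hm _)) (hm _) (by norm_num)).trans
    (add_le_add h1 h2)

end

lemma zero_mem_activeSet {K r : ℝ} {ρ : ℕ → ℝ} {ε : ℝ} (hε : ε ≤ 1) :
    (0 : MIdx) ∈ activeSet (weight K r ρ) ε := by
  change ε ≤ (weight K r ρ 0)⁻¹
  rwa [weight_zero, inv_one]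

/-- Each active direction multiplies the weight by at least 4. This supplies an allocation of work
at most 1 for the small budgets n. -/
lemma activeSet_one {K r : ℝ} {ρ : ℕ → ℝ} (hr : 3 ≤ r) (hK : ∀ j, 2 ≤ K * ρ j) :
    activeSet (weight K r ρ) 1 = (({0} : Finset MIdx) : Set MIdx) := by
  ext ν
  rw [Finset.coe_singleton, Set.mem_singleton_iff]
  refine ⟨fun h => ?_, fun h => h ▸ zero_mem_activeSet le_rfl⟩
  by_contra hν
  have h1 : 1 ≤ (weight K r ρ ν)⁻¹ := h
  have h2 := weight_ge_prod (K := K) (ρ := ρ) hr ν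
  have h3 : (4 : ℝ) ^ ν.support.card ≤ ∏ j ∈ ν.support, max 1 (K * ρ j) ^ 2 := by
    rw [← Finset.prod_const]
    refine Finset.prod_le_prod (fun _ _ => by norm_num) fun j _ => ?_
    have := (hK j).trans (le_max_right 1 (K * ρ j))
    nlinarith
  have h4 : (1 : ℝ) < 4 ^ ν.support.card :=
    one_lt_pow₀ (by norm_num) (Finset.card_pos.2 (Finsupp.support_nonempty_iff.2 hν)).ne'
  have h5 := inv_lt_one_of_one_lt₀ (h4.trans_le (h3.trans h2))
  linarith

lemma work_constructLevels_one_le {w : ℕ → ℕ} (hw : StrictMono w) (hw0 : w 0 = 0) {c d : MIdx → ℝ}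
    {q α : ℝ} (hΛ : activeSet c 1 = (({0} : Finset MIdx) : Set MIdx)) (hd0 : d 0 = 1) :
    work w (constructLevels w c d q α 1) ≤ 1 := by
  have hmem : (0 : MIdx) ∈ ({0} : Finset MIdx) := Finset.mem_singleton_self 0
  rw [work_eq_sum w (Λ := {0}) fun ν hν => constructLevels_of_notMem hΛ hν, Finset.sum_singleton,
    Finsupp.prod_zero_index, one_mul, constructLevels_of_mem hΛ hmem]
  simp only [Finset.sum_singleton, hd0, Real.one_rpow, mul_one]
  have h1 := (level_spec hw hw0 zero_le_one).1
  set l := sSup {j : ℕ | (w j : ℝ) ≤ 1}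
  have h2 : w l ≤ 1 := by exact_mod_cast h1
  have h3 : l ≤ w l := hw.le_apply
  rcases Nat.le_one_iff_eq_zero_or_eq_one.1 (h3.trans h2) with h | h
  · rw [h]; simp
  · rw [h] at h2 ⊢
    simpa using h2

/-- The exponent of `ε` by which the number of points on the active set is bounded. -/
noncomputable def growthExp (α p₁ p₂ : ℝ) : ℝ :=
  max 0 (1 / (2 * (1 / p₁ - 1)) * (1 - 2 * (1 / p₂ - 1) / (1 + 2 * α)))

section Exponents
variable {α p₁ p₂ : ℝ}

/-- Put x = 1/p₁ and z = 1/p₂, so that κ = (2x - 3)/(4(x - 1)). If the growth exponent vanishes, the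
quotient is α. Otherwise its denominator is (α + x - z)/(2α(x - 1)), and the quotient is the second
term of the minimum. -/
lemma rate_le (hα : 0 < α) (hp₁ : 0 < p₁) (hp₁' : p₁ < 2 / 3) (hp₁₂ : p₁ ≤ p₂) :
    min α (α * (1 / p₁ - 3 / 2) / (α + 1 / p₁ - 1 / p₂)) ≤
      (1 / 2 - p₁ / (1 - p₁) / 4) / ((1 / 2 - p₁ / (1 - p₁) / 4) / α +
        growthExp α p₁ p₂ * (1 + 1 / (2 * α))) := by
  have hx : 3 / 2 < 1 / p₁ := by
    rw [lt_div_iff₀ hp₁]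
    linarith
  have hxz : 1 / p₂ ≤ 1 / p₁ := one_div_le_one_div_of_le hp₁ hp₁₂
  have hq : p₁ / (1 - p₁) = 1 / (1 / p₁ - 1) := by
    have : 1 - p₁ ≠ 0 := by linarith
    field_simp
  rw [hq, growthExp]
  set x := 1 / p₁
  set z := 1 / p₂
  have hx1 : 0 < x - 1 := by linarith
  have hκ : 1 / 2 - 1 / (x - 1) / 4 = (2 * x - 3) / (4 * (x - 1)) := by
    field_simp
    ring
  have hκ0 : 0 < (2 * x - 3) / (4 * (x - 1)) := div_pos (by linarith) (by positivity)
  rw [hκ]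
  rcases le_total (1 / (2 * (x - 1)) * (1 - 2 * (z - 1) / (1 + 2 * α))) 0 with h | h
  · rw [max_eq_left h, zero_mul, add_zero, div_div_cancel₀ hκ0.ne']
    exact min_le_left _ _
  · rw [max_eq_right h]
    refine (min_le_right _ _).trans (le_of_eq ?_)
    have h1 : 0 < α + x - z := by linarith
    have h2 : (2 * x - 3) / (4 * (x - 1)) / α + 1 / (2 * (x - 1)) *
        (1 - 2 * (z - 1) / (1 + 2 * α)) * (1 + 1 / (2 * α)) =
        (α + x - z) / (2 * α * (x - 1)) := by
      field_simp
      ring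
    rw [h2]
    field_simp
    ring

lemma growthExp_nonneg : 0 ≤ growthExp α p₁ p₂ := le_max_left _ _

/-- The growth exponent is the least nonnegative number with this property, which is what
summability over the directions requires. -/
lemma one_le_exponents (hα : 0 < α) (hp₁ : 0 < p₁) (hp₁' : p₁ < 2 / 3) (hp₂ : 0 < p₂) :
    1 ≤ 2 * (1 / (1 + 2 * α)) * (1 - p₂) / p₂ + 2 * growthExp α p₁ p₂ * (1 - p₁) / p₁ := by
  have h1 : 0 < 1 - p₁ := by linarith
  have h2 : 1 / (2 * (1 / p₁ - 1)) * (1 - 2 * (1 / p₂ - 1) / (1 + 2 * α)) ≤ growthExp α p₁ p₂ :=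
    le_max_right _ _
  have h3 : 2 * (1 / (2 * (1 / p₁ - 1)) * (1 - 2 * (1 / p₂ - 1) / (1 + 2 * α))) * (1 - p₁) / p₁ =
      1 - 2 * (1 / (1 + 2 * α)) * (1 - p₂) / p₂ := by
    have e : 1 / p₁ - 1 = (1 - p₁) / p₁ := by field_simp
    rw [e]
    field_simp
  have h4 : 2 * (1 / (2 * (1 / p₁ - 1)) * (1 - 2 * (1 / p₂ - 1) / (1 + 2 * α))) * (1 - p₁) / p₁ ≤
      2 * growthExp α p₁ p₂ * (1 - p₁) / p₁ := by gcongr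
  linarith

/-- With x = 1/p₁ the hypothesis reads r - 3 > 2(x - 1) + (1 + 2α) + 1, and the second factor is at
least 1/(2(x - 1)) and at least 1/(1 + 2α). -/
lemma two_lt_exponents (hα : 0 < α) (hp₁ : 0 < p₁) (hp₁' : p₁ < 2 / 3) (hp₁₂ : p₁ ≤ p₂) {r : ℝ}
    (hr : 2 * (1 + (α + 1) * (p₁ / (1 - p₁))) / (p₁ / (1 - p₁)) + 3 < r) :
    2 < (r - 3) * (1 / (1 + 2 * α) + growthExp α p₁ p₂) := by
  have hxz : 1 / p₂ ≤ 1 / p₁ := one_div_le_one_div_of_le hp₁ hp₁₂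
  have hx : 3 / 2 < 1 / p₁ := by
    rw [lt_div_iff₀ hp₁]
    linarith
  have hq : p₁ / (1 - p₁) = 1 / (1 / p₁ - 1) := by
    have : 1 - p₁ ≠ 0 := by linarith
    field_simp
  rw [hq] at hr
  have h1 := le_max_right 0 (1 / (2 * (1 / p₁ - 1)) * (1 - 2 * (1 / p₂ - 1) / (1 + 2 * α)))
  have h0 : 0 ≤ growthExp α p₁ p₂ := growthExp_nonneg
  rw [← growthExp] at h1
  set t := growthExp α p₁ p₂
  set x := 1 / p₁
  set z := 1 / p₂
  set m := 1 / (1 + 2 * α) + t with hm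
  have hx1 : 0 < x - 1 := by linarith
  have hm1 : 1 / (1 + 2 * α) ≤ m := le_add_of_nonneg_right h0
  have hm2 : 1 / (2 * (x - 1)) ≤ m := by
    have : 1 / (2 * (x - 1)) * (1 - 2 * (x - 1) / (1 + 2 * α)) ≤
        1 / (2 * (x - 1)) * (1 - 2 * (z - 1) / (1 + 2 * α)) := by gcongr
    have e : 1 / (2 * (x - 1)) * (1 - 2 * (x - 1) / (1 + 2 * α)) =
        1 / (2 * (x - 1)) - 1 / (1 + 2 * α) := by
      field_simp
    linarith
  have h3 : 2 * (1 + (α + 1) * (1 / (x - 1))) / (1 / (x - 1)) = 2 * (x - 1) + 2 * (α + 1) := by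
    field_simp
  rw [h3] at hr
  have hm0 : 0 < m := lt_of_lt_of_le (by positivity) hm1
  have h5 : 1 ≤ 2 * (x - 1) * m := by
    rw [div_le_iff₀ (by positivity)] at hm2
    linarith
  have h6 : 1 ≤ (1 + 2 * α) * m := by
    rw [div_le_iff₀ (by positivity)] at hm1
    linarith
  nlinarith

end Exponents

end MLSmolyak

open MLSmolyak MeasureTheory in
/-- Convergence rate of the multilevel Smolyak interpolants with the allocation of
`constructLevels`. The families `uN` and `ulN l` are the finite-dimensional functions through which
`u` and `u^l` are evaluated; `uN` witnesses the holomorphy of `u`, and `uN - ulN l` that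
of `u - u^l`. -/
theorem theorem7p5 {X : Type*} [NormedAddCommGroup X] [InnerProductSpace ℂ X] [CompleteSpace X]
    [TopologicalSpace.SeparableSpace X]
    (w : ℕ → ℕ) (hw : WorkSequence w)
    (α p₁ p₂ ξ δ : ℝ) (hα : 0 < α) (hp₁ : 0 < p₁) (hp₁' : p₁ < 2 / 3) (hp₁₂ : p₁ ≤ p₂)
    (hp₂ : p₂ < 1) (hξ : 0 < ξ) (hδ : 0 < δ)
    (b₁ b₂ : ℕ → ℝ) (hb₁ : ∀ j, 0 < b₁ j) (hb₂ : ∀ j, 0 < b₂ j)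
    (hb₁p : Summable fun j => b₁ j ^ p₁) (hb₂p : Summable fun j => b₂ j ^ p₂)
    (u : (ℕ → ℝ) → X) (ul : ℕ → (ℕ → ℝ) → X)
    (hul : ∀ l, 1 ≤ l → MemLp (ul l) 2 gaussU)
    (uN : ∀ N : ℕ, (Fin N → ℝ) → X) (ulN : ℕ → ∀ N : ℕ, (Fin N → ℝ) → X)
    (hu₁ : HolomorphicFamily b₁ ξ δ u uN)
    (hu₂ : IsHolomorphic b₂ ξ δ u)
    (he₁ : ∀ l, 1 ≤ l →
      HolomorphicFamily b₁ ξ δ (fun y => u y - ul l y) (fun N y => uN N y - ulN l N y))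
    (he₂ : ∀ l, 1 ≤ l →
      IsHolomorphic b₂ ξ (δ * (w l : ℝ) ^ (-α)) (fun y => u y - ul l y))
    (q₁ r : ℝ) (hq₁ : q₁ = p₁ / (1 - p₁)) (hr : 2 * (1 + (α + 1) * q₁) / q₁ + 3 < r) :
    ∃ K : ℝ, 0 < K ∧ ∃ C : ℝ, 0 < C ∧ ∀ n : ℕ, 1 ≤ n → ∃ ε : ℝ, 0 < ε ∧ ε ≤ 1 ∧
      (activeSet (weight K r (rho b₁ p₁ ξ)) ε).Finite ∧
      ∃ l : MIdx → ℕ,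
        l = constructLevels w (weight K r (rho b₁ p₁ ξ)) (weight K r (rho b₂ p₂ ξ)) q₁ α ε ∧
        work w l ≤ n ∧
        eLpNorm (fun y => u y - mlInterp l ulN y) 2 gaussU ≤
          ENNReal.ofReal (C * (1 + Real.log n) *
            (n : ℝ) ^ (-(min α (α * (1 / p₁ - 3 / 2) / (α + 1 / p₁ - 1 / p₂))))) := by
  have hr3 : 3 < r := by
    have : 0 < 2 * (1 + (α + 1) * q₁) / q₁ := by
      have : 0 < q₁ := by rw [hq₁]; exact div_pos hp₁ (by linarith)
      positivity
    linarith
  have hp₂0 : 0 < p₂ := hp₁.trans_le hp₁₂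
  have hp₁1 : p₁ < 1 := by linarith
  have hq0 : 0 < q₁ := by rw [hq₁]; exact div_pos hp₁ (by linarith)
  have hq2 : q₁ < 2 := by
    rw [hq₁, div_lt_iff₀ (by linarith)]
    linarith
  -- K ϱ_{1,j} ≥ 2 is needed only for the case ε = 1; the other estimates hold for every K > 0.
  obtain ⟨K, hK, hKρ'⟩ := exists_le_mul_rho hb₁ hp₁ hp₁1 hb₁p hξ
  have hKρ := hKρ' K le_rfl
  set c := weight K r (rho b₁ p₁ ξ) with hc
  set d := weight K r (rho b₂ p₂ ξ) with hd
  have hc1 : ∀ ν, 1 ≤ c ν := one_le_weight hr3.le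
  have hd1 : ∀ ν, 1 ≤ d ν := one_le_weight hr3.le
  have hc0 : c 0 = 1 := weight_zero
  have hd0 : d 0 = 1 := weight_zero
  obtain ⟨KW, hKW1, hKW⟩ := hw.growth
  have hKW' : ∀ l, (w (l + 1) : ℝ) ≤ KW * (1 + w l) := fun l =>
    (hKW (l + 1) (Nat.le_add_left 1 l)).2.2
  obtain ⟨a₁, ha₁, ha₁'⟩ := exists_detail_bound hb₁ hp₁ hp₁1 hb₁p hξ hK hr3.le X
  obtain ⟨a₂, ha₂, ha₂'⟩ := exists_detail_bound hb₂ hp₂0 hp₂ hb₂p hξ hK hr3.le X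
  set t := growthExp α p₁ p₂ with ht
  have ht0 : 0 ≤ t := growthExp_nonneg
  set a := 1 / (1 + 2 * α) with ha
  have ha0 : 0 < a := by positivity
  have hna : -1 / (1 + 2 * α) = -a := by rw [ha, neg_div]
  obtain ⟨C₁, hC₁, hC₁'⟩ := max_rho_rpow_le hb₁ hb₁p hξ hK ht0
  obtain ⟨C₂, hC₂, hC₂'⟩ := max_rho_rpow_le hb₂ hb₂p hξ hK ha0.le
  have hsum : Summable fun ν : MIdx => ((ν.prod fun _ m => 1 + m : ℕ) : ℝ) *
      (d ν ^ (-a) * c ν ^ (-t)) := by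
    refine summable_points_mul_weights ?_ (two_lt_exponents hα hp₁ hp₁' hp₁₂ (hq₁ ▸ hr))
    have h1 := summable_rpow_mul_rpow hb₁ hb₂ hp₁ hp₂0 hb₁p hb₂p (A := 2 * a * (1 - p₂))
      (B := 2 * t * (1 - p₁)) (mul_nonneg (by positivity) (by linarith))
      (mul_nonneg (by positivity) (by linarith)) (one_le_exponents hα hp₁ hp₁' hp₂0)
    have hM : ∀ (ρ : ℕ → ℝ) (j : ℕ), (0 : ℝ) ≤ max 1 (K * ρ j) := fun ρ j =>
      le_max_of_le_left zero_le_one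
    refine Summable.of_nonneg_of_le (fun j => mul_nonneg (Real.rpow_nonneg (hM _ _) _)
      (Real.rpow_nonneg (hM _ _) _)) (fun j => ?_) (h1.mul_left (C₂ * C₁))
    refine (mul_le_mul (hC₂' j) (hC₁' j) (Real.rpow_nonneg (hM _ _) _)
      (mul_nonneg hC₂ (Real.rpow_nonneg (hb₂ j).le _))).trans (le_of_eq (by ring))
  set S := ∑' ν : MIdx, ((ν.prod fun _ m => 1 + m : ℕ) : ℝ) * (d ν ^ (-a) * c ν ^ (-t)) with hS
  have hS1 : 1 ≤ S := by
    have h1 := hsum.le_tsum 0 fun ν _ => by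
      have := hc1 ν
      have := hd1 ν
      positivity
    refine le_trans (le_of_eq ?_) h1
    rw [hd0, hc0, Finsupp.prod_zero_index]
    simp
  set κ := 1 / 2 - q₁ / 4 with hκ
  have hκ0 : 0 < κ := by linarith
  set τ := κ / α + t * (1 + 1 / (2 * α)) with hτ
  have hτ0 : 0 < τ := by positivity
  set CW := KW * S ^ (1 + 1 / (2 * α)) with hCW
  have hCW1 : 1 ≤ CW := one_le_mul_of_one_le_of_one_le hKW1 (Real.one_le_rpow hS1 (by positivity))
  set CE := ENNReal.ofReal δ * ∑' ν, a₁ ν + ENNReal.ofReal (δ * (2 * KW) ^ α) * ∑' ν, a₂ ν with hCE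
  have hCEtop : CE ≠ ⊤ := ENNReal.add_ne_top.2 ⟨ENNReal.mul_ne_top ENNReal.ofReal_ne_top ha₁,
    ENNReal.mul_ne_top ENNReal.ofReal_ne_top ha₂⟩
  have hfin : ∀ ε, 0 < ε → (activeSet c ε).Finite := fun ε hε =>
    activeSet_finite hb₁ hp₁ hp₁1 hb₁p hξ hK hr3 hε
  have herr : ∀ ε, 0 < ε → ε ≤ 1 →
      eLpNorm (fun y => u y - mlInterp (constructLevels w c d q₁ α ε) ulN y) 2 gaussU ≤
        CE * ENNReal.ofReal (ε ^ κ) := by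
    intro ε hε hε1
    refine eLpNorm_sub_mlInterp_le hb₁ hξ hδ.le hu₁ hc1 hd1 (ha₁' _ _ hu₁.holFam) hw.strictMono
      hw.zero hKW1 hKW' hα (fun l ν => ?_) hq0.le hε hε1 (hfin ε hε).coe_toFinset.symm
      ((hfin ε hε).mem_toFinset.2 (zero_mem_activeSet hε1)) hd0
    refine ha₂' _ _ ?_ ν
    -- At level 0 the approximation is zero, so the second holomorphy assumption on u itself is used
    -- there.
    split_ifs with hl
    · exact (he₁ l hl).holFam_of_isHolomorphic hb₁ hb₂ hp₁ hp₁₂ hp₂ hb₁p hb₂p hξ (he₂ l hl)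
    · simp only [sub_zero, mul_one]
      exact hu₁.holFam_of_isHolomorphic hb₁ hb₂ hp₁ hp₁₂ hp₂ hb₁p hb₂p hξ hu₂
  have hrate : min α (α * (1 / p₁ - 3 / 2) / (α + 1 / p₁ - 1 / p₂)) ≤ κ / τ := by
    rw [hτ, hκ, hq₁]
    exact rate_le hα hp₁ hp₁' hp₁₂
  set R := min α (α * (1 / p₁ - 3 / 2) / (α + 1 / p₁ - 1 / p₂)) with hR
  -- The summand 1 only ensures positivity of the constant.
  refine ⟨K, hK, CE.toReal * CW ^ (κ / τ) + 1, by positivity, fun n hn => ?_⟩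
  have hn1 : (1 : ℝ) ≤ n := by exact_mod_cast hn
  have hn0 : (0 : ℝ) < n := by linarith
  suffices h : ∃ ε, 0 < ε ∧ ε ≤ 1 ∧ ε ^ κ ≤ (CW / n) ^ (κ / τ) ∧
      work w (constructLevels w c d q₁ α ε) ≤ n by
    obtain ⟨ε, hε, hε1, hεκ, hwork⟩ := h
    refine ⟨ε, hε, hε1, hfin ε hε, _, rfl, hwork, (herr ε hε hε1).trans ?_⟩
    have hCEε : CE * ENNReal.ofReal (ε ^ κ) = ENNReal.ofReal (CE.toReal * ε ^ κ) := by
      rw [ENNReal.ofReal_mul ENNReal.toReal_nonneg, ENNReal.ofReal_toReal hCEtop]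
    rw [hCEε]
    refine ENNReal.ofReal_le_ofReal ?_
    have h1 : (CW / n) ^ (κ / τ) ≤ CW ^ (κ / τ) * (n : ℝ) ^ (-R) := by
      rw [Real.div_rpow (by linarith) hn0.le, div_eq_mul_inv, ← Real.rpow_neg hn0.le]
      gcongr
    have h2 : 1 ≤ 1 + Real.log n := le_add_of_nonneg_right (Real.log_nonneg hn1)
    calc CE.toReal * ε ^ κ ≤ CE.toReal * (CW ^ (κ / τ) * (n : ℝ) ^ (-R)) := by
          gcongr
          exact hεκ.trans h1
      _ ≤ (CE.toReal * CW ^ (κ / τ) + 1) * 1 * (n : ℝ) ^ (-R) := by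
          have := Real.rpow_nonneg hn0.le (-R)
          nlinarith
      _ ≤ _ := by gcongr
  -- The work is at most CW ε^{-τ}. For n ≥ CW, ε is chosen such that this equals n. For n < CW, ε =
  -- 1 works: only ν = 0 is active, and the target bound exceeds a constant.
  rcases le_or_gt CW n with h | h
  · have hx0 : 0 < CW / n := div_pos (by linarith) hn0
    have hε : 0 < (CW / n) ^ (1 / τ) := Real.rpow_pos_of_pos hx0 _
    refine ⟨(CW / n) ^ (1 / τ), hε,
      Real.rpow_le_one hx0.le ((div_le_one hn0).2 h) (by positivity), ?_, ?_⟩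
    · rw [← Real.rpow_mul hx0.le, one_div_mul_eq_div]
    · have hΛ := (hfin _ hε).coe_toFinset.symm
      have hP := sum_activeSet_le (a := a) (t := t) hε ht0 hc1 hd1 hΛ hsum
      rw [← hna] at hP
      have hW := work_constructLevels_le hw.strictMono hw.zero (by linarith)
        (fun l hl => (hKW l hl).1) (q := q₁) hα hε hd1 hΛ hP
      have hW' : KW * (((CW / n) ^ (1 / τ)) ^ (-((1 / 2 - q₁ / 4) / α)) *
          (((CW / n) ^ (1 / τ)) ^ (-t) * S) ^ (1 + 1 / (2 * α))) = n := by
        rw [Real.mul_rpow (Real.rpow_nonneg hε.le _) (by linarith), ← Real.rpow_mul hε.le (-t),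
          ← mul_assoc (_ ^ _), ← Real.rpow_add hε, ← hκ,
          show -(κ / α) + -t * (1 + 1 / (2 * α)) = -τ by rw [hτ]; ring, ← Real.rpow_mul hx0.le,
          show 1 / τ * -τ = -1 by field_simp, Real.rpow_neg_one, inv_div]
        calc KW * (n / CW * S ^ (1 + 1 / (2 * α))) = n / CW * CW := by rw [hCW]; ring
          _ = n := div_mul_cancel₀ _ (by linarith)
      rw [hna, ← hS, hW'] at hW
      exact_mod_cast hW
  · refine ⟨1, one_pos, le_rfl, ?_, ?_⟩
    · rw [Real.one_rpow]
      exact Real.one_le_rpow ((one_le_div hn0).2 h.le) (by positivity)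
    · exact (work_constructLevels_one_le hw.strictMono hw.zero
        (activeSet_one hr3.le hKρ) hd0).trans hn
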